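/- **Setting.** A hidden-action principal-agent problem has $n$ agent's actions $a\in\mathcal A$ and $m$ outcomes $\omega\in\Omega$. Action $a$ has a cost $c_a\in[0,1]$ and a distribution $F_a$ over outcomes, some action has cost $0$, and outcome $\omega$ has a reward $r_\omega\in[0,1]$. A contract is a vector $p\in\mathbb R^m_{\ge 0}$ of payments. Under $p$ the agent plays an action $a^\star(p)$ that maximizes $\sum_\omega F_{a,\omega}p_\omega-c_a$ and, among the maximizers, maximizes $\sum_\omega F_{a,\omega}(r_\omega-p_\omega)$; the principal's expected utility is $u(p)=\sum_\omega F_{a^\star(p),\omega}(r_\omega-p_\omega)$. In each round $t=1,\dots,T$ the principal, who does not know $F$ and $c$, commits to a contract $p^t$ and observes an outcome $\omega^t\sim F_{a^\star(p^t)}$. For $B\ge1$ the cumulative (Stackelberg) regret is $R^T=T\cdot\max_{p\in[0,B]^m}u(p)-\sum_{t=1}^T u(p^t)$. **Algorithm.** Given $n,m,r,B\ge 1,\delta\in(0,1),T\ge 1$, set $$\rho=\min\{m^{n/5}B^{3/5}m\,n^{8/5}T^{-1/5},\tfrac12\},\quad \epsilon=\frac{\rho^2}{32^2Bm^2n^2},\quad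 \eta=\frac{\epsilon\sqrt m\,n}{2},\quad \alpha=\frac{\delta}{2n^3\left[\log\frac{2Bm}{\eta}+\binom{m+n+1}{m}\right]},$$ $$q=\left\lceil\frac1{2\epsilon^2}\log\frac{2m}{\alpha}\right\rceil,\quad y=18B\epsilon mn^2+2n\eta\sqrt m,\quad \gamma=27B\epsilon mn^2+2n\eta\sqrt m .$$ The algorithm runs *Discover-and-Cover* (as far as the $T$ rounds suffice), and then commits to the contract that it returned in all remaining rounds. Discover-and-Cover keeps a set $\mathcal D$ of meta-actions and, for $d\in\mathcal D$, a set $\mathcal F[d]$ of empirical distributions and one distribution $\widetilde F_d$; initially $\mathcal D=\varnothing$. With $\mathcal P=\{p\in\mathbb R^m_{\ge0}:\|p\|_1\le mB\}$, it repeats Try-Cover until Try-Cover succeeds, and then runs Find-Contract. All arbitrary choices ("any", "take") may be made by any rule that depends on what has been observed so far. - *Action-Oracle*$(p)$: commit to $p$ for $q$ rounds; let $\widetilde F$ be the empirical distribution of the outcomes and $\mathcal D^\diamond$ the set of $d\in\mathcal D$ with $\|F-\widetilde F\|_\infty\le2\epsilon$ for some $F\in\mathcal F[d]$. If $\mathcal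 D^\diamond=\{d\}$, add $\widetilde F$ to $\mathcal F[d]$ and return $d$. Otherwise replace in $\mathcal D$ all elements of $\mathcal D^\diamond$ by one new $d^\diamond$ with $\mathcal F[d^\diamond]=\{\widetilde F\}\cup\bigcup_{d\in\mathcal D^\diamond}\mathcal F[d]$ and $\widetilde F_{d^\diamond}=\widetilde F$, and return $\bot$. Whenever $\bot$ is returned, the running Try-Cover is aborted and Try-Cover is started again. - *Try-Cover*: set $\mathcal L_d=\varnothing$, $\mathcal U_d=\mathcal P$, $\mathcal D_d=\{d\}$ for all $d\in\mathcal D$. Call Action-Oracle on any $p\in\mathcal P$; if it returns $d$, set $\mathcal L_d=\{p\}$, $\mathcal C=\{d\}$. While $\mathcal C\ne\varnothing$, take any $d_i\in\mathcal C$; as long as $\mathcal U_{d_i}\not\subseteq\mathcal L_{d_i}$, test the vertices $p$ of $\mathcal U_{d_i}$ one by one, in any order: call Action-Oracle$(p)$, giving $d_j$; if $\mathcal L_{d_j}=\varnothing$, set $\mathcal L_{d_j}=\{p\}$ and add $d_j$ to $\mathcal C$; if $d_j\in\mathcal D_{d_i}$, replace $\mathcal L_{d_i}$ by the convex hull of $\mathcal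 L_{d_i}\cup\{p\}$ and go on with the next vertex; if $d_j\notin\mathcal D_{d_i}$, call Find-HS$(d_i,p)$, which gives a halfspace $\widetilde H$ and a $d_k$, replace $\mathcal U_{d_i}$ by $\mathcal U_{d_i}\cap\widetilde H$, add $d_k$ to $\mathcal D_{d_i}$, and restart with the vertices of the new $\mathcal U_{d_i}$. When $\mathcal U_{d_i}\subseteq\mathcal L_{d_i}$, remove $d_i$ from $\mathcal C$. When $\mathcal C=\varnothing$, Try-Cover succeeds. - *Find-HS*$(d_i,p)$: let $p^1$ be any of the tested contracts that span $\mathcal L_{d_i}$ as their convex hull, $p^2=p$, $d_j=$ Action-Oracle$(p^1)$, $d_k=$ Action-Oracle$(p^2)$. While $\|p^1-p^2\|_2>\eta$, let $p'=(p^1+p^2)/2$ and $d=$ Action-Oracle$(p')$; if $\mathcal L_d=\varnothing$, set $\mathcal L_d=\{p'\}$ and add $d$ to $\mathcal C$; if $d\in\mathcal D_{d_i}$, set $(p^1,d_j)=(p',d)$, otherwise set $(p^2,d_k)=(p',d)$. Finally let $p'=(p^1+p^2)/2$ and $\Delta\widetilde c_{ik}=\Delta\widetilde c_{ij}+\sum_\omega(\widetilde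 F_{d_j,\omega}-\widetilde F_{d_k,\omega})p'_\omega$, where $\Delta\widetilde c_{ij}$ is the value found when $d_j$ was added to $\mathcal D_{d_i}$ (and $0$ if $d_j=d_i$), and return $d_k$ and $\widetilde H=\{p\in\mathbb R^m_{\ge0}:\sum_\omega(\widetilde F_{d_i,\omega}-\widetilde F_{d_k,\omega})p_\omega\ge\Delta\widetilde c_{ik}-y\}$. - *Find-Contract*: let $(d^\star,p^\star)$ maximize $\sum_\omega\widetilde F_{d,\omega}(r_\omega-p_\omega)$ over all $d\in\mathcal D$ and $p\in[0,B]^m\cap\mathcal L_d$; return $(1-\sqrt\gamma)p^\star+\sqrt\gamma\,r$. **Theorem.** There are universal constants $K>0$ and $k\in\mathbb N$ such that for all $m$, $n$, $T\ge1$, $B\ge1$, $\delta\in(0,1)$, every problem with $n$ actions and $m$ outcomes, and all rules for the arbitrary choices, with probability at least $1-\delta$ the algorithm above satisfies $$R^T\le K\cdot m^n\cdot(mnB)^k\cdot\bigl(1+\log(1/\delta)\bigr)\cdot(1+\log T)^k\cdot T^{4/5}.$$ -/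

import Mathlib

namespace HiddenAction

/-- A payment vector: one payment for each of the `m` outcomes. -/
abbrev Contract (m : ℕ) := Fin m → ℝ

/-! ### Hidden-action principal-agent problems -/

/-- A hidden-action principal-agent problem with `n` agent's actions and `m` outcomes. -/
structure Setting (m n : ℕ) where
  /-- `F a ω` is the probability of outcome `ω` under action `a` -/
  F : Fin n → Fin m → ℝ
  /-- cost of each action for the agent -/
  c : Fin n → ℝ
  /-- reward of each outcome for the principal -/
  r : Fin m → ℝ
  F_nonneg : ∀ a ω, 0 ≤ F a ω
  F_sum : ∀ a, ∑ ω, F a ω = 1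
  c_mem : ∀ a, c a ∈ Set.Icc (0 : ℝ) 1
  r_mem : ∀ ω, r ω ∈ Set.Icc (0 : ℝ) 1
  exists_free : ∃ a, c a = 0

namespace Setting

variable {m n : ℕ}

/-- Expected utility of the agent when playing `a` under the contract `p`. -/
def agentUtility (S : Setting m n) (p : Contract m) (a : Fin n) : ℝ :=
  ∑ ω, S.F a ω * p ω - S.c a

/-- Expected utility of the principal when the agent plays `a` under the contract `p`. -/
def principalUtility (S : Setting m n) (p : Contract m) (a : Fin n) : ℝ :=
  ∑ ω, S.F a ω * (S.r ω - p ω)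

/-- The set of best responses of the agent to the contract `p`. -/
def bestResponses (S : Setting m n) (p : Contract m) : Set (Fin n) :=
  {a | ∀ b, S.agentUtility p b ≤ S.agentUtility p a}

/-- `a` describes the behaviour of the agent: to every contract (with nonnegative payments) it
assigns a best response, with ties broken in favor of the principal. -/
def IsResponse (S : Setting m n) (a : Contract m → Fin n) : Prop :=
  ∀ p : Contract m, 0 ≤ p → a p ∈ S.bestResponses p ∧
    ∀ b ∈ S.bestResponses p, S.principalUtility p b ≤ S.principalUtility p (a p)

/-- The expected utility `u p` of the principal who commits to `p`. -/
def u (S : Setting m n) (a : Contract m → Fin n) (p : Contract m) : ℝ :=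
  S.principalUtility p (a p)

end Setting

/-- Contracts with payments in `[0, B]`. -/
def box (m : ℕ) (B : ℝ) : Set (Contract m) := {p | ∀ ω, 0 ≤ p ω ∧ p ω ≤ B}

/-! ### Repeated interaction -/

/-- A (deterministic) learning algorithm: given the outcomes observed in the previous rounds, in
chronological order, the contract of the current round. -/
abbrev Policy (m : ℕ) := List (Fin m) → Contract m

/-- The contract chosen by `π` in round `t`, when `w` is the sequence of outcomes. -/
def Policy.contract {m T : ℕ} (π : Policy m) (w : Fin T → Fin m) (t : Fin T) : Contract m :=
  π ((List.ofFn w).take t)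

namespace Setting

variable {m n : ℕ}

/-- Probability that the outcomes realized in `T` rounds are `w`: in round `t` the agent plays
`a (p t)` in response to the contract `p t` chosen by `π`, and the outcome is drawn from the
distribution of that action. -/
def law (S : Setting m n) (a : Contract m → Fin n) (π : Policy m) {T : ℕ} (w : Fin T → Fin m) :
    ℝ :=
  ∏ t : Fin T, S.F (a (π.contract w t)) (w t)

open Classical in
/-- Probability of an event in the interaction over `T` rounds. -/
noncomputable def prob (S : Setting m n) (a : Contract m → Fin n) (π : Policy m) {T : ℕ}
    (E : Set (Fin T → Fin m)) : ℝ :=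
  ∑ w : Fin T → Fin m, if w ∈ E then S.law a π w else 0

/-- Cumulative Stackelberg regret over `T` rounds, against the best contract in `[0, B]^m`. -/
noncomputable def regret (S : Setting m n) (a : Contract m → Fin n) (B : ℝ) (π : Policy m)
    {T : ℕ} (w : Fin T → Fin m) : ℝ :=
  T * sSup (S.u a '' box m B) - ∑ t : Fin T, S.u a (π.contract w t)

end Setting

/-! ### The Discover-and-Cover algorithm -/

/-- What Discover-and-Cover is given: the number `n` of actions, the rewards `r`, the bound `B` on
payments, the accuracy `ρ` and the confidence parameter `δ`. -/
structure Input (m : ℕ) where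
  n : ℕ
  r : Fin m → ℝ
  B : ℝ
  ρ : ℝ
  δ : ℝ

namespace Input

variable {m : ℕ}

noncomputable def eps (I : Input m) : ℝ :=
  I.ρ ^ 2 / (32 ^ 2 * I.B * (m : ℝ) ^ 2 * (I.n : ℝ) ^ 2)

noncomputable def eta (I : Input m) : ℝ := I.eps * √(m : ℝ) * I.n / 2

noncomputable def alpha (I : Input m) : ℝ :=
  I.δ / (2 * (I.n : ℝ) ^ 3 * (Real.log (2 * I.B * m / I.eta) + ((m + I.n + 1).choose m : ℝ)))

/-- Number of rounds used by one call to Action-Oracle. -/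
noncomputable def q (I : Input m) : ℕ := ⌈1 / (2 * I.eps ^ 2) * Real.log (2 * m / I.alpha)⌉₊

/-- Slack of the approximate halfspaces. -/
noncomputable def y (I : Input m) : ℝ :=
  18 * I.B * I.eps * m * (I.n : ℝ) ^ 2 + 2 * I.n * I.eta * √(m : ℝ)

/-- Weight parameter of the final contract. -/
noncomputable def gamma (I : Input m) : ℝ :=
  27 * I.B * I.eps * m * (I.n : ℝ) ^ 2 + 2 * I.n * I.eta * √(m : ℝ)

/-- The set `𝒫` of contracts to be covered. -/
def region (I : Input m) : Set (Contract m) := {p | 0 ≤ p ∧ ∑ ω, p ω ≤ m * I.B}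

end Input

/-- Control points of the algorithm. All but the last one are pending calls to Action-Oracle. -/
inductive Loc (m : ℕ) where
  /-- the first call made by Try-Cover, on the contract `p` -/
  | first (p : Contract m)
  /-- Try-Cover is processing `d`; the set `V` of vertices of `𝒰_d` is still to be tested, and
  Action-Oracle has been called on `p ∈ V` -/
  | vertex (d : ℕ) (V : Set (Contract m)) (p : Contract m)
  /-- Find-HS on `(d, p)`: call on the first endpoint `p₁` -/
  | left (d : ℕ) (p p₁ : Contract m)
  /-- Find-HS on `(d, p₂)`: call on the second endpoint `p₂`, after the one on `p₁` gave `dj` -/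
  | right (d : ℕ) (p₁ p₂ : Contract m) (dj : ℕ)
  /-- Find-HS on `d`: call on the middle point of `p₁`, `p₂`, whose meta-actions are `dj`, `dk` -/
  | middle (d : ℕ) (p₁ p₂ : Contract m) (dj dk : ℕ)
  /-- Discover-and-Cover has terminated and returned `p` -/
  | done (p : Contract m)

/-- The middle point of a segment. -/
noncomputable def midpt {m : ℕ} (p₁ p₂ : Contract m) : Contract m := fun ω => (p₁ ω + p₂ ω) / 2

/-- The contract to which the principal commits while at a given control point. -/
noncomputable def Loc.contract {m : ℕ} : Loc m → Contract m
  | .first p => p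
  | .vertex _ _ p => p
  | .left _ _ p₁ => p₁
  | .right _ _ p₂ _ => p₂
  | .middle _ p₁ p₂ _ _ => midpt p₁ p₂
  | .done p => p

/-- The variables of the algorithm. Meta-actions are natural numbers. -/
structure State (m : ℕ) where
  /-- all outcomes observed so far, most recent first -/
  seen : List (Fin m)
  /-- outcomes observed during the current call to Action-Oracle -/
  buf : List (Fin m)
  /-- the set `𝒟` of meta-actions -/
  D : Finset ℕ
  /-- the next unused name for a meta-action -/
  fresh : ℕ
  /-- the dictionary `ℱ` of empirical distributions -/
  emp : ℕ → Set (Fin m → ℝ)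
  /-- the empirical distribution `F̃_d` -/
  rep : ℕ → Fin m → ℝ
  /-- the tested contracts whose convex hull is the lower bound `ℒ_d` -/
  gen : ℕ → Set (Contract m)
  /-- the upper bound `𝒰_d` -/
  U : ℕ → Set (Contract m)
  /-- `𝒟_d`: `d` itself and the meta-actions whose halfspace has been intersected with `𝒰_d` -/
  sep : ℕ → Finset ℕ
  /-- the estimates `Δc̃_{ij}` of the differences of costs -/
  dc : ℕ → ℕ → ℝ
  /-- the set `𝒞` of meta-actions to be processed -/
  C : Finset ℕ
  /-- the control point -/
  loc : Loc m

/-- The lower bound `ℒ_d`. -/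
def State.L {m : ℕ} (s : State m) (d : ℕ) : Set (Contract m) := convexHull ℝ (s.gen d)

/-- How the algorithm makes its arbitrary choices ("take any element of"). A choice may depend on
everything observed so far. -/
structure Selection (m : ℕ) where
  point : State m → Set (Contract m) → Contract m
  point_mem : ∀ s V, V.Nonempty → point s V ∈ V
  action : State m → Finset ℕ → ℕ
  action_mem : ∀ s C, C.Nonempty → action s C ∈ C

section Algorithm

variable {m : ℕ} (I : Input m) (σ : Selection m)

/-- (Re)start of Try-Cover: its variables are initialized and Action-Oracle is called on some
contract in `𝒫`. -/
def restart (s : State m) : State m :=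
  { s with
    gen := fun _ => ∅
    U := fun _ => I.region
    sep := fun d => {d}
    dc := fun _ _ => 0
    C := ∅
    loc := .first (σ.point s I.region) }

/-- The state before the first round. -/
def startState : State m :=
  restart I σ
    { seen := [], buf := [], D := ∅, fresh := 0, emp := fun _ => ∅, rep := fun _ _ => 0,
      gen := fun _ => ∅, U := fun _ => ∅, sep := fun _ => ∅, dc := fun _ _ => 0, C := ∅,
      loc := .done 0 }

/-- Estimated utility of the principal when `p` is used and `d` is the meta-action. -/
def value (s : State m) (d : ℕ) (p : Contract m) : ℝ := ∑ ω, s.rep d ω * (I.r ω - p ω)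

/-- The contracts `p` that, together with some `d`, maximize the estimated utility of the
principal over all `d ∈ 𝒟` and `p ∈ [0, B]^m ∩ ℒ_d`. -/
def candidates (s : State m) : Set (Contract m) :=
  {p | ∃ d ∈ s.D, p ∈ box m I.B ∩ s.L d ∧
    ∀ d' ∈ s.D, ∀ p' ∈ box m I.B ∩ s.L d', value I s d' p' ≤ value I s d p}

open Classical in
/-- Find-Contract: a maximizer is moved slightly towards the rewards. (There is a maximizer
unless all the sets `[0, B]^m ∩ ℒ_d` are empty.) -/
noncomputable def findContract (s : State m) : Contract m :=
  let p : Contract m := if (candidates I s).Nonempty then σ.point s (candidates I s) else 0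
  fun ω => (1 - √I.gamma) * p ω + √I.gamma * I.r ω

/-- Start testing the vertices of `𝒰_d`. -/
def testVertices (d : ℕ) (s : State m) : State m :=
  let V := (s.U d).extremePoints ℝ
  { s with loc := .vertex d V (σ.point s V) }

open Classical in
/-- The outer loop of Try-Cover: take any meta-action in `𝒞`, until there is none left; then
Find-Contract is run. Meta-actions whose lower bound contains the upper bound are removed. -/
noncomputable def coverLoop (s : State m) : State m :=
  if h : s.C.Nonempty then
    if s.U (σ.action s s.C) ⊆ s.L (σ.action s s.C) then
      coverLoop { s with C := s.C.erase (σ.action s s.C) }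
    else testVertices σ (σ.action s s.C) s
  else { s with loc := .done (findContract I σ s) }
termination_by s.C.card
decreasing_by exact Finset.card_erase_lt_of_mem (σ.action_mem s s.C h)

open Classical in
/-- The test of the loop that processes the meta-action `d`: as long as `ℒ_d` does not fill `𝒰_d`,
the vertices of `𝒰_d` are tested; otherwise `d` is removed from `𝒞`. -/
noncomputable def closeGap (d : ℕ) (s : State m) : State m :=
  if s.U d ⊆ s.L d then coverLoop I σ { s with C := s.C.erase d } else testVertices σ d s

open Classical in
/-- If `ℒ_d` is empty, it becomes `{p}` and `d` has to be processed. -/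
noncomputable def register (d : ℕ) (p : Contract m) (s : State m) : State m :=
  if s.gen d = ∅ then
    { s with gen := Function.update s.gen d {p}, C := insert d s.C }
  else s

/-- End of the binary search of Find-HS, started on `d`, with endpoints `p₁`, `p₂`: the estimated
difference of costs and the approximate halfspace are computed, and `𝒰_d` is updated. -/
noncomputable def addHalfspace (d : ℕ) (p₁ p₂ : Contract m) (dj dk : ℕ) (s : State m) : State m :=
  let Δ : ℝ := (if dj = d then 0 else s.dc d dj) +
    ∑ ω, (s.rep dj ω - s.rep dk ω) * midpt p₁ p₂ ω
  let H : Set (Contract m) :=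
    {p | 0 ≤ p ∧ Δ - I.y ≤ ∑ ω, (s.rep d ω - s.rep dk ω) * p ω}
  { s with
    dc := Function.update s.dc d (Function.update (s.dc d) dk Δ)
    U := Function.update s.U d (s.U d ∩ H)
    sep := Function.update s.sep d (insert dk (s.sep d)) }

open Classical in
/-- The test of the binary search of Find-HS. -/
noncomputable def bisect (d : ℕ) (p₁ p₂ : Contract m) (dj dk : ℕ) (s : State m) : State m :=
  if I.eta < √(∑ ω, (p₁ ω - p₂ ω) ^ 2) then { s with loc := .middle d p₁ p₂ dj dk }
  else closeGap I σ d (addHalfspace I d p₁ p₂ dj dk s)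

open Classical in
/-- Second phase of Action-Oracle: the new empirical distribution `G` is compared with the previous
ones. The answer is a meta-action or `none`, the latter if the set of meta-actions has changed. -/
noncomputable def oracle (G : Fin m → ℝ) (s : State m) : State m × Option ℕ :=
  let near : Finset ℕ := s.D.filter fun d => ∃ F ∈ s.emp d, ‖F - G‖ ≤ 2 * I.eps
  if h : ∃ d, near = {d} then
    ({ s with emp := Function.update s.emp h.choose (insert G (s.emp h.choose)) }, some h.choose)
  else
    ({ s with
        D := insert s.fresh (s.D \ near)
        fresh := s.fresh + 1
        emp := fun d =>
          if d = s.fresh then insert G (⋃ d' ∈ near, s.emp d')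
          else if d ∈ near then ∅
          else s.emp d
        rep := Function.update s.rep s.fresh G }, none)

open Classical in
/-- What Try-Cover and Find-HS do with the answer `e` of the pending call to Action-Oracle. -/
noncomputable def resume (e : Option ℕ) (s : State m) : State m :=
  match e with
  | none => restart I σ s
  | some e =>
    match s.loc with
    | .first p => coverLoop I σ { s with gen := Function.update s.gen e {p}, C := {e} }
    | .vertex d V p =>
      let s' := register e p s
      if e ∈ s'.sep d then
        let s'' := { s' with gen := Function.update s'.gen d (insert p (s'.gen d)) }
        if (V \ {p}).Nonempty then
          { s'' with loc := .vertex d (V \ {p}) (σ.point s'' (V \ {p})) }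
        else closeGap I σ d s''
      else { s' with loc := .left d p (σ.point s' (s'.gen d)) }
    | .left d p p₁ => { s with loc := .right d p₁ p e }
    | .right d p₁ p₂ dj => bisect I σ d p₁ p₂ dj e s
    | .middle d p₁ p₂ dj dk =>
      let p' := midpt p₁ p₂
      let s' := register e p' s
      if e ∈ s'.sep d then bisect I σ d p' p₂ e dk s' else bisect I σ d p₁ p' dj e s'
    | .done p => { s with loc := .done p }

/-- Frequencies of the outcomes in a list. -/
noncomputable def frequencies (l : List (Fin m)) : Fin m → ℝ :=
  fun ω => (l.count ω : ℝ) / l.length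

open Classical in
/-- One round, in which the outcome `ω` is observed. A call to Action-Oracle is complete after
`q` rounds. -/
noncomputable def step (s : State m) (ω : Fin m) : State m :=
  let s' := { s with seen := ω :: s.seen, buf := ω :: s.buf }
  match s.loc with
  | .done _ => s'
  | _ =>
    if I.q ≤ s'.buf.length then
      let x := oracle I (frequencies s'.buf) { s' with buf := [] }
      resume I σ x.2 x.1
    else s'

/-- Discover-and-Cover, followed by a commitment forever to the contract that it returns. -/
noncomputable def discoverAndCover : Policy m := fun h =>
  (h.foldl (step I σ) (startState I σ)).loc.contract

end Algorithm

/-- The accuracy with which Discover-and-Cover is run when the horizon is `T`; it has to be less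
than one. -/
noncomputable def accuracy (m n : ℕ) (B : ℝ) (T : ℕ) : ℝ :=
  min ((m : ℝ) ^ ((n : ℝ) / 5) * B ^ (3 / 5 : ℝ) * m * (n : ℝ) ^ (8 / 5 : ℝ) *
    (T : ℝ) ^ (-(1 / 5) : ℝ)) (1 / 2)

/-- The explore-then-commit algorithm for `T` rounds. -/
noncomputable def exploreThenCommit {m : ℕ} (n : ℕ) (r : Fin m → ℝ) (B δ : ℝ) (T : ℕ)
    (σ : Selection m) : Policy m :=
  discoverAndCover { n := n, r := r, B := B, ρ := accuracy m n B T, δ := δ } σ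

end HiddenAction

/-! The regret of Discover-and-Cover is of order `T ^ (4 / 5)`.

*Clean event.* A call to Action-Oracle is accurate if the observed frequencies are within `eps` of
the distribution of the action that was played; by Hoeffding's inequality (`deviation_nil_le`) it
fails with probability at most `alpha`. Since the contracts depend on the past and the number of
calls is random, the union bound takes the form of a supermartingale (`prob_exists_not_le`): the
`risk` of a state is the probability that the current call fails, plus `alpha` for each further
call that the state allows for. As long as calls are accurate, the number of remaining calls is
bounded by `rank`, which decreases with every call (`resume_oracle_spec`) and starts at no more
than `δ / alpha` (`later_mul_alpha_le`). Hence with probability `1 - δ` the invariants `Good` hold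
in all rounds (`prob_not_good_le`).

*Meta-actions.* On the clean event a meta-action stands for a cluster: played actions that are
connected by steps of length at most `4 * eps`. Their distributions are within `4 * eps * n`, and
since each of them is a best response somewhere, their costs are close too
(`cost_sub_le_of_mem_cluster`). Different clusters stay separated, so that answers are consistent
(`OracleInv.ans_unique`), and a query that yields no answer either discovers an action or merges
clusters (`OracleInv.merge`); therefore there are fewer than `2 * n` restarts.

*Covering.* A binary search finds two close contracts at which different clusters respond, whence
the difference of their costs is known up to an error that accumulates at most `n - 1` times
(`abs_estimate_sub_le`, `Standing.error_le`). The slack `y` exceeds it, so the approximate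
halfspaces contain the true ones and the sets `𝒰_d` cover all contracts (`CoverInv.exists_mem_U`),
whereas every action of the cluster is a `2 * y`-best response throughout `ℒ_d`
(`CoverInv.utility_le_of_mem_L`). Each `𝒰_d` is a polytope with at most `(m + n).choose m`
vertices, and in a run of Try-Cover a halfspace is added at most once for each ordered pair of
meta-actions, which bounds the number of calls (`resume_spec`).

*The returned contract.* If a contract is moved towards the rewards by `√γ`, an approximately
optimal response of the agent costs the principal only little (`le_principalUtility_of_move`).
This is applied twice in `CoverInv.findContract_spec`: to the optimal contract, whose best
response may never have been discovered, and to the maximizer found by Find-Contract. The loss is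
at most `2 * ρ` per round.

*Balance.* The exploration takes `q * rank` rounds, each of regret at most `1 + m * B`, and `q` is
of order `ρ ^ (-4)`; with `ρ` of order `T ^ (-1 / 5)` both parts are of order `T ^ (4 / 5)`
(`Input.Admissible.exploration_le`, `accuracy_spec`).
-/

namespace HiddenAction

/-! ### Extreme points of polyhedra -/

section Polyhedron

variable {ι E : Type*} [Fintype ι] [AddCommGroup E] [Module ℝ E] {f : ι → E →ₗ[ℝ] ℝ} {b : ι → ℝ}

/-- At an extreme point of a polyhedron, no direction is orthogonal to all tight constraints. -/
theorem eq_zero_of_tight {x v : E} (hx : x ∈ {x | ∀ i, b i ≤ f i x}.extremePoints ℝ)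
    (hv : ∀ i, f i x = b i → f i v = 0) : v = 0 := by
  -- Slack constraints leave room for a small move in the directions `v` and `-v`.
  obtain ⟨t, ht, h⟩ : ∃ t : ℝ, 0 < t ∧ ∀ i, t * |f i v| ≤ f i x - b i := by
    have key : ∀ i, ∀ᶠ t : ℝ in nhdsWithin 0 (Set.Ioi 0), t * |f i v| ≤ f i x - b i := by
      intro i
      have h0 : b i ≤ f i x := hx.1 i
      rcases h0.eq_or_lt with h | h
      · simp [hv i h.symm, h]
      · have : Filter.Tendsto (fun t : ℝ => t * |f i v|) (nhdsWithin 0 (Set.Ioi 0)) (nhds 0) := by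
          have : Filter.Tendsto (fun t : ℝ => t * |f i v|) (nhds 0) (nhds (0 * |f i v|)) :=
            (continuous_id.mul continuous_const).tendsto 0
          rw [zero_mul] at this
          exact this.mono_left nhdsWithin_le_nhds
        exact (this.eventually (Iio_mem_nhds (sub_pos.2 h))).mono fun t ht => le_of_lt ht
    obtain ⟨t, h1, h2⟩ := ((Filter.eventually_all.2 key).and self_mem_nhdsWithin).exists
    exact ⟨t, h2, h1⟩
  have mem : ∀ s : ℝ, |s| = t → x + s • v ∈ {x | ∀ i, b i ≤ f i x} := by
    intro s hs i
    have h1 := h i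
    rw [← hs, ← abs_mul] at h1
    have h2 := neg_abs_le (s * f i v)
    simp only [map_add, map_smul, smul_eq_mul]
    linarith
  have seg : x ∈ openSegment ℝ (x + t • v) (x + (-t) • v) :=
    ⟨1 / 2, 1 / 2, by norm_num, by norm_num, by norm_num, by module⟩
  have h3 := hx.2 (mem t (abs_of_pos ht)) (mem (-t) (by rw [abs_neg, abs_of_pos ht])) seg
  have h4 : t • v = 0 := by simpa using h3
  exact (smul_eq_zero.1 h4).resolve_left ht.ne'

variable (f b) in
/-- An extreme point of a polyhedron in dimension `N` is determined by `N` tight constraints. -/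
theorem exists_tight_basis [FiniteDimensional ℝ E] {x : E}
    (hx : x ∈ {x | ∀ i, b i ≤ f i x}.extremePoints ℝ) :
    ∃ J : Finset ι, J.card = Module.finrank ℝ E ∧ (∀ i ∈ J, f i x = b i) ∧
      ∀ v, (∀ i ∈ J, f i v = 0) → v = 0 := by
  classical
  let tight := {i : ι // f i x = b i}
  -- The tight functionals span the dual space; take a basis among them.
  obtain ⟨κ, e, he, hspan, hli⟩ := exists_linearIndependent' ℝ (fun i : tight => f i)
  have htop : Submodule.span ℝ (Set.range fun i : tight => f i) = ⊤ := by
    rw [← Subspace.dualCoannihilator_dualAnnihilator_eq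
      (W := Submodule.span ℝ (Set.range fun i : tight => f i)),
      Submodule.dualAnnihilator_eq_top_iff,
      Submodule.eq_bot_iff]
    intro v hv
    refine eq_zero_of_tight hx fun i hi => ?_
    rw [Submodule.mem_dualCoannihilator] at hv
    exact hv _ (Submodule.subset_span ⟨⟨i, hi⟩, rfl⟩)
  rw [htop] at hspan
  have : Fintype κ := Fintype.ofInjective e he
  have hcard : Fintype.card κ = Module.finrank ℝ E := by
    rw [← finrank_span_eq_card hli, hspan, finrank_top, Subspace.dual_finrank_eq]
  refine ⟨Finset.univ.image fun k => (e k : ι), ?_, ?_, ?_⟩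
  · rw [Finset.card_image_of_injective _ fun k k' h => he (Subtype.ext h), Finset.card_univ, hcard]
  · intro i hi
    obtain ⟨k, -, rfl⟩ := Finset.mem_image.1 hi
    exact (e k).2
  · intro v hv
    rw [← Module.forall_dual_apply_eq_zero_iff ℝ v]
    intro φ
    have hφ : φ ∈ Submodule.span ℝ (Set.range ((fun i : tight => f i) ∘ e)) := by
      rw [hspan]; trivial
    have hle : Submodule.span ℝ (Set.range ((fun i : tight => f i) ∘ e)) ≤
        LinearMap.ker (Module.Dual.eval ℝ E v) := by
      rw [Submodule.span_le]
      rintro _ ⟨k, rfl⟩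
      exact hv _ (Finset.mem_image_of_mem _ (Finset.mem_univ k))
    exact hle hφ

variable (f b) in
/-- A polyhedron with `k` constraints in dimension `N` has at most `k.choose N` extreme points. -/
theorem extremePoints_finite_ncard [FiniteDimensional ℝ E] :
    ({x | ∀ i, b i ≤ f i x}.extremePoints ℝ).Finite ∧
    ({x | ∀ i, b i ≤ f i x}.extremePoints ℝ).ncard ≤
      (Fintype.card ι).choose (Module.finrank ℝ E) := by
  classical
  choose! J hc ht hv using fun x => exists_tight_basis f b (x := x)
  let P : Set (Finset ι) :=
    ↑(Finset.powersetCard (Module.finrank ℝ E) (Finset.univ : Finset ι))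
  have hmaps : Set.MapsTo J ({x | ∀ i, b i ≤ f i x}.extremePoints ℝ) P := fun x hx =>
    Finset.mem_coe.2 (Finset.mem_powersetCard.2 ⟨Finset.subset_univ _, hc x hx⟩)
  have hinj : Set.InjOn J ({x | ∀ i, b i ≤ f i x}.extremePoints ℝ) := by
    intro x hx y hy hxy
    refine sub_eq_zero.1 (hv x hx _ fun i hi => ?_)
    rw [map_sub, ht x hx i hi, ht y hy i (hxy ▸ hi), sub_self]
  refine ⟨Set.Finite.of_injOn hmaps hinj (Finset.finite_toSet _), ?_⟩
  refine (Set.ncard_le_ncard_of_injOn J hmaps hinj (Finset.finite_toSet _)).trans ?_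
  rw [Set.ncard_coe_finset, Finset.card_powersetCard, Finset.card_univ]

end Polyhedron

/-! ### Concentration of empirical frequencies -/

section Tail

variable {m : ℕ} (F : Fin m → ℝ) (ε : ℝ)

open Classical in
/-- Probability that, after `j` further draws from `F`, the frequencies of the outcomes deviate
from `F` by more than `ε`, given the outcomes `l` already drawn. -/
noncomputable def deviation : ℕ → List (Fin m) → ℝ
  | 0, l => if ‖frequencies l - F‖ ≤ ε then 0 else 1
  | j + 1, l => ∑ ω, F ω * deviation j (ω :: l)

variable {F ε}

theorem deviation_nonneg (hF : ∀ ω, 0 ≤ F ω) (j : ℕ) (l : List (Fin m)) :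
    0 ≤ deviation F ε j l := by
  induction j generalizing l with
  | zero => rw [deviation]; split_ifs <;> norm_num
  | succ j ih => exact Finset.sum_nonneg fun ω _ => mul_nonneg (hF ω) (ih _)

/-- Hoeffding's lemma for an indicator on a finite probability space, in both directions. -/
theorem sum_mul_exp_le (hF : ∀ ω, 0 ≤ F ω) (hs : ∑ ω, F ω = 1) (ω₀ : Fin m) (t : ℝ) :
    ∑ ω, F ω * Real.exp (t * ((if ω = ω₀ then 1 else 0) - F ω₀)) ≤ Real.exp (t ^ 2 / 8) := by
  let P : PMF (Fin m) := PMF.ofFintype (fun ω => ENNReal.ofReal (F ω)) (by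
    rw [← ENNReal.ofReal_sum_of_nonneg fun ω _ => hF ω, hs, ENNReal.ofReal_one])
  have hP : ∀ ω, (P ω).toReal = F ω := fun ω => by
    simp [P, PMF.ofFintype_apply, ENNReal.toReal_ofReal (hF ω)]
  let X : Fin m → ℝ := fun ω => if ω = ω₀ then 1 else 0
  have h1 := (ProbabilityTheory.hasSubgaussianMGF_of_mem_Icc (μ := P.toMeasure) (X := X)
    (a := 0) (b := 1) (measurable_of_finite X).aemeasurable
    (Filter.Eventually.of_forall fun ω => by
      simp only [X]; split_ifs <;> simp)).mgf_le t
  have hint : ∫ ω, X ω ∂P.toMeasure = F ω₀ := by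
    rw [PMF.integral_eq_sum]
    simp [X, hP]
  rw [ProbabilityTheory.mgf, PMF.integral_eq_sum, hint] at h1
  simp only [hP, smul_eq_mul] at h1
  refine h1.trans (le_of_eq ?_)
  congr 1
  simp
  ring

/-- Chernoff's method: the probability of a deviation is at most a sum of exponential moments,
one for each outcome and each sign. -/
theorem deviation_le (hF : ∀ ω, 0 ≤ F ω) (hs : ∑ ω, F ω = 1) (hε : 0 < ε) (j : ℕ)
    (l : List (Fin m)) (hl : 0 < j + l.length) (t : ℝ) (ht : 0 ≤ t) :
    deviation F ε j l ≤ ∑ ω₀, ∑ σ ∈ ({1, -1} : Finset ℝ),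
      Real.exp (σ * t * (l.count ω₀ - l.length * F ω₀) + j * (t ^ 2 / 8)
        - t * ((j + l.length) * ε)) := by
  induction j generalizing l with
  | zero =>
    rw [deviation]
    split_ifs with h
    · exact Finset.sum_nonneg fun _ _ => Finset.sum_nonneg fun _ _ => (Real.exp_pos _).le
    · rw [pi_norm_le_iff_of_nonneg hε.le] at h
      push Not at h
      obtain ⟨ω₀, h⟩ := h
      have hpos : (0 : ℝ) < l.length := by exact_mod_cast (by omega : 0 < l.length)
      have h2 : (l.length : ℝ) * ε < |l.count ω₀ - l.length * F ω₀| := by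
        have : (l.count ω₀ - l.length * F ω₀ : ℝ) = l.length * (frequencies l - F) ω₀ := by
          simp only [frequencies, Pi.sub_apply]
          field_simp
        rw [this, abs_mul, abs_of_pos hpos]
        exact mul_lt_mul_of_pos_left h hpos
      have h3 : ∃ σ ∈ ({1, -1} : Finset ℝ),
          (l.length : ℝ) * ε ≤ σ * (l.count ω₀ - l.length * F ω₀) := by
        rcases lt_abs.1 h2 with h | h
        · exact ⟨1, by simp, by linarith⟩
        · exact ⟨-1, by simp, by linarith⟩
      obtain ⟨σ, hσ, h3⟩ := h3
      calc (1 : ℝ) ≤ Real.exp (σ * t * (l.count ω₀ - l.length * F ω₀) + (0 : ℕ) * (t ^ 2 / 8)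
            - t * (((0 : ℕ) + l.length) * ε)) := by
            apply Real.one_le_exp
            have := mul_le_mul_of_nonneg_left h3 ht
            push_cast
            linarith
        _ ≤ _ := (Finset.single_le_sum (f := fun σ : ℝ =>
              Real.exp (σ * t * (l.count ω₀ - l.length * F ω₀) + (0 : ℕ) * (t ^ 2 / 8)
            - t * (((0 : ℕ) + l.length) * ε))) (fun _ _ => (Real.exp_pos _).le) hσ)
        _ ≤ _ := Finset.single_le_sum (f := fun ω₀ => ∑ σ ∈ ({1, -1} : Finset ℝ),
              Real.exp (σ * t * (l.count ω₀ - l.length * F ω₀) + (0 : ℕ) * (t ^ 2 / 8)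
            - t * (((0 : ℕ) + l.length) * ε)))
              (fun _ _ => Finset.sum_nonneg fun _ _ => (Real.exp_pos _).le) (Finset.mem_univ ω₀)
  | succ j ih =>
    rw [deviation]
    calc ∑ ω, F ω * deviation F ε j (ω :: l)
        ≤ ∑ ω, F ω * ∑ ω₀, ∑ σ ∈ ({1, -1} : Finset ℝ),
          Real.exp (σ * t * ((ω :: l).count ω₀ - (ω :: l).length * F ω₀) + j * (t ^ 2 / 8)
            - t * ((j + (ω :: l).length) * ε)) :=
          Finset.sum_le_sum fun ω _ =>
            mul_le_mul_of_nonneg_left (ih _ (by simp)) (hF ω)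
      _ = ∑ ω₀, ∑ σ ∈ ({1, -1} : Finset ℝ), ∑ ω, F ω *
          Real.exp (σ * t * ((ω :: l).count ω₀ - (ω :: l).length * F ω₀) + j * (t ^ 2 / 8)
            - t * ((j + (ω :: l).length) * ε)) := by
          simp only [Finset.mul_sum]
          rw [Finset.sum_comm]
          exact Finset.sum_congr rfl fun ω₀ _ => Finset.sum_comm
      _ ≤ _ := by
          refine Finset.sum_le_sum fun ω₀ _ => Finset.sum_le_sum fun σ hσ => ?_
          have hσ2 : σ ^ 2 = 1 := by
            simp only [Finset.mem_insert, Finset.mem_singleton] at hσ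
            rcases hσ with rfl | rfl <;> norm_num
          have h1 : ∀ ω, Real.exp (σ * t * ((ω :: l).count ω₀ - (ω :: l).length * F ω₀)
              + j * (t ^ 2 / 8) - t * ((j + (ω :: l).length) * ε)) =
              Real.exp (σ * t * (l.count ω₀ - l.length * F ω₀) + j * (t ^ 2 / 8)
                - t * (((j + 1 : ℕ) + l.length) * ε)) *
              Real.exp ((σ * t) * ((if ω = ω₀ then 1 else 0) - F ω₀)) := by
            intro ω
            rw [← Real.exp_add]
            congr 1
            rw [List.count_cons, List.length_cons]
            by_cases h : ω = ω₀
            · simp [h]; ring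
            · simp [h]; ring
          simp only [h1]
          calc _ = Real.exp (σ * t * (l.count ω₀ - l.length * F ω₀) + j * (t ^ 2 / 8)
                - t * (((j + 1 : ℕ) + l.length) * ε)) *
                ∑ ω, F ω * Real.exp ((σ * t) * ((if ω = ω₀ then 1 else 0) - F ω₀)) := by
                rw [Finset.mul_sum]
                exact Finset.sum_congr rfl fun ω _ => by ring
            _ ≤ _ * Real.exp ((σ * t) ^ 2 / 8) :=
                mul_le_mul_of_nonneg_left (sum_mul_exp_le hF hs ω₀ _) (Real.exp_pos _).le
            _ ≤ _ := by
                rw [← Real.exp_add, mul_pow, hσ2]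
                apply Real.exp_le_exp.2
                push_cast
                linarith

/-- Hoeffding's inequality and a union bound over the outcomes. -/
theorem deviation_nil_le (hF : ∀ ω, 0 ≤ F ω) (hs : ∑ ω, F ω = 1) (hε : 0 < ε) {j : ℕ}
    (hj : 0 < j) : deviation F ε j [] ≤ 2 * m * Real.exp (-(2 * j * ε ^ 2)) := by
  -- The exponent `j * (t ^ 2 / 8) - t * j * ε` is minimal at `t = 4 * ε`.
  refine (deviation_le hF hs hε j [] (by simpa using hj) (4 * ε) (by positivity)).trans
    (le_of_eq ?_)
  have h2 : (1 : ℝ) ≠ -1 := by norm_num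
  simp [Finset.sum_pair h2]
  ring_nf

end Tail

/-! ### Supermartingales along the interaction -/

namespace Setting

variable {m n : ℕ} (S : Setting m n) (a : Contract m → Fin n) (π : Policy m)

theorem sum_snoc {T : ℕ} (f : (Fin (T + 1) → Fin m) → ℝ) :
    ∑ w, f w = ∑ w : Fin T → Fin m, ∑ ω, f (Fin.snoc w ω) := by
  rw [← Fintype.sum_prod_type_right']
  exact Fintype.sum_equiv (Fin.snocEquiv fun _ => Fin m).symm _ _ fun w => by
    simp [Fin.snocEquiv]

theorem ofFn_snoc {T : ℕ} (w : Fin T → Fin m) (ω : Fin m) :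
    List.ofFn (Fin.snoc w ω : Fin (T + 1) → Fin m) = List.ofFn w ++ [ω] := by
  rw [List.ofFn_succ']
  simp

theorem law_snoc {T : ℕ} (w : Fin T → Fin m) (ω : Fin m) :
    S.law a π (Fin.snoc w ω : Fin (T + 1) → Fin m) =
      S.law a π w * S.F (a (π (List.ofFn w))) ω := by
  rw [law, law, Fin.prod_univ_castSucc]
  congr 1
  · refine Finset.prod_congr rfl fun t _ => ?_
    have : π.contract (Fin.snoc w ω : Fin (T + 1) → Fin m) t.castSucc = π.contract w t := by
      rw [Policy.contract, Policy.contract, ofFn_snoc, List.take_append_of_le_length]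
      · rfl
      · simp
    rw [this]
    simp
  · have : π.contract (Fin.snoc w ω : Fin (T + 1) → Fin m) (Fin.last T) = π (List.ofFn w) := by
      rw [Policy.contract, ofFn_snoc]
      simp
    rw [this]
    simp

theorem law_nonneg {T : ℕ} (w : Fin T → Fin m) : 0 ≤ S.law a π w :=
  Finset.prod_nonneg fun _ _ => S.F_nonneg _ _

theorem sum_law (T : ℕ) : ∑ w : Fin T → Fin m, S.law a π w = 1 := by
  induction T with
  | zero => simp [law]
  | succ T ih =>
    rw [sum_snoc]
    simp only [law_snoc, ← Finset.mul_sum, S.F_sum, mul_one, ih]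

variable {a π}

/-- A nonnegative supermartingale that is at least `1` outside the good histories bounds the
probability of ever leaving the good histories. -/
theorem prob_exists_not_le {G : List (Fin m) → Prop} {Ψ : List (Fin m) → ℝ}
    (h0 : ∀ h, 0 ≤ Ψ h) (hbad : ∀ h, ¬ G h → 1 ≤ Ψ h)
    (hstep : ∀ h, G h → ∑ ω, S.F (a (π h)) ω * Ψ (h ++ [ω]) ≤ Ψ h) (T : ℕ) :
    S.prob a π {w : Fin T → Fin m | ∃ t ≤ T, ¬ G ((List.ofFn w).take t)} ≤ Ψ [] := by
  classical
  -- The supermartingale is replaced by `1` as soon as the good histories have been left.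
  suffices h : ∑ w : Fin T → Fin m, S.law a π w *
      (if ∃ t ≤ T, ¬ G ((List.ofFn w).take t) then 1 else Ψ (List.ofFn w)) ≤ Ψ [] by
    refine le_trans ?_ h
    rw [prob]
    refine Finset.sum_le_sum fun w _ => ?_
    simp only [Set.mem_ofPred_eq]
    split_ifs with h
    · rw [mul_one]
    · exact mul_nonneg (S.law_nonneg a π w) (h0 _)
  induction T with
  | zero =>
    have : ∀ w : Fin 0 → Fin m, S.law a π w = 1 := fun w => by simp [law]
    simp [this]
    split_ifs with h
    · exact le_rfl
    · exact hbad _ h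
  | succ T ih =>
    refine le_trans ?_ ih
    rw [sum_snoc]
    refine Finset.sum_le_sum fun w _ => ?_
    simp only [law_snoc, mul_assoc, ← Finset.mul_sum]
    refine mul_le_mul_of_nonneg_left ?_ (S.law_nonneg a π w)
    have htake : ∀ t ≤ T, ∀ ω, (List.ofFn (Fin.snoc w ω : Fin (T + 1) → Fin m)).take t =
        (List.ofFn w).take t := fun t ht ω => by
      rw [ofFn_snoc, List.take_append_of_le_length (by simpa using ht)]
    split_ifs with h
    · obtain ⟨t, ht, hG⟩ := h
      have : ∀ ω, ∃ t ≤ T + 1, ¬ G ((List.ofFn (Fin.snoc w ω : Fin (T + 1) → Fin m)).take t) :=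
        fun ω => ⟨t, ht.trans T.le_succ, by rwa [htake t ht]⟩
      simp only [this, if_true, mul_one]
      exact (S.F_sum _).le
    · push Not at h
      have hw : G (List.ofFn w) := by
        simpa only [List.take_of_length_le (List.length_ofFn (f := w)).le] using h T le_rfl
      refine le_trans (Finset.sum_le_sum fun ω _ => ?_) (hstep _ hw)
      refine mul_le_mul_of_nonneg_left ?_ (S.F_nonneg _ _)
      split_ifs with h'
      · obtain ⟨t, ht, hG⟩ := h'
        rcases ht.eq_or_lt with rfl | ht
        · apply hbad
          rwa [List.take_of_length_le (List.length_ofFn).le, ofFn_snoc] at hG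
        · exact absurd (h t (Nat.lt_succ_iff.1 ht)) (by rwa [htake t (Nat.lt_succ_iff.1 ht)] at hG)
      · rw [ofFn_snoc]

theorem prob_ge_of_forall {δ : ℝ} {T : ℕ} {E A : Set (Fin T → Fin m)} (hA : S.prob a π A ≤ δ)
    (h : ∀ w, w ∉ A → w ∈ E) : 1 - δ ≤ S.prob a π E := by
  classical
  have h1 : ∑ w : Fin T → Fin m, S.law a π w ≤ S.prob a π A + S.prob a π E := by
    rw [prob, prob, ← Finset.sum_add_distrib]
    refine Finset.sum_le_sum fun w _ => ?_
    have := S.law_nonneg a π w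
    by_cases hw : w ∈ A
    · simp only [hw, if_true]; split_ifs <;> linarith
    · simp [hw, h w hw]
  rw [sum_law] at h1
  linarith

end Setting

/-! ### Clusters of actions -/

/-- Actions are adjacent if their outcome distributions are at distance at most `4 * ε`. -/
def Setting.actionGraph {m n : ℕ} (S : Setting m n) (ε : ℝ) : SimpleGraph (Fin n) where
  Adj x y := x ≠ y ∧ ‖S.F x - S.F y‖ ≤ 4 * ε
  symm := ⟨fun x y h => ⟨h.1.symm, by rw [norm_sub_rev]; exact h.2⟩⟩
  loopless := ⟨fun _ h => h.1 rfl⟩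

theorem Setting.reachable_of_norm_le {m n : ℕ} (S : Setting m n) {ε : ℝ} {x y : Fin n}
    (h : ‖S.F x - S.F y‖ ≤ 4 * ε) : (S.actionGraph ε).Reachable x y := by
  by_cases hxy : x = y
  · rw [hxy]
  · exact SimpleGraph.Adj.reachable ⟨hxy, h⟩

/-- A path in the graph of actions has at most `n - 1` edges. -/
theorem Setting.norm_sub_le_of_reachable {m n : ℕ} (S : Setting m n) {ε : ℝ} (hε : 0 ≤ ε)
    {x y : Fin n} (h : (S.actionGraph ε).Reachable x y) :
    ‖S.F x - S.F y‖ ≤ 4 * ε * (n - 1) := by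
  classical
  obtain ⟨p⟩ := h
  have h1 : ∀ {x y : Fin n} (p : (S.actionGraph ε).Walk x y),
      ‖S.F x - S.F y‖ ≤ 4 * ε * p.length := by
    intro x y p
    induction p with
    | nil => simp
    | cons h p ih =>
      have := norm_sub_le_norm_sub_add_norm_sub (S.F _) (S.F _) (S.F _) |>.trans
        (add_le_add h.2 ih)
      refine this.trans (le_of_eq ?_)
      rw [SimpleGraph.Walk.length_cons]
      push_cast
      ring
  refine (h1 p.toPath.1).trans (mul_le_mul_of_nonneg_left ?_ (by positivity))
  have := p.toPath.2.length_lt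
  rw [Fintype.card_fin] at this
  rw [le_sub_iff_add_le]
  exact_mod_cast this

/-- Estimates of expected payments of contracts in the region are off by at most `4 * beta`. -/
noncomputable def Input.beta {m : ℕ} (I : Input m) : ℝ := I.eps * I.n * (m * I.B)

theorem abs_sum_mul_le {m : ℕ} {I : Input m} {p : Contract m} (hp : p ∈ I.region)
    (v : Fin m → ℝ) {x : ℝ} (hv : ‖v‖ ≤ x) : |∑ ω, v ω * p ω| ≤ x * (m * I.B) := by
  calc |∑ ω, v ω * p ω| ≤ ∑ ω, |v ω * p ω| := Finset.abs_sum_le_sum_abs _ _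
    _ ≤ ∑ ω, x * p ω := Finset.sum_le_sum fun ω _ => by
        rw [abs_mul, abs_of_nonneg (hp.1 ω)]
        exact mul_le_mul_of_nonneg_right ((norm_le_pi_norm v ω).trans hv) (hp.1 ω)
    _ = x * ∑ ω, p ω := by rw [Finset.mul_sum]
    _ ≤ _ := mul_le_mul_of_nonneg_left hp.2 ((norm_nonneg v).trans hv)

section

variable {m : ℕ} (I : Input m) (S : Setting m I.n) (a : Contract m → Fin I.n)

/-- The actions that are associated with a meta-action whose empirical distribution is `G`: they
are played in response to some contract of the region, and they are connected in the graph of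
actions to an action whose distribution is close to `G`. -/
def cluster (G : Fin m → ℝ) : Set (Fin I.n) :=
  {b | (∃ p ∈ I.region, a p = b) ∧
    ∃ b', ‖G - S.F b'‖ ≤ I.eps ∧ (S.actionGraph I.eps).Reachable b' b}

variable {I S a}

theorem norm_sub_le_of_mem_cluster (hε : 0 ≤ I.eps) {G : Fin m → ℝ} {b : Fin I.n}
    (hb : b ∈ cluster I S a G) : ‖G - S.F b‖ ≤ 4 * I.eps * I.n := by
  obtain ⟨-, b', h1, h2⟩ := hb
  have := norm_sub_le_norm_sub_add_norm_sub G (S.F b') (S.F b) |>.trans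
    (add_le_add h1 (S.norm_sub_le_of_reachable hε h2))
  linarith

theorem norm_F_sub_le {G : Fin m → ℝ} {b b' : Fin I.n} {x y : ℝ} (h : ‖G - S.F b‖ ≤ x)
    (h' : ‖G - S.F b'‖ ≤ y) : ‖S.F b - S.F b'‖ ≤ x + y := by
  rw [norm_sub_rev] at h
  exact norm_sub_le_norm_sub_add_norm_sub _ _ _ |>.trans (add_le_add h h')

theorem norm_F_sub_le_of_mem_cluster (hε : 0 ≤ I.eps) {G : Fin m → ℝ} {b b' : Fin I.n}
    (hb : b ∈ cluster I S a G) (hb' : b' ∈ cluster I S a G) :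
    ‖S.F b - S.F b'‖ ≤ 4 * I.eps * I.n := by
  obtain ⟨-, c, h1, h2⟩ := hb
  obtain ⟨-, c', h1', h2'⟩ := hb'
  have h3 : (S.actionGraph I.eps).Reachable c c' :=
    S.reachable_of_norm_le ((norm_F_sub_le h1 h1').trans (by linarith))
  refine (S.norm_sub_le_of_reachable hε (h2.symm.trans (h3.trans h2'))).trans ?_
  linarith

theorem Setting.IsResponse.le {n : ℕ} {S : Setting m n} {a : Contract m → Fin n}
    (ha : S.IsResponse a) {p : Contract m} (hp : 0 ≤ p) (b : Fin n) :
    ∑ ω, S.F b ω * p ω - S.c b ≤ ∑ ω, S.F (a p) ω * p ω - S.c (a p) := (ha p hp).1 b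

theorem sum_sub_mul {m : ℕ} (f g p : Fin m → ℝ) :
    ∑ ω, (f ω - g ω) * p ω = ∑ ω, f ω * p ω - ∑ ω, g ω * p ω := by
  simp only [sub_mul, Finset.sum_sub_distrib]

theorem abs_sum_sub_le {p : Contract m} (hp : p ∈ I.region) {f g : Fin m → ℝ}
    (h : ‖f - g‖ ≤ 4 * I.eps * I.n) :
    |∑ ω, f ω * p ω - ∑ ω, g ω * p ω| ≤ 4 * I.beta := by
  rw [← sum_sub_mul]
  refine (abs_sum_mul_le hp (f - g) h).trans (le_of_eq ?_)
  rw [Input.beta]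
  ring

/-- Close actions that are both played have close costs. -/
theorem cost_sub_le_of_mem_cluster (hε : 0 ≤ I.eps) (ha : S.IsResponse a) {G : Fin m → ℝ}
    {b b' : Fin I.n} (hb : b ∈ cluster I S a G) (hb' : b' ∈ cluster I S a G) :
    S.c b - S.c b' ≤ 4 * I.beta := by
  have h := norm_F_sub_le_of_mem_cluster hε hb hb'
  obtain ⟨⟨p, hp, rfl⟩, -⟩ := hb
  have h1 := (abs_le.1 (abs_sum_sub_le hp h)).2
  have h2 := ha.le hp.1 b'
  linarith

theorem utility_le_of_mem_cluster (hε : 0 ≤ I.eps) (ha : S.IsResponse a) {G : Fin m → ℝ}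
    {b b' : Fin I.n} (hb : b ∈ cluster I S a G) (hb' : b' ∈ cluster I S a G) {p : Contract m}
    (hp : p ∈ I.region) :
    ∑ ω, S.F b ω * p ω - S.c b ≤ ∑ ω, S.F b' ω * p ω - S.c b' + 8 * I.beta := by
  have h := norm_F_sub_le_of_mem_cluster hε hb hb'
  have h1 := (abs_le.1 (abs_sum_sub_le hp h)).2
  have h2 := cost_sub_le_of_mem_cluster hε ha hb' hb
  linarith

/-! ### Action-Oracle on the clean event -/

variable (I S a)

/-- The meta-action `d` is a correct answer to a query of `p`. -/
def Ans (s : State m) (d : ℕ) (p : Contract m) : Prop :=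
  d ∈ s.D ∧ ∃ G ∈ s.emp d, ‖G - S.F (a p)‖ ≤ I.eps

open Classical in
/-- The actions that are close to an observed empirical distribution. -/
noncomputable def known (s : State m) : Finset (Fin I.n) :=
  Finset.univ.filter fun b => ∃ d ∈ s.D, ∃ G ∈ s.emp d, ‖G - S.F b‖ ≤ I.eps

/-- The properties of meta-actions that hold as long as all empirical distributions are close to
the true ones. Different meta-actions are far `apart`, while the actions close to distributions of
the same meta-action are `linked` in the graph of actions. Each merge increases `s.fresh` by one and
either decreases the number of meta-actions or discovers an action, which bounds the number of
merges (`card_add_fresh_le`). -/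
structure OracleInv (s : State m) : Prop where
  lt_fresh : ∀ d ∈ s.D, d < s.fresh
  rep_mem : ∀ d ∈ s.D, s.rep d ∈ s.emp d
  apart : ∀ d ∈ s.D, ∀ d' ∈ s.D, d ≠ d' → ∀ G ∈ s.emp d, ∀ G' ∈ s.emp d', 2 * I.eps < ‖G - G'‖
  played : ∀ d ∈ s.D, ∀ G ∈ s.emp d, ∃ p ∈ I.region, ‖G - S.F (a p)‖ ≤ I.eps
  linked : ∀ d ∈ s.D, ∀ G ∈ s.emp d, ∀ G' ∈ s.emp d, ∀ b b', ‖G - S.F b‖ ≤ I.eps →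
    ‖G' - S.F b'‖ ≤ I.eps → (S.actionGraph I.eps).Reachable b b'
  card_add_fresh_le : s.D.card + s.fresh ≤ 2 * (known I S s).card

/-- The two states agree in everything that concerns Action-Oracle. -/
structure SameData (s s' : State m) : Prop where
  D : s'.D = s.D
  fresh : s'.fresh = s.fresh
  emp : s'.emp = s.emp
  rep : s'.rep = s.rep
  buf : s'.buf = s.buf

variable {I S a}

theorem SameData.refl (s : State m) : SameData s s := ⟨rfl, rfl, rfl, rfl, rfl⟩

theorem SameData.trans {s s' s'' : State m} (h : SameData s s') (h' : SameData s' s'') :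
    SameData s s'' :=
  ⟨h'.D.trans h.D, h'.fresh.trans h.fresh, h'.emp.trans h.emp, h'.rep.trans h.rep,
    h'.buf.trans h.buf⟩

theorem known_congr {s s' : State m} (hD : s'.D = s.D) (he : s'.emp = s.emp) :
    known I S s' = known I S s := by
  rw [known, known, hD, he]

theorem OracleInv.congr {s s' : State m} (h : OracleInv I S a s) (hD : s'.D = s.D)
    (hf : s'.fresh = s.fresh) (he : s'.emp = s.emp) (hr : s'.rep = s.rep) :
    OracleInv I S a s' := by
  obtain ⟨h1, h2, h3, h4, h5, h6⟩ := h
  rw [← known_congr hD he] at h6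
  rw [← hD, ← hf] at h1 h6
  rw [← hD, ← he] at h3 h4 h5
  rw [← hD, ← he, ← hr] at h2
  exact ⟨h1, h2, h3, h4, h5, h6⟩

theorem OracleInv.of_sameData {s s' : State m} (h : OracleInv I S a s) (hs : SameData s s') :
    OracleInv I S a s' := h.congr hs.D hs.fresh hs.emp hs.rep

/-- The action behind a correct answer belongs to the cluster of that answer. -/
theorem OracleInv.mem_cluster {s : State m} (h : OracleInv I S a s) {d : ℕ} {p : Contract m}
    (hp : p ∈ I.region) (hA : Ans I S a s d p) : a p ∈ cluster I S a (s.rep d) := by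
  obtain ⟨hd, G, hG, hGp⟩ := hA
  obtain ⟨p', hp', hr⟩ := h.played d hd _ (h.rep_mem d hd)
  exact ⟨⟨p, hp, rfl⟩, a p', hr, h.linked d hd _ (h.rep_mem d hd) _ hG _ _ hr hGp⟩

theorem OracleInv.cluster_nonempty {s : State m} (h : OracleInv I S a s) {d : ℕ}
    (hd : d ∈ s.D) : (cluster I S a (s.rep d)).Nonempty := by
  obtain ⟨p', hp', hr⟩ := h.played d hd _ (h.rep_mem d hd)
  exact ⟨a p', ⟨p', hp', rfl⟩, a p', hr, SimpleGraph.Reachable.refl _⟩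

theorem norm_sub_le_of_close {G G' : Fin m → ℝ} {b : Fin I.n} {x y : ℝ} (h : ‖G - S.F b‖ ≤ x)
    (h' : ‖G' - S.F b‖ ≤ y) : ‖G - G'‖ ≤ x + y := by
  rw [norm_sub_rev] at h'
  exact norm_sub_le_norm_sub_add_norm_sub _ _ _ |>.trans (add_le_add h h')

/-- Correct answers are unique, because meta-actions are far apart. -/
theorem OracleInv.ans_unique {s : State m} (h : OracleInv I S a s) {d d' : ℕ} {p : Contract m}
    (hA : Ans I S a s d p) (hA' : Ans I S a s d' p) : d = d' := by
  obtain ⟨hd, G, hG, hGp⟩ := hA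
  obtain ⟨hd', G', hG', hGp'⟩ := hA'
  by_contra hne
  have := h.apart d hd d' hd' hne G hG G' hG'
  linarith [norm_sub_le_of_close hGp hGp']

theorem Ans.mono {s s' : State m} {d : ℕ} {p : Contract m} (h : Ans I S a s d p)
    (hD : s'.D = s.D) (he : ∀ d, s.emp d ⊆ s'.emp d) : Ans I S a s' d p := by
  obtain ⟨hd, G, hG, hGp⟩ := h
  exact ⟨hD ▸ hd, G, he d hG, hGp⟩

theorem OracleInv.card_le_fresh {s : State m} (h : OracleInv I S a s) :
    s.D.card ≤ s.fresh := by
  rw [← Finset.card_range s.fresh]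
  exact Finset.card_le_card fun d hd => Finset.mem_range.2 (h.lt_fresh d hd)

theorem card_known_le (s : State m) : (known I S s).card ≤ I.n :=
  (Finset.card_le_univ _).trans (Fintype.card_fin _).le

theorem OracleInv.card_add_fresh_le' {s : State m} (h : OracleInv I S a s) :
    s.D.card + s.fresh ≤ 2 * I.n :=
  h.card_add_fresh_le.trans (Nat.mul_le_mul_left 2 (card_known_le s))

theorem OracleInv.card_le {s : State m} (h : OracleInv I S a s) : s.D.card ≤ I.n := by
  have h1 := h.card_le_fresh
  have h2 := h.card_add_fresh_le'
  omega

theorem link_self {G : Fin m → ℝ} (hε : 0 ≤ I.eps) {b b' : Fin I.n} (hG : ‖G - S.F b‖ ≤ I.eps)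
    (hb : ‖G - S.F b'‖ ≤ I.eps) : (S.actionGraph I.eps).Reachable b b' :=
  S.reachable_of_norm_le ((norm_F_sub_le hG hb).trans (by linarith))

theorem OracleInv.link_near {s : State m} (h : OracleInv I S a s) {d : ℕ} (hd : d ∈ s.D)
    {G H : Fin m → ℝ} {b b' : Fin I.n} (hn : ∃ F ∈ s.emp d, ‖F - G‖ ≤ 2 * I.eps)
    (hG : ‖G - S.F b'‖ ≤ I.eps) (hH : H ∈ s.emp d) (hb : ‖H - S.F b‖ ≤ I.eps) :
    (S.actionGraph I.eps).Reachable b b' := by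
  obtain ⟨F, hF, hFG⟩ := hn
  obtain ⟨p', -, hFp⟩ := h.played d hd F hF
  refine (h.linked d hd H hH F hF b _ hb hFp).trans (S.reachable_of_norm_le ?_)
  rw [norm_sub_rev] at hFp
  have h1 := norm_sub_le_norm_sub_add_norm_sub (S.F (a p')) F G
  have h2 := norm_sub_le_norm_sub_add_norm_sub (S.F (a p')) G (S.F b')
  linarith

open Classical in
/-- The meta-actions with an empirical distribution close to `G`. -/
noncomputable def nearby (I : Input m) (G : Fin m → ℝ) (s : State m) : Finset ℕ :=
  s.D.filter fun d => ∃ F ∈ s.emp d, ‖F - G‖ ≤ 2 * I.eps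

theorem mem_nearby {G : Fin m → ℝ} {s : State m} {d : ℕ} :
    d ∈ nearby I G s ↔ d ∈ s.D ∧ ∃ F ∈ s.emp d, ‖F - G‖ ≤ 2 * I.eps := by
  classical
  simp [nearby]

theorem mem_nearby_of_ans {G : Fin m → ℝ} {s : State m} {d : ℕ} {p : Contract m}
    (hG : ‖G - S.F (a p)‖ ≤ I.eps) (h : Ans I S a s d p) : d ∈ nearby I G s := by
  obtain ⟨hd, G', hG', hGp'⟩ := h
  refine mem_nearby.2 ⟨hd, G', hG', (norm_sub_le_of_close hGp' hG).trans (by linarith)⟩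

theorem not_near {G : Fin m → ℝ} {s : State m} {d : ℕ} (hd : d ∈ s.D) (hn : d ∉ nearby I G s)
    {H : Fin m → ℝ} (hH : H ∈ s.emp d) : 2 * I.eps < ‖H - G‖ := by
  by_contra! h
  exact hn (mem_nearby.2 ⟨hd, H, hH, h⟩)

/-- The invariant is preserved when the result of a query is attributed to the only meta-action
that is close to it. -/
theorem OracleInv.insertEmp {s : State m} (h : OracleInv I S a s) (hε : 0 ≤ I.eps) {p : Contract m}
    (hp : p ∈ I.region) {G : Fin m → ℝ} (hG : ‖G - S.F (a p)‖ ≤ I.eps) {d : ℕ}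
    (hd : nearby I G s = {d}) :
    OracleInv I S a { s with emp := Function.update s.emp d (insert G (s.emp d)) } := by
  have hmem : d ∈ s.D ∧ ∃ F ∈ s.emp d, ‖F - G‖ ≤ 2 * I.eps := by
    rw [← mem_nearby, hd]; simp
  have hnot : ∀ d' ≠ d, d' ∉ nearby I G s := by
    intro d' hne; rw [hd]; simpa using hne
  have hsub : ∀ d', s.emp d' ⊆ Function.update s.emp d (insert G (s.emp d)) d' := by
    intro d'
    by_cases hdd : d' = d
    · subst hdd; simp
    · simp [hdd]
  have hcases : ∀ d' H, H ∈ Function.update s.emp d (insert G (s.emp d)) d' →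
      H ∈ s.emp d' ∨ (d' = d ∧ H = G) := by
    intro d' H hH
    by_cases hdd : d' = d
    · subst hdd
      rw [Function.update_self] at hH
      rcases hH with hH | hH
      · exact Or.inr ⟨rfl, hH⟩
      · exact Or.inl hH
    · rw [Function.update_of_ne hdd] at hH
      exact Or.inl hH
  refine ⟨h.lt_fresh, fun d' hd' => hsub d' (h.rep_mem d' hd'), ?_, ?_, ?_, ?_⟩
  · intro d₁ h₁ d₂ h₂ hne G₁ hG₁ G₂ hG₂
    rcases hcases _ _ hG₁ with hH₁ | ⟨rfl, rfl⟩ <;> rcases hcases _ _ hG₂ with hH₂ | ⟨rfl, rfl⟩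
    · exact h.apart d₁ h₁ d₂ h₂ hne G₁ hH₁ G₂ hH₂
    · exact not_near (s := s) h₁ (hnot _ hne) hH₁
    · rw [norm_sub_rev]; exact not_near (s := s) h₂ (hnot _ hne.symm) hH₂
    · exact absurd rfl hne
  · intro d' hd' H hH
    rcases hcases _ _ hH with hH | ⟨rfl, rfl⟩
    · exact h.played d' hd' H hH
    · exact ⟨p, hp, hG⟩
  · intro d' hd' G₁ hG₁ G₂ hG₂ b₁ b₂ hb₁ hb₂
    rcases hcases _ _ hG₁ with hH₁ | ⟨rfl, rfl⟩ <;> rcases hcases _ _ hG₂ with hH₂ | ⟨h', h''⟩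
    · exact h.linked d' hd' _ hH₁ _ hH₂ _ _ hb₁ hb₂
    · subst h' h''
      exact h.link_near hd' hmem.2 hb₂ hH₁ hb₁
    · exact (h.link_near hd' hmem.2 hb₁ hH₂ hb₂).symm
    · subst h''
      exact link_self hε hb₁ hb₂
  · refine h.card_add_fresh_le.trans (Nat.mul_le_mul_left 2 (Finset.card_le_card ?_))
    intro b hb
    simp only [known, Finset.mem_filter, Finset.mem_univ, true_and] at hb ⊢
    obtain ⟨d', hd', G', hG', hb⟩ := hb
    exact ⟨d', hd', G', hsub d' hG', hb⟩

/-- The invariant is preserved when the meta-actions close to the result of a query are merged. -/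
theorem OracleInv.merge {s : State m} (h : OracleInv I S a s) (hε : 0 ≤ I.eps) {p : Contract m}
    (hp : p ∈ I.region) {G : Fin m → ℝ} (hG : ‖G - S.F (a p)‖ ≤ I.eps)
    (hne : ¬ ∃ d, nearby I G s = {d}) {s' : State m}
    (hD : s'.D = insert s.fresh (s.D \ nearby I G s)) (hfresh : s'.fresh = s.fresh + 1)
    (hrep : s'.rep = Function.update s.rep s.fresh G)
    (hemp₀ : s'.emp s.fresh = insert G (⋃ d' ∈ nearby I G s, s.emp d'))
    (hemp : ∀ d ∈ s.D, d ∉ nearby I G s → s'.emp d = s.emp d) : OracleInv I S a s' := by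
  have hDmem : ∀ d, d ∈ s'.D ↔ d = s.fresh ∨ (d ∈ s.D ∧ d ∉ nearby I G s) := by
    intro d; rw [hD, Finset.mem_insert, Finset.mem_sdiff]
  have hfr : s.fresh ∉ s.D := fun h' => lt_irrefl _ (h.lt_fresh _ h')
  have hcases : ∀ H, H ∈ s'.emp s.fresh →
      H = G ∨ ∃ d ∈ s.D, (∃ F ∈ s.emp d, ‖F - G‖ ≤ 2 * I.eps) ∧ d ∈ nearby I G s ∧
        H ∈ s.emp d := by
    intro H hH
    rw [hemp₀] at hH
    rcases hH with hH | hH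
    · exact Or.inl hH
    · simp only [Set.mem_iUnion] at hH
      obtain ⟨d, hd, hH⟩ := hH
      exact Or.inr ⟨d, (mem_nearby.1 hd).1, (mem_nearby.1 hd).2, hd, hH⟩
  have hlink : ∀ H ∈ s'.emp s.fresh, ∀ b, ‖H - S.F b‖ ≤ I.eps →
      (S.actionGraph I.eps).Reachable b (a p) := by
    intro H hH b hb
    rcases hcases H hH with rfl | ⟨d, hd, hn, -, hH⟩
    · exact link_self hε hb hG
    · exact h.link_near hd hn hG hH hb
  have hsep : ∀ d ∈ s.D, d ∉ nearby I G s → ∀ H ∈ s.emp d, ∀ H' ∈ s'.emp s.fresh,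
      2 * I.eps < ‖H - H'‖ := by
    intro d hd hn H hH H' hH'
    rcases hcases H' hH' with rfl | ⟨d', hd', -, hn', hH'⟩
    · exact not_near hd hn hH
    · exact h.apart d hd d' hd' (fun e => hn (e ▸ hn')) H hH H' hH'
  refine ⟨?_, ?_, ?_, ?_, ?_, ?_⟩
  · intro d hd
    rw [hfresh]
    rcases (hDmem d).1 hd with rfl | ⟨hd, -⟩
    · omega
    · have := h.lt_fresh d hd; omega
  · intro d hd
    rcases (hDmem d).1 hd with rfl | ⟨hd, hn⟩
    · rw [hrep, Function.update_self, hemp₀]; exact Set.mem_insert _ _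
    · rw [hrep, Function.update_of_ne (fun e : d = s.fresh => hfr (e ▸ hd)), hemp d hd hn]
      exact h.rep_mem d hd
  · intro d₁ h₁ d₂ h₂ hne G₁ hG₁ G₂ hG₂
    rcases (hDmem d₁).1 h₁ with rfl | ⟨h₁, hn₁⟩ <;> rcases (hDmem d₂).1 h₂ with rfl | ⟨h₂, hn₂⟩
    · exact absurd rfl hne
    · rw [hemp d₂ h₂ hn₂] at hG₂
      rw [norm_sub_rev]
      exact hsep d₂ h₂ hn₂ G₂ hG₂ G₁ hG₁
    · rw [hemp d₁ h₁ hn₁] at hG₁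
      exact hsep d₁ h₁ hn₁ G₁ hG₁ G₂ hG₂
    · rw [hemp d₁ h₁ hn₁] at hG₁
      rw [hemp d₂ h₂ hn₂] at hG₂
      exact h.apart d₁ h₁ d₂ h₂ hne G₁ hG₁ G₂ hG₂
  · intro d hd H hH
    rcases (hDmem d).1 hd with rfl | ⟨hd, hn⟩
    · rcases hcases H hH with rfl | ⟨d', hd', -, -, hH⟩
      · exact ⟨p, hp, hG⟩
      · exact h.played d' hd' H hH
    · rw [hemp d hd hn] at hH
      exact h.played d hd H hH
  · intro d hd G₁ hG₁ G₂ hG₂ b₁ b₂ hb₁ hb₂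
    rcases (hDmem d).1 hd with rfl | ⟨hd, hn⟩
    · exact (hlink G₁ hG₁ b₁ hb₁).trans (hlink G₂ hG₂ b₂ hb₂).symm
    · rw [hemp d hd hn] at hG₁ hG₂
      exact h.linked d hd _ hG₁ _ hG₂ _ _ hb₁ hb₂
  · have hcard : s'.D.card + (nearby I G s).card = s.D.card + 1 := by
      have hsub : nearby I G s ⊆ s.D := fun d hd => (mem_nearby.1 hd).1
      have h1 := Finset.card_sdiff_add_card_eq_card hsub
      rw [hD, Finset.card_insert_of_notMem fun h' => hfr (Finset.mem_sdiff.1 h').1]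
      omega
    have hknown : known I S s ⊆ known I S s' := by
      intro b hb
      simp only [known, Finset.mem_filter, Finset.mem_univ, true_and] at hb ⊢
      obtain ⟨d, hd, H, hH, hb⟩ := hb
      by_cases hn : d ∈ nearby I G s
      · refine ⟨s.fresh, (hDmem _).2 (Or.inl rfl), H, ?_, hb⟩
        rw [hemp₀]
        exact Set.mem_insert_of_mem _ (Set.mem_biUnion hn hH)
      · exact ⟨d, (hDmem _).2 (Or.inr ⟨hd, hn⟩), H, by rwa [hemp d hd hn], hb⟩
    have h6 := h.card_add_fresh_le
    have hle := Finset.card_le_card hknown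
    rcases Nat.lt_or_ge (nearby I G s).card 1 with h0 | h1
    · -- No meta-action is close to `G`, hence the action just played was unknown.
      have hnew : a p ∈ known I S s' \ known I S s := by
        simp only [known, Finset.mem_sdiff, Finset.mem_filter, Finset.mem_univ, true_and]
        refine ⟨⟨s.fresh, (hDmem _).2 (Or.inl rfl), G, ?_, hG⟩, ?_⟩
        · rw [hemp₀]; exact Set.mem_insert _ _
        · rintro ⟨d, hd, hd'⟩
          have : d ∈ nearby I G s := mem_nearby_of_ans hG ⟨hd, hd'⟩
          have := Finset.card_pos.2 ⟨d, this⟩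
          omega
      have h7 := Finset.card_sdiff_add_card_eq_card hknown
      have h8 := Finset.card_pos.2 ⟨_, hnew⟩
      rw [hfresh]
      omega
    · -- At least two meta-actions are merged into one.
      have : (nearby I G s).card ≠ 1 := fun h' => hne (Finset.card_eq_one.1 h')
      rw [hfresh]
      omega

/-- Action-Oracle with an accurate empirical distribution: either the correct meta-action is
returned, or the meta-actions are updated. -/
theorem oracle_spec {s : State m} (h : OracleInv I S a s) (hε : 0 ≤ I.eps) {p : Contract m}
    (hp : p ∈ I.region) {G : Fin m → ℝ} (hG : ‖G - S.F (a p)‖ ≤ I.eps) :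
    (∃ d E, oracle I G s = ({ s with emp := E }, some d) ∧ (∀ d', s.emp d' ⊆ E d') ∧
      OracleInv I S a { s with emp := E } ∧ Ans I S a { s with emp := E } d p) ∨
    ∃ s', oracle I G s = (s', none) ∧ s'.fresh = s.fresh + 1 ∧ s'.buf = s.buf ∧
      OracleInv I S a s' := by
  classical
  by_cases hd : ∃ d, nearby I G s = {d}
  · left
    have hch : nearby I G s = {hd.choose} := hd.choose_spec
    have hmem : hd.choose ∈ nearby I G s := hch.symm.subset (Finset.mem_singleton_self _)
    refine ⟨hd.choose, Function.update s.emp hd.choose (insert G (s.emp hd.choose)), ?_, ?_,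
      h.insertEmp hε hp hG hch, (mem_nearby.1 hmem).1, G, ?_, hG⟩
    · rw [oracle]
      exact dif_pos hd
    · intro d'
      by_cases hdd : d' = hd.choose
      · rw [hdd, Function.update_self]; exact Set.subset_insert _ _
      · rw [Function.update_of_ne hdd]
    · simp
  · right
    refine ⟨_, dif_neg hd, rfl, rfl, h.merge hε hp hG hd rfl rfl rfl ?_ ?_⟩
    · simp [nearby]
    · intro d hdD hn
      have hfr : d ≠ s.fresh := fun e => lt_irrefl _ (e ▸ h.lt_fresh _ hdD)
      have hn' : d ∉ s.D.filter fun d => ∃ F ∈ s.emp d, ‖F - G‖ ≤ 2 * I.eps := by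
        intro h'; exact hn (mem_nearby.2 (Finset.mem_filter.1 h'))
      simp only [hfr, if_false]
      exact if_neg hn'

end

/-! ### Estimates of cost differences and approximate halfspaces -/

section

variable {m : ℕ} (I : Input m) (S : Setting m I.n) (a : Contract m → Fin I.n)

/-- The standing assumptions: `a` is the behaviour of the agent, and the parameters of the
algorithm are meaningful. -/
structure Standing : Prop where
  r_eq : I.r = S.r
  response : S.IsResponse a
  one_le_B : 1 ≤ I.B
  eps_pos : 0 < I.eps
  n_pos : 0 < I.n
  m_pos : 0 < m
  gamma_le : I.gamma ≤ 1

/-- Euclidean distance of two contracts, as computed by the binary search. -/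
noncomputable def dist₂ (p₁ p₂ : Contract m) : ℝ := √(∑ ω, (p₁ ω - p₂ ω) ^ 2)

/-- Additional error of an estimate of a cost difference found by one binary search. -/
noncomputable def Input.kappa : ℝ := 16 * I.beta + √(m : ℝ) * I.eta

variable {I S a}

theorem Standing.beta_pos (h : Standing I S a) : 0 < I.beta := by
  have h1 := h.eps_pos
  have h2 : (0 : ℝ) < I.n := Nat.cast_pos.2 h.n_pos
  have h3 : (0 : ℝ) < m := Nat.cast_pos.2 h.m_pos
  have h4 : 0 < I.B := lt_of_lt_of_le one_pos h.one_le_B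
  rw [Input.beta]
  positivity

theorem Standing.eta_pos (h : Standing I S a) : 0 < I.eta := by
  have h1 := h.eps_pos
  have h2 : (0 : ℝ) < I.n := Nat.cast_pos.2 h.n_pos
  have h3 : (0 : ℝ) < m := Nat.cast_pos.2 h.m_pos
  rw [Input.eta]
  positivity

theorem Standing.kappa_pos (h : Standing I S a) : 0 < I.kappa := by
  have h1 := h.beta_pos
  have h2 := h.eta_pos
  rw [Input.kappa]
  positivity

theorem Input.y_eq (I : Input m) :
    I.y = 18 * I.n * I.beta + 2 * I.n * (√(m : ℝ) * I.eta) := by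
  rw [Input.y, Input.beta]; ring

theorem Standing.one_le_n (h : Standing I S a) : (1 : ℝ) ≤ I.n := by
  exact_mod_cast h.n_pos

/-- A chain of at most `n - 1` binary searches yields an error for which the slack `y` is
sufficient. -/
theorem Standing.error_le (h : Standing I S a) {k : ℕ} (hk : k ≤ I.n) :
    4 * I.beta + ((k : ℝ) - 1) * I.kappa ≤ I.y - 8 * I.beta := by
  have h1 : ((k : ℝ) - 1) * I.kappa ≤ ((I.n : ℝ) - 1) * I.kappa :=
    mul_le_mul_of_nonneg_right (by simpa using hk) h.kappa_pos.le
  have h2 := h.beta_pos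
  have h3 : 0 ≤ √(m : ℝ) * I.eta := mul_nonneg (Real.sqrt_nonneg _) h.eta_pos.le
  have h4 := h.one_le_n
  rw [I.y_eq]
  rw [Input.kappa] at *
  nlinarith [mul_nonneg (sub_nonneg.2 h4) h2.le, mul_nonneg (sub_nonneg.2 h4) h3]

theorem Standing.beta_le_y (h : Standing I S a) : 12 * I.beta ≤ I.y := by
  have := h.error_le (k := 1) h.n_pos
  simp only [Nat.cast_one, sub_self, zero_mul] at this
  linarith

theorem Standing.y_le_gamma (h : Standing I S a) : I.y ≤ I.gamma := by
  have h1 := h.eps_pos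
  have h4 : 0 < I.B := lt_of_lt_of_le one_pos h.one_le_B
  have : 0 ≤ I.B * I.eps * m * (I.n : ℝ) ^ 2 := by positivity
  rw [Input.y, Input.gamma]
  linarith

/-- Differences of expected payments are estimated by means of the empirical distributions. -/
theorem rep_sub_bounds (h : Standing I S a) {G G' : Fin m → ℝ} {b b' : Fin I.n}
    (hb : b ∈ cluster I S a G) (hb' : b' ∈ cluster I S a G') {p : Contract m}
    (hp : p ∈ I.region) :
    |∑ ω, (G ω - G' ω) * p ω - (∑ ω, S.F b ω * p ω - ∑ ω, S.F b' ω * p ω)| ≤ 8 * I.beta := by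
  have h1 := abs_le.1 (abs_sum_sub_le hp (norm_sub_le_of_mem_cluster h.eps_pos.le hb))
  have h2 := abs_le.1 (abs_sum_sub_le hp (norm_sub_le_of_mem_cluster h.eps_pos.le hb'))
  rw [sum_sub_mul, abs_le]
  constructor <;> linarith

/-- The approximate halfspace contains the part of the region in which `b` is preferred. -/
theorem mem_halfspace (h : Standing I S a) {G G' : Fin m → ℝ} {b b' : Fin I.n}
    (hb : b ∈ cluster I S a G) (hb' : b' ∈ cluster I S a G') {p : Contract m}
    (hp : p ∈ I.region) {Δ : ℝ} (hΔ : |Δ - (S.c b - S.c b')| ≤ I.y - 8 * I.beta)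
    (hle : ∑ ω, S.F b' ω * p ω - S.c b' ≤ ∑ ω, S.F b ω * p ω - S.c b) :
    Δ - I.y ≤ ∑ ω, (G ω - G' ω) * p ω := by
  have h1 := abs_le.1 (rep_sub_bounds h hb hb' hp)
  have h2 := abs_le.1 hΔ
  linarith

/-- In the approximate halfspace, `b` is almost preferred. -/
theorem utility_le_of_mem_halfspace (h : Standing I S a) {G G' : Fin m → ℝ} {b b' : Fin I.n}
    (hb : b ∈ cluster I S a G) (hb' : b' ∈ cluster I S a G') {p : Contract m}
    (hp : p ∈ I.region) {Δ : ℝ} (hΔ : |Δ - (S.c b - S.c b')| ≤ I.y - 8 * I.beta)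
    (hle : Δ - I.y ≤ ∑ ω, (G ω - G' ω) * p ω) :
    ∑ ω, S.F b' ω * p ω - S.c b' ≤ ∑ ω, S.F b ω * p ω - S.c b + 2 * I.y := by
  have h1 := abs_le.1 (rep_sub_bounds h hb hb' hp)
  have h2 := abs_le.1 hΔ
  linarith

theorem sum_mul_midpt (v p₁ p₂ : Fin m → ℝ) :
    ∑ ω, v ω * midpt p₁ p₂ ω = (∑ ω, v ω * p₁ ω + ∑ ω, v ω * p₂ ω) / 2 := by
  rw [← Finset.sum_add_distrib, Finset.sum_div]
  exact Finset.sum_congr rfl fun ω _ => by rw [midpt]; ring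

theorem midpt_mem_region {p₁ p₂ : Contract m} (h₁ : p₁ ∈ I.region) (h₂ : p₂ ∈ I.region) :
    midpt p₁ p₂ ∈ I.region := by
  refine ⟨fun ω => ?_, ?_⟩
  · have := h₁.1 ω
    have := h₂.1 ω
    simp only [midpt, Pi.zero_apply] at *
    linarith
  · have := sum_mul_midpt (fun _ => 1) p₁ p₂
    simp only [one_mul] at this
    have := h₁.2
    have := h₂.2
    linarith

theorem F_le_one {n : ℕ} (S : Setting m n) (b : Fin n) (ω : Fin m) : S.F b ω ≤ 1 := by
  rw [← S.F_sum b]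
  exact Finset.single_le_sum (fun ω _ => S.F_nonneg b ω) (Finset.mem_univ ω)

theorem abs_F_sub_le {n : ℕ} (S : Setting m n) (b b' : Fin n) (ω : Fin m) :
    |S.F b ω - S.F b' ω| ≤ 1 := by
  have h1 := F_le_one S b ω
  have h2 := F_le_one S b' ω
  have h3 := S.F_nonneg b ω
  have h4 := S.F_nonneg b' ω
  rw [abs_le]; constructor <;> linarith

theorem abs_sum_F_sub_mul_sub_le {n : ℕ} (S : Setting m n) (b b' : Fin n) (p₁ p₂ : Contract m) :
    |∑ ω, (S.F b ω - S.F b' ω) * (p₁ ω - p₂ ω)| ≤ √(m : ℝ) * dist₂ p₁ p₂ := by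
  have h1 : |∑ ω, (S.F b ω - S.F b' ω) * (p₁ ω - p₂ ω)| ≤ ∑ ω, |p₁ ω - p₂ ω| :=
    (Finset.abs_sum_le_sum_abs _ _).trans (Finset.sum_le_sum fun ω _ => by
      rw [abs_mul]
      exact mul_le_of_le_one_left (abs_nonneg _) (abs_F_sub_le S b b' ω))
  refine h1.trans ?_
  rw [dist₂, ← Real.sqrt_mul (Nat.cast_nonneg m)]
  apply Real.le_sqrt_of_sq_le
  have := sq_sum_le_card_mul_sum_sq (s := Finset.univ) (f := fun ω => |p₁ ω - p₂ ω|)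
  simpa using this

/-- The error after one more binary search: as `p₁` and `p₂` are close, a played action of `Gj` and
one of `Gk` are almost equally good for the agent at the middle point, so that the difference of
their costs is almost that of their expected payments. -/
theorem abs_estimate_sub_le (h : Standing I S a) {Gj Gk : Fin m → ℝ} {p₁ p₂ : Contract m}
    (hp₁ : p₁ ∈ I.region) (hp₂ : p₂ ∈ I.region) (hd : dist₂ p₁ p₂ ≤ I.eta)
    (h₁ : a p₁ ∈ cluster I S a Gj) (h₂ : a p₂ ∈ cluster I S a Gk) {b b' : Fin I.n}
    (hb' : b' ∈ cluster I S a Gk) {Δ e : ℝ} (hΔ : |Δ - (S.c b - S.c (a p₁))| ≤ e) :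
    |Δ + ∑ ω, (Gj ω - Gk ω) * midpt p₁ p₂ ω - (S.c b - S.c b')| ≤ e + I.kappa := by
  have e1 := abs_le.1 (rep_sub_bounds h h₁ hb' (midpt_mem_region hp₁ hp₂))
  simp only [sum_mul_midpt] at e1 ⊢
  have e2 := h.response.le hp₁.1 b'
  have e3 := h.response.le hp₂.1 (a p₁)
  have e4 := utility_le_of_mem_cluster h.eps_pos.le h.response h₂ hb' hp₂
  have e5 := abs_le.1 ((abs_sum_F_sub_mul_sub_le S (a p₁) b' p₁ p₂).trans
    (mul_le_mul_of_nonneg_left hd (Real.sqrt_nonneg _)))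
  have e6 : ∑ ω, (S.F (a p₁) ω - S.F b' ω) * (p₁ ω - p₂ ω) =
      (∑ ω, S.F (a p₁) ω * p₁ ω - ∑ ω, S.F b' ω * p₁ ω) -
      (∑ ω, S.F (a p₁) ω * p₂ ω - ∑ ω, S.F b' ω * p₂ ω) := by
    simp only [← Finset.sum_sub_distrib]
    exact Finset.sum_congr rfl fun ω _ => by ring
  rw [e6] at e5
  have e7 := abs_le.1 hΔ
  have e8 : 0 ≤ √(m : ℝ) * I.eta := mul_nonneg (Real.sqrt_nonneg _) h.eta_pos.le
  rw [Input.kappa, abs_le]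
  constructor <;> linarith

/-! ### Moving a contract towards the rewards -/

/-- If `x` is almost optimal for the agent under `p`, and `x'` is almost optimal under a contract
`p'` obtained by moving `p` towards the rewards, then the principal loses little: the move changes
the preferences of the agent in the direction of those of the principal. -/
theorem le_principalUtility_of_move {n : ℕ} (S : Setting m n) {p p' : Contract m} {g θ₁ θ₂ : ℝ}
    (hg : 0 < g) (hg1 : g ≤ 1) (hp' : ∀ ω, p' ω = (1 - g) * p ω + g * S.r ω) {x x' : Fin n}
    (h : ∑ ω, S.F x' ω * p ω - S.c x' ≤ ∑ ω, S.F x ω * p ω - S.c x + θ₁)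
    (h' : ∑ ω, S.F x ω * p' ω - S.c x ≤ ∑ ω, S.F x' ω * p' ω - S.c x' + θ₂) :
    (1 - g) * (S.principalUtility p x - (θ₁ + θ₂) / g) ≤ S.principalUtility p' x' := by
  have e1 : ∀ b, ∑ ω, S.F b ω * p' ω = (1 - g) * ∑ ω, S.F b ω * p ω + g * ∑ ω, S.F b ω * S.r ω := by
    intro b
    rw [Finset.mul_sum, Finset.mul_sum, ← Finset.sum_add_distrib]
    exact Finset.sum_congr rfl fun ω _ => by rw [hp']; ring
  have e2 : ∀ b q, S.principalUtility q b = ∑ ω, S.F b ω * S.r ω - ∑ ω, S.F b ω * q ω := by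
    intro b q
    rw [Setting.principalUtility, ← Finset.sum_sub_distrib]
    exact Finset.sum_congr rfl fun ω _ => by ring
  have e3 : S.principalUtility p' x' = (1 - g) * S.principalUtility p x' := by
    rw [e2, e2, e1]; ring
  rw [e3]
  refine mul_le_mul_of_nonneg_left ?_ (sub_nonneg.2 hg1)
  rw [sub_le_iff_le_add, ← sub_le_iff_le_add', le_div_iff₀ hg, e2, e2]
  rw [e1, e1] at h'
  linarith

theorem principalUtility_le_one {n : ℕ} (S : Setting m n) {p : Contract m} (hp : 0 ≤ p)
    (b : Fin n) : S.principalUtility p b ≤ 1 := by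
  rw [← S.F_sum b, Setting.principalUtility]
  refine Finset.sum_le_sum fun ω _ => mul_le_of_le_one_right (S.F_nonneg b ω) ?_
  have h1 := (S.r_mem ω).2
  have h2 : 0 ≤ p ω := hp ω
  linarith

theorem le_principalUtility {n : ℕ} (S : Setting m n) {p : Contract m} {x : ℝ} (hp : 0 ≤ p)
    (hx : ∑ ω, p ω ≤ x) (b : Fin n) : -x ≤ S.principalUtility p b := by
  have : ∑ ω, -p ω ≤ S.principalUtility p b := by
    refine Finset.sum_le_sum fun ω _ => ?_
    have h1 := (S.r_mem ω).1
    have h2 : 0 ≤ p ω := hp ω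
    have h3 := F_le_one S b ω
    have h4 := S.F_nonneg b ω
    nlinarith [mul_nonneg h4 h1, mul_nonneg (sub_nonneg.2 h3) h2]
  rw [Finset.sum_neg_distrib] at this
  linarith

theorem box_subset_region : box m I.B ⊆ I.region := by
  intro p hp
  refine ⟨fun ω => (hp ω).1, (Finset.sum_le_sum fun ω _ => (hp ω).2).trans ?_⟩
  simp

end

section

variable {m : ℕ} (I : Input m) (S : Setting m I.n) (a : Contract m → Fin I.n)

/-! ### Invariants of Try-Cover -/

/-- `p` lies in the approximate halfspace that separates `d` from `k`. -/
def InHalfspace (s : State m) (d k : ℕ) (p : Contract m) : Prop :=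
  s.dc d k - I.y ≤ ∑ ω, (s.rep d ω - s.rep k ω) * p ω

/-- The invariant of Try-Cover. A meta-action `d` is registered if `s.gen d` is nonempty. The
upper bounds of registered meta-actions that wait to be processed, except those in `A`, have not
been refined yet; in the course of the processing of `d`, `A` is `{d}`. The error of an estimated
cost difference grows with the number of halfspaces found before, since each estimate is based on an
earlier one. -/
structure CoverInv (s : State m) (A : Set ℕ) : Prop where
  mem_D : ∀ d, (s.gen d).Nonempty → d ∈ s.D
  reg_of_mem_C : ∀ d ∈ s.C, (s.gen d).Nonempty
  gen_finite : ∀ d, (s.gen d).Finite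
  self_mem_sep : ∀ d, d ∈ s.sep d
  reg_of_mem_sep : ∀ d, ∀ k ∈ s.sep d, k ≠ d → (s.gen k).Nonempty
  sep_eq : ∀ d, s.gen d = ∅ ∨ (d ∈ s.C ∧ d ∉ A) → s.sep d = {d}
  U_eq : ∀ d, s.U d = {p | p ∈ I.region ∧ ∀ k ∈ s.sep d, k ≠ d → InHalfspace I s d k p}
  of_mem_gen : ∀ d, ∀ p ∈ s.gen d, p ∈ I.region ∧
    ∃ j ∈ s.sep d, Ans I S a s j p ∧ (j ≠ d → InHalfspace I s d j p)
  witness : ∀ d, (s.gen d).Nonempty → ∃ p ∈ s.gen d, Ans I S a s d p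
  covered : ∀ d, (s.gen d).Nonempty → d ∉ s.C → s.U d ⊆ s.L d
  error : ∀ d, (s.gen d).Nonempty → ∀ k ∈ s.sep d, k ≠ d →
    ∀ b ∈ cluster I S a (s.rep d), ∀ b' ∈ cluster I S a (s.rep k),
      |s.dc d k - (S.c b - S.c b')| ≤ 4 * I.beta + ((s.sep d).card - 1) * I.kappa

/-- Loss of the contract returned by Discover-and-Cover. -/
noncomputable def Input.loss : ℝ := 6 * √I.gamma + 8 * I.beta

/-- The endpoints of the binary search of Find-HS, started on `d`: the answer `dj` to `p₁` is in
`𝒟_d`, the answer `dk` to `p₂` is not. -/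
structure SearchInv (s : State m) (d : ℕ) (p₁ p₂ : Contract m) (dj dk : ℕ) : Prop where
  mem₁ : p₁ ∈ I.region
  mem₂ : p₂ ∈ I.region
  ans₁ : Ans I S a s dj p₁
  ans₂ : Ans I S a s dk p₂
  mem_sep : dj ∈ s.sep d
  notMem_sep : dk ∉ s.sep d
  reg : (s.gen dk).Nonempty

/-- The invariant at a control point. -/
def LocInv (s : State m) : Prop :=
  match s.loc with
  | .first p => CoverInv I S a s ∅ ∧ p ∈ I.region ∧ ∀ d, s.gen d = ∅
  | .vertex d V p => CoverInv I S a s {d} ∧ d ∈ s.C ∧ V ⊆ (s.U d).extremePoints ℝ ∧ p ∈ V ∧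
      (s.U d).extremePoints ℝ ⊆ V ∪ s.gen d
  | .left d p p₁ => CoverInv I S a s {d} ∧ d ∈ s.C ∧ p₁ ∈ s.gen d ∧ p ∈ I.region ∧
      ∃ dk ∉ s.sep d, Ans I S a s dk p ∧ (s.gen dk).Nonempty
  | .right d p₁ p₂ dj => CoverInv I S a s {d} ∧ d ∈ s.C ∧ ∃ dk, SearchInv I S a s d p₁ p₂ dj dk
  | .middle d p₁ p₂ dj dk => CoverInv I S a s {d} ∧ d ∈ s.C ∧ SearchInv I S a s d p₁ p₂ dj dk ∧
      I.eta < dist₂ p₁ p₂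
  | .done p => ∀ p₀ ∈ box m I.B, S.u a p₀ ≤ S.u a p + I.loss

/-! ### The number of remaining calls -/

/-- The number of queries made by a binary search on endpoints at distance `x`. -/
noncomputable def Input.halvings (x : ℝ) : ℕ := ⌈Real.logb 2 (x / I.eta)⌉₊

/-- The number of queries made by Find-HS. -/
noncomputable def Input.search : ℕ := 2 + I.halvings (2 * (m * I.B))

/-- The number of queries made while `𝒰_d` does not change. -/
noncomputable def Input.phase : ℕ := I.search + (m + I.n).choose m

open Classical in
/-- The number of meta-actions other than `d` that may still have to be processed. -/
noncomputable def waiting (s : State m) (d : ℕ) : ℕ :=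
  (s.D.filter fun d' => d' ≠ d ∧ (s.gen d' = ∅ ∨ d' ∈ s.C)).card

open Classical in
/-- The number of meta-actions that may still have to be processed. -/
noncomputable def pending (s : State m) : ℕ :=
  (s.D.filter fun d' => s.gen d' = ∅ ∨ d' ∈ s.C).card

/-- The number of queries that suffice to process completely `k` meta-actions. -/
noncomputable def Input.full (s : State m) (k : ℕ) : ℕ := k * (s.D.card * I.phase)

/-- Bound on the number of queries, including the pending one, that remain in this run of
Try-Cover unless it is aborted. -/
noncomputable def cost (s : State m) : ℕ :=
  match s.loc with
  | .first _ => 1 + I.full s s.D.card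
  | .vertex d V _ => I.full s (waiting s d) + (s.D.card - (s.sep d).card) * I.phase +
      (I.search + V.ncard)
  | .left d _ _ => I.full s (waiting s d) + (s.D.card - (s.sep d).card) * I.phase + I.search
  | .right d _ _ _ => I.full s (waiting s d) + (s.D.card - (s.sep d).card) * I.phase +
      (1 + I.halvings (2 * (m * I.B)))
  | .middle d p₁ p₂ _ _ => I.full s (waiting s d) + (s.D.card - (s.sep d).card) * I.phase +
      I.halvings (dist₂ p₁ p₂)
  | .done _ => 0

/-- `s'` is reached from `s` without a query, satisfies the invariants, and at most `N` queries
remain. -/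
structure Reaches (s s' : State m) (N : ℕ) : Prop where
  same : SameData s s'
  inv : LocInv I S a s'
  cost_le : cost I s' ≤ N

variable {I S a}

/-! ### Consequences of the invariants -/

theorem CoverInv.card_sep_le {s : State m} {A : Set ℕ} (h : CoverInv I S a s A) {d : ℕ}
    (hd : (s.gen d).Nonempty) : (s.sep d).card ≤ s.D.card := by
  refine Finset.card_le_card fun k hk => ?_
  by_cases hkd : k = d
  · exact hkd ▸ h.mem_D d hd
  · exact h.mem_D k (h.reg_of_mem_sep d k hk hkd)

theorem CoverInv.error_le {s : State m} {A : Set ℕ} (h : CoverInv I S a s A)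
    (hO : OracleInv I S a s) (hs : Standing I S a) {d k : ℕ} (hd : (s.gen d).Nonempty)
    (hk : k ∈ s.sep d) (hkd : k ≠ d) {b b' : Fin I.n} (hb : b ∈ cluster I S a (s.rep d))
    (hb' : b' ∈ cluster I S a (s.rep k)) :
    |s.dc d k - (S.c b - S.c b')| ≤ I.y - 8 * I.beta :=
  (h.error d hd k hk hkd b hb b' hb').trans
    (hs.error_le ((h.card_sep_le hd).trans hO.card_le))

/-- A contract lies in `𝒰_d` if an action of `d` is preferred to some action of every
meta-action whose halfspace has been used. -/
theorem CoverInv.mem_U {s : State m} {A : Set ℕ} (h : CoverInv I S a s A)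
    (hO : OracleInv I S a s) (hs : Standing I S a) {d : ℕ} (hd : (s.gen d).Nonempty)
    {b : Fin I.n} (hb : b ∈ cluster I S a (s.rep d)) {p : Contract m} (hp : p ∈ I.region)
    (hle : ∀ k ∈ s.sep d, k ≠ d → ∃ b' ∈ cluster I S a (s.rep k),
      ∑ ω, S.F b' ω * p ω - S.c b' ≤ ∑ ω, S.F b ω * p ω - S.c b) : p ∈ s.U d := by
  rw [h.U_eq]
  refine ⟨hp, fun k hk hkd => ?_⟩
  obtain ⟨b', hb', hle⟩ := hle k hk hkd
  exact mem_halfspace hs hb hb' hp (h.error_le hO hs hd hk hkd hb hb') hle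

/-- A contract to which `d` was answered never leaves `𝒰_d`. -/
theorem CoverInv.U_nonempty {s : State m} {A : Set ℕ} (h : CoverInv I S a s A)
    (hO : OracleInv I S a s) (hs : Standing I S a) {d : ℕ} (hd : (s.gen d).Nonempty) :
    (s.U d).Nonempty := by
  obtain ⟨p, hp, hA⟩ := h.witness d hd
  have hpr := (h.of_mem_gen d p hp).1
  refine ⟨p, h.mem_U hO hs hd (hO.mem_cluster hpr hA) hpr fun k hk hkd => ?_⟩
  obtain ⟨b', hb'⟩ := hO.cluster_nonempty (h.mem_D k (h.reg_of_mem_sep d k hk hkd))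
  exact ⟨b', hb', hs.response.le hpr.1 b'⟩

/-- The upper bounds cover the region: a contract `p` lies in `𝒰_d` if `d` contains an action that
is best under `p` among those of registered meta-actions. -/
theorem CoverInv.exists_mem_U {s : State m} {A : Set ℕ} (h : CoverInv I S a s A)
    (hO : OracleInv I S a s) (hs : Standing I S a) (hne : ∃ d, (s.gen d).Nonempty)
    {p : Contract m} (hp : p ∈ I.region) : ∃ d, (s.gen d).Nonempty ∧ p ∈ s.U d := by
  classical
  let X : Finset (Fin I.n) := Finset.univ.filter fun b =>
    ∃ d, (s.gen d).Nonempty ∧ b ∈ cluster I S a (s.rep d)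
  have hX : X.Nonempty := by
    obtain ⟨d, hd⟩ := hne
    obtain ⟨b, hb⟩ := hO.cluster_nonempty (h.mem_D d hd)
    exact ⟨b, by simp only [X, Finset.mem_filter, Finset.mem_univ, true_and]; exact ⟨d, hd, hb⟩⟩
  obtain ⟨b, hbX, hmax⟩ := X.exists_max_image (fun b => ∑ ω, S.F b ω * p ω - S.c b) hX
  simp only [X, Finset.mem_filter, Finset.mem_univ, true_and] at hbX hmax
  obtain ⟨d, hd, hb⟩ := hbX
  refine ⟨d, hd, h.mem_U hO hs hd hb hp fun k hk hkd => ?_⟩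
  have hkr := h.reg_of_mem_sep d k hk hkd
  obtain ⟨b', hb'⟩ := hO.cluster_nonempty (h.mem_D k hkr)
  exact ⟨b', hb', hmax b' ⟨k, hkr, hb'⟩⟩

/-- On the lower bound `ℒ_d`, every action of `d` is almost optimal for the agent. -/
theorem CoverInv.utility_le_of_mem_L {s : State m} {A : Set ℕ} (h : CoverInv I S a s A)
    (hO : OracleInv I S a s) (hs : Standing I S a) {d : ℕ} {b : Fin I.n}
    (hb : b ∈ cluster I S a (s.rep d)) {p : Contract m} (hp : p ∈ s.L d) (x : Fin I.n) :
    ∑ ω, S.F x ω * p ω - S.c x ≤ ∑ ω, S.F b ω * p ω - S.c b + 2 * I.y := by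
  have hconv : Convex ℝ {p : Contract m | ∑ ω, (S.F x ω - S.F b ω) * p ω ≤
      S.c x - S.c b + 2 * I.y} :=
    convex_halfSpace_le (f := fun p : Contract m => ∑ ω, (S.F x ω - S.F b ω) * p ω)
      ⟨fun p q => by simp only [Pi.add_apply, mul_add, Finset.sum_add_distrib],
        fun c p => by
          simp only [Pi.smul_apply, smul_eq_mul, Finset.mul_sum]
          exact Finset.sum_congr rfl fun ω _ => by ring⟩ _
  -- The claim is linear in the contract, hence may be checked on the tested contracts.
  have hsub : s.gen d ⊆ {p : Contract m | ∑ ω, (S.F x ω - S.F b ω) * p ω ≤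
      S.c x - S.c b + 2 * I.y} := by
    intro q hq
    obtain ⟨hqr, j, hj, hA, hH⟩ := h.of_mem_gen d q hq
    have hmem := hO.mem_cluster hqr hA
    have h1 := hs.response.le hqr.1 x
    have h2 : ∑ ω, S.F (a q) ω * q ω - S.c (a q) ≤ ∑ ω, S.F b ω * q ω - S.c b + 2 * I.y := by
      by_cases hjd : j = d
      · subst hjd
        have := utility_le_of_mem_cluster hs.eps_pos.le hs.response hmem hb hqr
        linarith [hs.beta_le_y, hs.beta_pos]
      · exact utility_le_of_mem_halfspace hs hb hmem hqr
          (h.error_le hO hs ⟨q, hq⟩ hj hjd hb hmem) (hH hjd)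
    show ∑ ω, (S.F x ω - S.F b ω) * q ω ≤ _
    rw [sum_sub_mul]
    linarith
  have h3 : ∑ ω, (S.F x ω - S.F b ω) * p ω ≤ S.c x - S.c b + 2 * I.y :=
    convexHull_min hsub hconv hp
  rw [sum_sub_mul] at h3
  linarith

/-- The objective of Find-Contract estimates the utility of the principal. -/
theorem abs_value_sub_le (hs : Standing I S a) {s : State m} {d : ℕ} {b : Fin I.n}
    (hb : b ∈ cluster I S a (s.rep d)) {p : Contract m} (hp : p ∈ box m I.B) :
    |value I s d p - S.principalUtility p b| ≤ 4 * I.beta := by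
  have hB := hs.one_le_B
  have hn := norm_sub_le_of_mem_cluster hs.eps_pos.le hb
  have h1 : value I s d p - S.principalUtility p b =
      ∑ ω, (s.rep d ω - S.F b ω) * (S.r ω - p ω) := by
    rw [value, Setting.principalUtility, hs.r_eq, ← Finset.sum_sub_distrib]
    exact Finset.sum_congr rfl fun ω _ => by ring
  rw [h1]
  refine (Finset.abs_sum_le_sum_abs _ _).trans ?_
  have h2 : ∀ ω ∈ Finset.univ, |(s.rep d ω - S.F b ω) * (S.r ω - p ω)| ≤
      4 * I.eps * I.n * I.B := by
    intro ω _
    rw [abs_mul]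
    have h3 : |S.r ω - p ω| ≤ I.B := by
      have := S.r_mem ω
      have := hp ω
      rw [abs_le]
      constructor <;> linarith [(S.r_mem ω).1, (S.r_mem ω).2]
    exact mul_le_mul ((norm_le_pi_norm (s.rep d - S.F b) ω).trans hn) h3 (abs_nonneg _)
      ((norm_nonneg _).trans hn)
  refine (Finset.sum_le_sum h2).trans (le_of_eq ?_)
  rw [Finset.sum_const, Finset.card_univ, Fintype.card_fin, nsmul_eq_mul, Input.beta]
  ring

theorem isCompact_box (B : ℝ) : IsCompact (box m B) := by
  have : box m B = Set.Icc (fun _ => 0) (fun _ => B) := by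
    ext p
    simp only [box, Set.mem_Icc, Pi.le_def]
    exact forall_and
  rw [this]
  exact isCompact_Icc

theorem continuous_value (s : State m) (d : ℕ) : Continuous (value I s d) := by
  unfold value
  fun_prop

theorem CoverInv.candidates_nonempty {s : State m} {A : Set ℕ} (h : CoverInv I S a s A)
    (hne : ∃ d ∈ s.D, (box m I.B ∩ s.L d).Nonempty) : (candidates I s).Nonempty := by
  classical
  have hc : ∀ d, IsCompact (box m I.B ∩ s.L d) := fun d =>
    (isCompact_box _).inter ((h.gen_finite d).isCompact_convexHull ℝ)
  have hmax : ∀ d ∈ s.D.filter (fun d => (box m I.B ∩ s.L d).Nonempty),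
      ∃ p ∈ box m I.B ∩ s.L d, ∀ p' ∈ box m I.B ∩ s.L d, value I s d p' ≤ value I s d p := by
    intro d hd
    obtain ⟨p, hp, hm⟩ := (hc d).exists_isMaxOn (Finset.mem_filter.1 hd).2
      (continuous_value s d).continuousOn
    exact ⟨p, hp, fun p' hp' => hm hp'⟩
  choose! P hP hPm using hmax
  obtain ⟨d₀, hd₀, hne₀⟩ := hne
  obtain ⟨d, hd, hm⟩ := (s.D.filter (fun d => (box m I.B ∩ s.L d).Nonempty)).exists_max_image
    (fun d => value I s d (P d)) ⟨d₀, Finset.mem_filter.2 ⟨hd₀, hne₀⟩⟩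
  refine ⟨P d, d, (Finset.mem_filter.1 hd).1, hP d hd, fun d' hd' p' hp' => ?_⟩
  have hd'' : d' ∈ s.D.filter (fun d => (box m I.B ∩ s.L d).Nonempty) :=
    Finset.mem_filter.2 ⟨hd', p', hp'⟩
  exact (hPm d' hd'' p' hp').trans (hm d' hd'')

/-- When nothing is left to be processed, Find-Contract returns an almost optimal contract. The
optimal contract may incentivize an action that was never discovered; but after it is moved
towards the rewards, every almost optimal response is almost as good for the principal. -/
theorem CoverInv.findContract_spec {s : State m} (h : CoverInv I S a s ∅)
    (hO : OracleInv I S a s) (hs : Standing I S a) (hne : ∃ d, (s.gen d).Nonempty)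
    (hC : s.C = ∅) (σ : Selection m) {p₀ : Contract m} (hp₀ : p₀ ∈ box m I.B) :
    S.u a p₀ ≤ S.u a (findContract I σ s) + I.loss := by
  have hβ := hs.beta_pos
  have hy := hs.beta_le_y
  have hyγ := hs.y_le_gamma
  have hγ : 0 < I.gamma := by linarith
  set g := √I.gamma with hg
  have hg0 : 0 < g := Real.sqrt_pos.2 hγ
  have hg1 : g ≤ 1 := by exact Real.sqrt_le_one.2 hs.gamma_le
  have hgg : g * g = I.gamma := Real.mul_self_sqrt hγ.le
  have hθ : 2 * I.y / g ≤ 2 * g := by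
    rw [div_le_iff₀ hg0]; linarith
  have hbox : ∀ p ∈ box m I.B, (fun ω => (1 - g) * p ω + g * S.r ω) ∈ box m I.B := by
    intro p hp ω
    have h1 := S.r_mem ω
    have h2 := hp ω
    have h3 := hs.one_le_B
    refine ⟨add_nonneg (mul_nonneg (sub_nonneg.2 hg1) h2.1) (mul_nonneg hg0.le h1.1), ?_⟩
    have h4 := mul_le_mul_of_nonneg_left h2.2 (sub_nonneg.2 hg1)
    have h5 := mul_le_mul_of_nonneg_left (h1.2.trans h3) hg0.le
    linarith
  have hcov : ∀ p ∈ box m I.B, ∃ d ∈ s.D, p ∈ s.L d := by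
    intro p hp
    obtain ⟨d, hd, hpU⟩ := h.exists_mem_U hO hs hne (box_subset_region hp)
    exact ⟨d, h.mem_D d hd, h.covered d hd (by simp [hC]) hpU⟩
  -- The comparator, moved towards the rewards, competes in the maximization.
  obtain ⟨d₁, hd₁, hL₁⟩ := hcov _ (hbox p₀ hp₀)
  obtain ⟨b₁, hb₁⟩ := hO.cluster_nonempty hd₁
  have h1 := le_principalUtility_of_move S hg0 hg1 (fun ω => rfl)
    (θ₁ := 0) (by simpa using hs.response.le (box_subset_region hp₀).1 b₁)
    (h.utility_le_of_mem_L hO hs hb₁ hL₁ (a p₀))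
  have hcand : (candidates I s).Nonempty :=
    h.candidates_nonempty ⟨d₁, hd₁, _, hbox p₀ hp₀, hL₁⟩
  have hpt := σ.point_mem s _ hcand
  have hfc : findContract I σ s =
      fun ω => (1 - g) * σ.point s (candidates I s) ω + g * S.r ω := by
    rw [findContract, if_pos hcand, hs.r_eq]
  set p := σ.point s (candidates I s) with hp
  obtain ⟨d, hd, ⟨hpb, hpL⟩, hmax⟩ := hpt
  obtain ⟨b, hb⟩ := hO.cluster_nonempty hd
  have h2 := hmax d₁ hd₁ _ ⟨hbox p₀ hp₀, hL₁⟩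
  have h3 := abs_le.1 (abs_value_sub_le hs hb₁ (hbox p₀ hp₀))
  have h4 := abs_le.1 (abs_value_sub_le hs hb hpb)
  have hreg := box_subset_region (I := I) (hbox p hpb)
  have h5 := le_principalUtility_of_move S hg0 hg1 (fun ω => rfl)
    (h.utility_le_of_mem_L hO hs hb hpL (a (fun ω => (1 - g) * p ω + g * S.r ω)))
    (θ₂ := 0) (by simpa using hs.response.le hreg.1 b)
  have h6 := principalUtility_le_one S (box_subset_region hp₀).1 (a p₀)
  have h7 := principalUtility_le_one S (box_subset_region hpb).1 b
  rw [hfc, Setting.u, Setting.u, Input.loss, ← hg]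
  rw [zero_add] at h1
  rw [add_zero] at h5
  -- Both moves, that of the comparator and that of the maximizer, cost at most `3 * √γ`.
  have h8 : ∀ x : ℝ, x ≤ 1 → x - 3 * g ≤ (1 - g) * (x - 2 * I.y / g) := by
    intro x hx
    have h9 := mul_le_mul_of_nonneg_left hθ (sub_nonneg.2 hg1)
    nlinarith [mul_nonneg hg0.le (sub_nonneg.2 hx), mul_nonneg hg0.le hg0.le]
  have h10 := h8 _ h6
  have h11 := h8 _ h7
  linarith

end

section

variable {m : ℕ} {I : Input m} {S : Setting m I.n} {a : Contract m → Fin I.n}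

/-! ### The upper bounds are polytopes -/

/-- The linear functional with coefficients `v`. -/
noncomputable def functional (v : Fin m → ℝ) : Contract m →ₗ[ℝ] ℝ :=
  ∑ ω, v ω • LinearMap.proj ω

theorem functional_apply (v p : Fin m → ℝ) : functional v p = ∑ ω, v ω * p ω := by
  simp [functional]

theorem CoverInv.exists_polyhedron {s : State m} {A : Set ℕ} (h : CoverInv I S a s A) (d : ℕ) :
    ∃ (f : Fin m ⊕ Unit ⊕ {k // k ∈ (s.sep d).erase d} → Contract m →ₗ[ℝ] ℝ)
      (b : Fin m ⊕ Unit ⊕ {k // k ∈ (s.sep d).erase d} → ℝ), s.U d = {x | ∀ i, b i ≤ f i x} := by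
  refine ⟨Sum.elim (fun ω => LinearMap.proj ω) (Sum.elim (fun _ => functional fun _ => -1)
    fun k => functional fun ω => s.rep d ω - s.rep k ω),
    Sum.elim (fun _ => 0) (Sum.elim (fun _ => -(m * I.B)) fun k => s.dc d k - I.y), ?_⟩
  rw [h.U_eq]
  ext p
  simp only [Set.mem_ofPred_eq, Sum.forall, Sum.elim_inl, Sum.elim_inr, functional_apply,
    LinearMap.proj_apply, Subtype.forall, Finset.mem_erase, Input.region, InHalfspace, Pi.le_def,
    Pi.zero_apply, neg_mul, one_mul, Finset.sum_neg_distrib, neg_le_neg_iff]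
  constructor
  · rintro ⟨⟨h1, h2⟩, h3⟩
    exact ⟨h1, fun _ => h2, fun k hk => h3 k hk.2 hk.1⟩
  · rintro ⟨h1, h2, h3⟩
    exact ⟨⟨h1, h2 ()⟩, fun k hk hkd => h3 k ⟨hkd, hk⟩⟩

theorem CoverInv.convex_U {s : State m} {A : Set ℕ} (h : CoverInv I S a s A) (d : ℕ) :
    Convex ℝ (s.U d) := by
  obtain ⟨f, b, hU⟩ := h.exists_polyhedron d
  rw [hU, Set.ofPred_forall]
  exact convex_iInter fun i => convex_halfSpace_ge (f i).isLinear _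

theorem CoverInv.isCompact_U {s : State m} {A : Set ℕ} (h : CoverInv I S a s A) (d : ℕ) :
    IsCompact (s.U d) := by
  have hclosed : IsClosed (s.U d) := by
    obtain ⟨f, b, hU⟩ := h.exists_polyhedron d
    rw [hU, Set.ofPred_forall]
    exact isClosed_iInter fun i =>
      isClosed_le continuous_const (LinearMap.continuous_of_finiteDimensional (f i))
  refine (isCompact_box (m := m) (m * I.B)).of_isClosed_subset hclosed fun p hp ω => ?_
  rw [h.U_eq] at hp
  exact ⟨hp.1.1 ω,
    (Finset.single_le_sum (fun ω _ => hp.1.1 ω) (Finset.mem_univ ω)).trans hp.1.2⟩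

theorem CoverInv.extremePoints_U {s : State m} {A : Set ℕ} (h : CoverInv I S a s A) (d : ℕ) :
    ((s.U d).extremePoints ℝ).Finite ∧
      ((s.U d).extremePoints ℝ).ncard ≤ (m + (s.sep d).card).choose m := by
  obtain ⟨f, b, hU⟩ := h.exists_polyhedron d
  have := extremePoints_finite_ncard f b
  rw [← hU] at this
  refine ⟨this.1, this.2.trans (le_of_eq ?_)⟩
  have hpos := Finset.card_pos.2 ⟨d, h.self_mem_sep d⟩
  rw [Module.finrank_fin_fun, Fintype.card_sum, Fintype.card_sum, Fintype.card_fin,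
    Fintype.card_unit, Fintype.card_coe, Finset.card_erase_of_mem (h.self_mem_sep d)]
  congr 2
  omega

theorem CoverInv.subset_L {s : State m} {A : Set ℕ} (h : CoverInv I S a s A) {d : ℕ}
    (hsub : (s.U d).extremePoints ℝ ⊆ s.gen d) : s.U d ⊆ s.L d := by
  rw [← closure_convexHull_extremePoints (h.isCompact_U d) (h.convex_U d)]
  exact closure_minimal (convexHull_mono hsub) ((h.gen_finite d).isCompact_convexHull ℝ).isClosed

/-! ### Counting the meta-actions to be processed -/

theorem waiting_add_one {s : State m} {d : ℕ} (hD : d ∈ s.D) (hC : d ∈ s.C) :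
    waiting s d + 1 = pending s := by
  classical
  rw [waiting, pending, ← Finset.card_erase_add_one
    (s := s.D.filter fun d' => s.gen d' = ∅ ∨ d' ∈ s.C) (a := d)
    (Finset.mem_filter.2 ⟨hD, Or.inr hC⟩)]
  congr 2
  ext d'
  simp only [Finset.mem_filter, Finset.mem_erase]
  tauto

theorem pending_erase {s : State m} {d : ℕ} (hd : (s.gen d).Nonempty) :
    pending { s with C := s.C.erase d } = waiting s d := by
  classical
  rw [waiting, pending]
  congr 1
  ext d'
  simp only [Finset.mem_filter, Finset.mem_erase]
  by_cases h : d' = d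
  · subst h
    simp [hd.ne_empty]
  · simp [h]

theorem pending_le (s : State m) : pending s ≤ s.D.card := Finset.card_filter_le _ _

theorem full_add_one (s : State m) (k : ℕ) :
    I.full s (k + 1) = I.full s k + s.D.card * I.phase := by
  rw [Input.full, Input.full]; ring

/-! ### Transitions without queries -/

/-- Starting to test the vertices of `𝒰_d` needs at most one phase for the present `𝒰_d`, and one
for each halfspace still to be added. -/
theorem testVertices_spec (hs : Standing I S a) (σ : Selection m) {s : State m} {d : ℕ}
    (hO : OracleInv I S a s) (h : CoverInv I S a s {d}) (hd : d ∈ s.C) :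
    Reaches I S a s (testVertices σ d s)
      (I.full s (waiting s d) + (s.D.card + 1 - (s.sep d).card) * I.phase) := by
  have hreg := h.reg_of_mem_C d hd
  refine ⟨⟨rfl, rfl, rfl, rfl, rfl⟩, ?_, ?_⟩
  · exact ⟨{ h with }, hd, subset_rfl, σ.point_mem _ _
      ((h.isCompact_U d).extremePoints_nonempty (h.U_nonempty hO hs hreg)),
      Set.subset_union_left⟩
  · have h1 := h.card_sep_le hreg
    have h2 : (m + (s.sep d).card).choose m ≤ (m + I.n).choose m :=
      Nat.choose_le_choose m (Nat.add_le_add_left (h1.trans hO.card_le) m)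
    have h3 := (h.extremePoints_U d).2
    have h4 : s.D.card + 1 - (s.sep d).card = s.D.card - (s.sep d).card + 1 := by omega
    show I.full s (waiting s d) + (s.D.card - (s.sep d).card) * I.phase +
      (I.search + ((s.U d).extremePoints ℝ).ncard) ≤ _
    have h5 : I.phase = I.search + (m + I.n).choose m := rfl
    rw [h4, add_mul, one_mul]
    omega

/-- A meta-action that is covered need not be processed any more. -/
theorem CoverInv.erase {s : State m} {d : ℕ} (h : CoverInv I S a s {d})
    (hU : s.U d ⊆ s.L d) : CoverInv I S a { s with C := s.C.erase d } ∅ where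
  mem_D := h.mem_D
  reg_of_mem_C k hk := h.reg_of_mem_C k (Finset.mem_of_mem_erase hk)
  gen_finite := h.gen_finite
  self_mem_sep := h.self_mem_sep
  reg_of_mem_sep := h.reg_of_mem_sep
  sep_eq k hk := h.sep_eq k (hk.imp_right fun hk =>
    ⟨Finset.mem_of_mem_erase hk.1, Finset.ne_of_mem_erase hk.1⟩)
  U_eq := h.U_eq
  of_mem_gen := h.of_mem_gen
  witness := h.witness
  covered k hk hkC := by
    by_cases hkd : k = d
    · subst hkd; exact hU
    · exact h.covered k hk fun h' => hkC (Finset.mem_erase.2 ⟨hkd, h'⟩)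
  error := h.error

theorem CoverInv.weaken {s : State m} (h : CoverInv I S a s ∅) (d : ℕ) :
    CoverInv I S a s {d} :=
  { h with sep_eq := fun k hk => h.sep_eq k (hk.imp_right fun hk => ⟨hk.1, id⟩) }

/-- Between two meta-actions, the algorithm drops those that are already covered, and then either
terminates or starts to process the next one. -/
theorem coverLoop_spec (hs : Standing I S a) (σ : Selection m) (N : ℕ) :
    ∀ s : State m, s.C.card = N → OracleInv I S a s → CoverInv I S a s ∅ →
      (∃ d, (s.gen d).Nonempty) →
      Reaches I S a s (coverLoop I σ s) (I.full s (pending s)) := by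
  induction N with
  | zero =>
    intro s hN hO h hne
    have hC : s.C = ∅ := Finset.card_eq_zero.1 hN
    rw [coverLoop, dif_neg (by simp [hC])]
    refine ⟨⟨rfl, rfl, rfl, rfl, rfl⟩, ?_, Nat.zero_le _⟩
    intro p₀ hp₀
    exact h.findContract_spec hO hs hne hC σ hp₀
  | succ N ih =>
    intro s hN hO h hne
    have hC : s.C.Nonempty := Finset.card_pos.1 (by omega)
    have hd := σ.action_mem s s.C hC
    rw [coverLoop, dif_pos hC]
    set d := σ.action s s.C
    have hreg := h.reg_of_mem_C d hd
    have hw := waiting_add_one (h.mem_D d hreg) hd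
    split_ifs with hU
    · have := ih { s with C := s.C.erase d } (by
        show (s.C.erase d).card = N
        rw [Finset.card_erase_of_mem hd]; omega) (hO.congr rfl rfl rfl rfl)
        ((h.weaken d).erase hU) hne
      refine ⟨⟨this.same.D, this.same.fresh, this.same.emp, this.same.rep, this.same.buf⟩,
        this.inv, this.cost_le.trans ?_⟩
      rw [pending_erase hreg, ← hw, full_add_one]
      exact Nat.le_add_right _ _
    · have := testVertices_spec hs σ hO (h.weaken d) hd
      refine ⟨this.same, this.inv, this.cost_le.trans ?_⟩
      rw [h.sep_eq d (Or.inr ⟨hd, id⟩), ← hw, full_add_one, Finset.card_singleton,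
        Nat.add_sub_cancel]

/-- After `𝒰_d` or `ℒ_d` has changed, the processing of `d` either continues with the vertices of
`𝒰_d` or is completed. -/
theorem closeGap_spec (hs : Standing I S a) (σ : Selection m) {s : State m} {d : ℕ}
    (hO : OracleInv I S a s) (h : CoverInv I S a s {d}) (hd : d ∈ s.C) :
    Reaches I S a s (closeGap I σ d s)
      (I.full s (waiting s d) + (s.D.card + 1 - (s.sep d).card) * I.phase) ∧
    (s.U d ⊆ s.L d → Reaches I S a s (closeGap I σ d s) (I.full s (waiting s d))) := by
  have hreg := h.reg_of_mem_C d hd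
  rw [closeGap]
  split_ifs with hU
  · have := coverLoop_spec hs σ _ { s with C := s.C.erase d } rfl
      (hO.congr rfl rfl rfl rfl) (h.erase hU) ⟨d, hreg⟩
    rw [pending_erase hreg] at this
    have h2 : Reaches I S a s (coverLoop I σ { s with C := s.C.erase d })
        (I.full s (waiting s d)) :=
      ⟨⟨this.same.D, this.same.fresh, this.same.emp, this.same.rep, this.same.buf⟩,
        this.inv, this.cost_le⟩
    exact ⟨⟨h2.same, h2.inv, h2.cost_le.trans (Nat.le_add_right _ _)⟩, fun _ => h2⟩
  · exact ⟨testVertices_spec hs σ hO h hd, fun h' => absurd h' hU⟩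

/-- Adding a halfspace preserves the invariant of Try-Cover. The contracts of `ℒ_d` keep their
meta-actions in `𝒟_d`, and the error of the new estimate is that of the estimate for `dj` plus
`kappa`. -/
theorem SearchInv.addHalfspace_spec (hs : Standing I S a) {s : State m} {d : ℕ}
    (hO : OracleInv I S a s) (h : CoverInv I S a s {d}) (hd : d ∈ s.C) {p₁ p₂ : Contract m}
    {dj dk : ℕ} (hS : SearchInv I S a s d p₁ p₂ dj dk) (hη : dist₂ p₁ p₂ ≤ I.eta) :
    CoverInv I S a (addHalfspace I d p₁ p₂ dj dk s) {d} := by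
  have hreg := h.reg_of_mem_C d hd
  have hkd : dk ≠ d := fun e => hS.notMem_sep (e ▸ h.self_mem_sep d)
  set Δ : ℝ := (if dj = d then 0 else s.dc d dj) +
    ∑ ω, (s.rep dj ω - s.rep dk ω) * midpt p₁ p₂ ω with hΔ
  have hdc : (addHalfspace I d p₁ p₂ dj dk s).dc =
    Function.update s.dc d (Function.update (s.dc d) dk Δ) := rfl
  have hsep : (addHalfspace I d p₁ p₂ dj dk s).sep =
    Function.update s.sep d (insert dk (s.sep d)) := by
      rw [addHalfspace]
  have hold : ∀ k l, (k = d → l ≠ dk) → ∀ p,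
      InHalfspace I (addHalfspace I d p₁ p₂ dj dk s) k l p ↔ InHalfspace I s k l p := by
    intro k l hkl p
    have : (addHalfspace I d p₁ p₂ dj dk s).dc k l = s.dc k l := by
      rw [hdc]
      by_cases hk : k = d
      · subst hk
        rw [Function.update_self, Function.update_of_ne (hkl rfl)]
      · rw [Function.update_of_ne hk]
    rw [InHalfspace, InHalfspace, this]
    rfl
  have hsub : ∀ k, s.sep k ⊆ (addHalfspace I d p₁ p₂ dj dk s).sep k := by
    intro k
    rw [hsep]
    by_cases hk : k = d
    · subst hk; rw [Function.update_self]; exact Finset.subset_insert _ _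
    · rw [Function.update_of_ne hk]
  refine ⟨h.mem_D, h.reg_of_mem_C, h.gen_finite, fun k => hsub k (h.self_mem_sep k), ?_, ?_, ?_,
    ?_, h.witness, ?_, ?_⟩
  · intro k l hl hlk
    rw [hsep] at hl
    by_cases hk : k = d
    · subst hk
      rw [Function.update_self, Finset.mem_insert] at hl
      rcases hl with rfl | hl
      · exact hS.reg
      · exact h.reg_of_mem_sep k l hl hlk
    · rw [Function.update_of_ne hk] at hl
      exact h.reg_of_mem_sep k l hl hlk
  · intro k hk
    have hne : k ≠ d := by
      rintro rfl
      rcases hk with hk | hk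
      · exact hreg.ne_empty hk
      · exact hk.2 rfl
    rw [hsep, Function.update_of_ne hne]
    exact h.sep_eq k hk
  · intro k
    by_cases hk : k = d
    · subst hk
      have hUk : (addHalfspace I k p₁ p₂ dj dk s).U k = s.U k ∩
          {p | 0 ≤ p ∧ Δ - I.y ≤ ∑ ω, (s.rep k ω - s.rep dk ω) * p ω} := by
        show Function.update s.U k _ k = _
        rw [Function.update_self]
      rw [hUk, h.U_eq k, hsep, Function.update_self]
      have hnew : ∀ p, InHalfspace I (addHalfspace I k p₁ p₂ dj dk s) k dk p ↔
          Δ - I.y ≤ ∑ ω, (s.rep k ω - s.rep dk ω) * p ω := by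
        intro p
        rw [InHalfspace, hdc, Function.update_self, Function.update_self]
        rfl
      ext p
      constructor
      · rintro ⟨⟨hp, hp1⟩, -, hp2⟩
        refine ⟨hp, fun l hl hlk => ?_⟩
        by_cases hldk : l = dk
        · subst hldk; exact (hnew p).2 hp2
        · exact (hold k l (fun _ => hldk) p).2
            (hp1 l (Finset.mem_of_mem_insert_of_ne hl hldk) hlk)
      · rintro ⟨hp, hp1⟩
        refine ⟨⟨hp, fun l hl hlk => ?_⟩, hp.1,
          (hnew p).1 (hp1 dk (Finset.mem_insert_self _ _) hkd)⟩
        have hldk : l ≠ dk := fun e => hS.notMem_sep (e ▸ hl)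
        exact (hold k l (fun _ => hldk) p).1 (hp1 l (Finset.mem_insert_of_mem hl) hlk)
    · have hUk : (addHalfspace I d p₁ p₂ dj dk s).U k = s.U k := by
        show Function.update s.U d _ k = _
        rw [Function.update_of_ne hk]
      rw [hUk, h.U_eq k, hsep, Function.update_of_ne hk]
      ext p
      simp only [Set.mem_ofPred_eq, hold k _ (fun e => absurd e hk) p]
  · intro k p hp
    obtain ⟨hpr, j, hj, hA, hH⟩ := h.of_mem_gen k p hp
    refine ⟨hpr, j, hsub k hj, hA, fun hjk => (hold k j ?_ p).2 (hH hjk)⟩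
    rintro rfl rfl
    exact hS.notMem_sep hj
  · intro k hk hkC
    have hne : k ≠ d := fun e => hkC (e ▸ hd)
    have hUk : (addHalfspace I d p₁ p₂ dj dk s).U k = s.U k := by
      show Function.update s.U d _ k = _
      rw [Function.update_of_ne hne]
    rw [hUk]
    exact h.covered k hk hkC
  · intro k hk l hl hlk b hb b' hb'
    rw [hsep] at hl ⊢
    by_cases hkd' : k = d
    · subst hkd'
      rw [Function.update_self] at hl ⊢
      have hcard : ((insert dk (s.sep k)).card : ℝ) - 1 = ((s.sep k).card - 1) + 1 := by
        rw [Finset.card_insert_of_notMem hS.notMem_sep]; push_cast; ring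
      rw [hcard]
      by_cases hldk : l = dk
      · subst hldk
        rw [hdc, Function.update_self, Function.update_self]
        have hj := hO.mem_cluster hS.mem₁ hS.ans₁
        -- If `dj` is `d` itself, the two actions may differ, but their costs are close.
        have hold' : |(if dj = k then 0 else s.dc k dj) - (S.c b - S.c (a p₁))| ≤
            4 * I.beta + ((s.sep k).card - 1) * I.kappa := by
          split_ifs with hjk
          · subst hjk
            have h1 := cost_sub_le_of_mem_cluster hs.eps_pos.le hs.response hb hj
            have h2 := cost_sub_le_of_mem_cluster hs.eps_pos.le hs.response hj hb
            have h3 : (1 : ℝ) ≤ (s.sep dj).card := by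
              exact_mod_cast Finset.card_pos.2 ⟨dj, h.self_mem_sep dj⟩
            have h4 := mul_nonneg (sub_nonneg.2 h3) hs.kappa_pos.le
            rw [abs_le]
            constructor <;> linarith
          · exact h.error k hreg dj hS.mem_sep hjk b hb _ hj
        have := abs_estimate_sub_le hs hS.mem₁ hS.mem₂ hη hj
          (hO.mem_cluster hS.mem₂ hS.ans₂) hb' hold'
        rw [hΔ]
        refine this.trans (le_of_eq ?_)
        ring
      · rw [hdc, Function.update_self, Function.update_of_ne hldk]
        refine (h.error k hk l (Finset.mem_of_mem_insert_of_ne hl hldk) hlk b hb b' hb').trans ?_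
        have := hs.kappa_pos
        linarith
    · rw [Function.update_of_ne hkd'] at hl ⊢
      rw [hdc, Function.update_of_ne hkd']
      exact h.error k hk l hl hlk b hb b' hb'

end

section

variable {m : ℕ} {I : Input m} {S : Setting m I.n} {a : Contract m → Fin I.n}

/-! ### The length of a binary search -/

theorem halvings_mono (hη : 0 < I.eta) {x y : ℝ} (hx : 0 ≤ x) (hxy : x ≤ y) :
    I.halvings x ≤ I.halvings y := by
  rcases hx.eq_or_lt with rfl | hx
  · simp [Input.halvings]
  · exact Nat.ceil_mono (Real.logb_le_logb_of_le one_lt_two (div_pos hx hη)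
      (div_le_div_of_nonneg_right hxy hη.le))

/-- One query of the binary search halves the distance of the endpoints. -/
theorem halvings_half (hη : 0 < I.eta) {x : ℝ} (hx : I.eta < x) :
    I.halvings (x / 2) + 1 ≤ I.halvings x := by
  have h0 : 0 < x := hη.trans hx
  have h1 : 0 < Real.logb 2 (x / I.eta) :=
    Real.logb_pos one_lt_two ((one_lt_div hη).2 hx)
  have h2 : Real.logb 2 (x / 2 / I.eta) = Real.logb 2 (x / I.eta) - 1 := by
    rw [div_right_comm, Real.logb_div (div_pos h0 hη).ne' two_ne_zero,
      Real.logb_self_eq_one one_lt_two]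
  have h3 : 0 < I.halvings x := Nat.ceil_pos.2 h1
  have h4 : I.halvings (x / 2) ≤ I.halvings x - 1 := by
    rw [Input.halvings, h2]
    apply Nat.ceil_le.2
    rw [Nat.cast_sub h3, Nat.cast_one]
    exact sub_le_sub_right (Nat.le_ceil _) 1
  omega

theorem dist₂_nonneg (p₁ p₂ : Contract m) : 0 ≤ dist₂ p₁ p₂ := Real.sqrt_nonneg _

theorem dist₂_le {p₁ p₂ : Contract m} (h₁ : p₁ ∈ I.region) (h₂ : p₂ ∈ I.region) :
    dist₂ p₁ p₂ ≤ 2 * (m * I.B) := by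
  have h3 : ∑ ω, |p₁ ω - p₂ ω| ≤ 2 * (m * I.B) := by
    calc ∑ ω, |p₁ ω - p₂ ω| ≤ ∑ ω, (p₁ ω + p₂ ω) := Finset.sum_le_sum fun ω _ => by
          have h3 : 0 ≤ p₁ ω := h₁.1 ω
          have h4 : 0 ≤ p₂ ω := h₂.1 ω
          rw [abs_le]; constructor <;> linarith
      _ = ∑ ω, p₁ ω + ∑ ω, p₂ ω := Finset.sum_add_distrib
      _ ≤ _ := by linarith [h₁.2, h₂.2]
  refine le_trans ?_ h3
  rw [dist₂]
  refine Real.sqrt_le_iff.2 ⟨Finset.sum_nonneg fun _ _ => abs_nonneg _, ?_⟩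
  have := Finset.sum_sq_le_sq_sum_of_nonneg (s := Finset.univ) (f := fun ω => |p₁ ω - p₂ ω|)
    (fun _ _ => abs_nonneg _)
  simpa only [sq_abs] using this

theorem dist₂_midpt_right (p₁ p₂ : Contract m) : dist₂ (midpt p₁ p₂) p₂ = dist₂ p₁ p₂ / 2 := by
  have : ∑ ω, (midpt p₁ p₂ ω - p₂ ω) ^ 2 = (∑ ω, (p₁ ω - p₂ ω) ^ 2) / 2 ^ 2 := by
    rw [Finset.sum_div]
    exact Finset.sum_congr rfl fun ω _ => by rw [midpt]; ring
  rw [dist₂, dist₂, this, Real.sqrt_div' _ (by norm_num), Real.sqrt_sq (by norm_num)]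

theorem dist₂_midpt_left (p₁ p₂ : Contract m) : dist₂ p₁ (midpt p₁ p₂) = dist₂ p₁ p₂ / 2 := by
  have : ∑ ω, (p₁ ω - midpt p₁ p₂ ω) ^ 2 = (∑ ω, (p₁ ω - p₂ ω) ^ 2) / 2 ^ 2 := by
    rw [Finset.sum_div]
    exact Finset.sum_congr rfl fun ω _ => by rw [midpt]; ring
  rw [dist₂, dist₂, this, Real.sqrt_div' _ (by norm_num), Real.sqrt_sq (by norm_num)]

/-! ### Transitions after an answer of Action-Oracle -/

/-- The binary search either continues with a query, or ends with a new halfspace. The latter is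
paid for by the decrease of the number of meta-actions outside `𝒟_d`. -/
theorem bisect_spec (hs : Standing I S a) (σ : Selection m) {s : State m} {d : ℕ}
    (hO : OracleInv I S a s) (h : CoverInv I S a s {d}) (hd : d ∈ s.C) {p₁ p₂ : Contract m}
    {dj dk : ℕ} (hS : SearchInv I S a s d p₁ p₂ dj dk) :
    Reaches I S a s (bisect I σ d p₁ p₂ dj dk s)
      (I.full s (waiting s d) + (s.D.card - (s.sep d).card) * I.phase +
        I.halvings (dist₂ p₁ p₂)) := by
  rw [bisect]
  split_ifs with hη
  · exact ⟨⟨rfl, rfl, rfl, rfl, rfl⟩, ⟨{ h with }, hd, { hS with }, hη⟩, le_rfl⟩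
  · have h1 := hS.addHalfspace_spec hs hO h hd (not_lt.1 hη)
    have h2 := (closeGap_spec (s := addHalfspace I d p₁ p₂ dj dk s) hs σ
      (hO.congr rfl rfl rfl rfl) h1 hd).1
    have h3 : ((addHalfspace I d p₁ p₂ dj dk s).sep d).card = (s.sep d).card + 1 := by
      have : (addHalfspace I d p₁ p₂ dj dk s).sep d = insert dk (s.sep d) := by
        rw [addHalfspace]; exact Function.update_self ..
      rw [this, Finset.card_insert_of_notMem hS.notMem_sep]
    rw [h3, Nat.add_sub_add_right] at h2
    exact ⟨⟨h2.same.D, h2.same.fresh, h2.same.emp, h2.same.rep, h2.same.buf⟩, h2.inv,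
      h2.cost_le.trans (Nat.le_add_right _ _)⟩

/-- What is preserved when the answer `e` is registered while `d` is being processed. -/
structure Registers (s s' : State m) (e d : ℕ) : Prop where
  same : SameData s s'
  U : s'.U = s.U
  sep : s'.sep = s.sep
  C : s.C ⊆ s'.C
  reg : (s'.gen e).Nonempty
  gen : ∀ k, (s.gen k).Nonempty → s'.gen k = s.gen k
  waiting_le : waiting s' d ≤ waiting s d
  inv : CoverInv I S a s' {d}

theorem register_spec {s : State m} {d e : ℕ} {p : Contract m} (h : CoverInv I S a s {d})
    (hd : d ∈ s.C) (hp : p ∈ I.region) (hA : Ans I S a s e p) :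
    Registers (I := I) (S := S) (a := a) s (register e p s) e d := by
  classical
  rw [register]
  split_ifs with hgen
  · have hed : e ≠ d := by
      rintro rfl; exact (h.reg_of_mem_C e hd).ne_empty hgen
    have hne : ∀ k, (s.gen k).Nonempty → k ≠ e := by
      rintro k hk rfl; exact hk.ne_empty hgen
    have hold : ∀ k, (s.gen k).Nonempty → Function.update s.gen e {p} k = s.gen k :=
      fun k hk => Function.update_of_ne (hne k hk) _ _
    have hmono : ∀ k, (s.gen k).Nonempty → (Function.update s.gen e {p} k).Nonempty :=
      fun k hk => by rw [hold k hk]; exact hk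
    have hsep : s.sep e = {e} := h.sep_eq e (Or.inl hgen)
    refine ⟨⟨rfl, rfl, rfl, rfl, rfl⟩, rfl, rfl, Finset.subset_insert _ _,
      by simp, hold, ?_, ?_⟩
    · rw [waiting, waiting]
      refine Finset.card_le_card fun k hk => ?_
      simp only [Finset.mem_filter, Finset.mem_insert] at hk ⊢
      refine ⟨hk.1, hk.2.1, ?_⟩
      by_cases hke : k = e
      · exact Or.inl (hke ▸ hgen)
      · rw [Function.update_of_ne hke] at hk
        tauto
    · refine ⟨?_, ?_, ?_, h.self_mem_sep, ?_, ?_, h.U_eq, ?_, ?_, ?_, ?_⟩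
      · intro k hk
        dsimp only at hk ⊢
        by_cases hke : k = e
        · exact hke ▸ hA.1
        · rw [Function.update_of_ne hke] at hk
          exact h.mem_D k hk
      · intro k hk
        dsimp only at hk ⊢
        by_cases hke : k = e
        · subst hke; simp
        · exact hmono k (h.reg_of_mem_C k (Finset.mem_of_mem_insert_of_ne hk hke))
      · intro k
        by_cases hke : k = e
        · subst hke; simp
        · show (Function.update s.gen e {p} k).Finite
          rw [Function.update_of_ne hke]; exact h.gen_finite k
      · exact fun k l hl hlk => hmono l (h.reg_of_mem_sep k l hl hlk)
      · intro k hk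
        dsimp only at hk ⊢
        by_cases hke : k = e
        · subst hke; exact hsep
        · rw [Function.update_of_ne hke] at hk
          exact h.sep_eq k (hk.imp_right fun hk => ⟨Finset.mem_of_mem_insert_of_ne hk.1 hke, hk.2⟩)
      · intro k q hq
        dsimp only at hq ⊢
        by_cases hke : k = e
        · subst hke
          rw [Function.update_self, Set.mem_singleton_iff] at hq
          subst hq
          exact ⟨hp, k, h.self_mem_sep k, hA, fun h' => absurd rfl h'⟩
        · rw [Function.update_of_ne hke] at hq
          exact h.of_mem_gen k q hq
      · intro k hk
        dsimp only at hk ⊢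
        by_cases hke : k = e
        · subst hke
          exact ⟨p, by simp, hA⟩
        · rw [Function.update_of_ne hke] at hk ⊢
          exact h.witness k hk
      · intro k hk hkC
        dsimp only at hk hkC ⊢
        have hke : k ≠ e := fun e' => hkC (e' ▸ Finset.mem_insert_self _ _)
        rw [Function.update_of_ne hke] at hk
        have hL : State.L { s with gen := Function.update s.gen e {p}, C := insert e s.C } k =
            s.L k := by
          rw [State.L, State.L]; show convexHull ℝ (Function.update s.gen e {p} k) = _
          rw [Function.update_of_ne hke]
        rw [hL]
        exact h.covered k hk fun h' => hkC (Finset.mem_insert_of_mem h')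
      · intro k hk l hl hlk
        dsimp only at hk hl ⊢
        by_cases hke : k = e
        · subst hke
          rw [hsep, Finset.mem_singleton] at hl
          exact absurd hl hlk
        · rw [Function.update_of_ne hke] at hk
          exact h.error k hk l hl hlk
  · exact ⟨SameData.refl s, rfl, rfl, subset_rfl, Set.nonempty_iff_ne_empty.2 hgen,
      fun _ _ => rfl, le_rfl, h⟩

/-- The invariant is not affected by further empirical distributions. -/
theorem CoverInv.mono {s : State m} {A : Set ℕ} (h : CoverInv I S a s A)
    {E : ℕ → Set (Fin m → ℝ)} (hE : ∀ d, s.emp d ⊆ E d) :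
    CoverInv I S a { s with emp := E } A :=
  { h with
    of_mem_gen := fun d p hp => by
      obtain ⟨hpr, j, hj, hA, hH⟩ := h.of_mem_gen d p hp
      exact ⟨hpr, j, hj, hA.mono rfl hE, hH⟩
    witness := fun d hd => by
      obtain ⟨p, hp, hA⟩ := h.witness d hd
      exact ⟨p, hp, hA.mono rfl hE⟩ }

theorem SearchInv.mono {s : State m} {d : ℕ} {p₁ p₂ : Contract m} {dj dk : ℕ}
    (h : SearchInv I S a s d p₁ p₂ dj dk) {E : ℕ → Set (Fin m → ℝ)} (hE : ∀ d, s.emp d ⊆ E d) :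
    SearchInv I S a { s with emp := E } d p₁ p₂ dj dk :=
  { h with
    ans₁ := h.ans₁.mono rfl hE
    ans₂ := h.ans₂.mono rfl hE }

theorem LocInv.mono {s : State m} (h : LocInv I S a s) {E : ℕ → Set (Fin m → ℝ)}
    (hE : ∀ d, s.emp d ⊆ E d) : LocInv I S a { s with emp := E } := by
  unfold LocInv at h ⊢
  cases hl : s.loc <;> rw [hl] at h <;> simp only
  · exact ⟨{ h.1.mono hE with }, h.2⟩
  · exact ⟨{ h.1.mono hE with }, h.2⟩
  · obtain ⟨h1, h2, h3, h4, dk, h5, h6, h7⟩ := h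
    exact ⟨{ h1.mono hE with }, h2, h3, h4, dk, h5, h6.mono rfl hE, h7⟩
  · obtain ⟨h1, h2, dk, h3⟩ := h
    exact ⟨{ h1.mono hE with }, h2, dk, { h3.mono hE with }⟩
  · exact ⟨{ h.1.mono hE with }, h.2.1, { h.2.2.1.mono hE with }, h.2.2.2⟩
  · exact h

theorem SearchInv.of_registers {s s' : State m} {e d : ℕ} {p₁ p₂ : Contract m} {dj dk : ℕ}
    (h : SearchInv I S a s d p₁ p₂ dj dk)
    (hr : Registers (I := I) (S := S) (a := a) s s' e d) :
    SearchInv I S a s' d p₁ p₂ dj dk where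
  mem₁ := h.mem₁
  mem₂ := h.mem₂
  ans₁ := h.ans₁.mono hr.same.D fun _ => hr.same.emp ▸ subset_rfl
  ans₂ := h.ans₂.mono hr.same.D fun _ => hr.same.emp ▸ subset_rfl
  mem_sep := hr.sep ▸ h.mem_sep
  notMem_sep := hr.sep ▸ h.notMem_sep
  reg := by rw [hr.gen dk h.reg]; exact h.reg

/-- Control points at which a query is pending. -/
def Loc.IsQuery : Loc m → Prop
  | .done _ => False
  | _ => True

/-- Only contracts of the region are tested. -/
theorem LocInv.contract_mem {s : State m} (h : LocInv I S a s) (hq : s.loc.IsQuery) :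
    s.loc.contract ∈ I.region := by
  unfold LocInv at h
  cases hl : s.loc <;> rw [hl] at h hq <;> simp only [Loc.contract]
  · exact h.2.1
  · obtain ⟨h1, h2, h3, h4, h5⟩ := h
    have := (h3 h4).1
    rw [h1.U_eq] at this
    exact this.1
  · exact (h.1.of_mem_gen _ _ h.2.2.1).1
  · obtain ⟨-, -, dk, h3⟩ := h
    exact h3.mem₂
  · exact midpt_mem_region h.2.2.1.mem₁ h.2.2.1.mem₂
  · exact hq.elim

theorem full_mono (s : State m) {k l : ℕ} (h : k ≤ l) : I.full s k ≤ I.full s l :=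
  Nat.mul_le_mul_right _ h

theorem full_congr {s s' : State m} (h : s'.D = s.D) (k : ℕ) : I.full s' k = I.full s k := by
  rw [Input.full, Input.full, h]

/-- The meta-action answered by the first query is the first one to be processed. -/
theorem CoverInv.start {s : State m} (h : CoverInv I S a s ∅) (hgen : ∀ d, s.gen d = ∅) {e : ℕ}
    {p : Contract m} (hp : p ∈ I.region) (hA : Ans I S a s e p) :
    CoverInv I S a { s with gen := Function.update s.gen e {p}, C := {e} } ∅ := by
  classical
  have hsep : ∀ k, s.sep k = {k} := fun k => h.sep_eq k (Or.inl (hgen k))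
  have hreg : ∀ k, (Function.update s.gen e {p} k).Nonempty → k = e := by
    intro k hk
    by_contra hke
    rw [Function.update_of_ne hke, hgen] at hk
    exact Set.not_nonempty_empty hk
  refine ⟨?_, ?_, ?_, h.self_mem_sep, ?_, fun k _ => hsep k, h.U_eq, ?_, ?_, ?_, ?_⟩
  · exact fun k hk => hreg k hk ▸ hA.1
  · intro k hk
    rw [Finset.mem_singleton.1 hk]; simp
  · intro k
    by_cases hke : k = e
    · subst hke; simp
    · show (Function.update s.gen e {p} k).Finite
      rw [Function.update_of_ne hke]; exact h.gen_finite k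
  · intro k l hl hlk
    rw [hsep, Finset.mem_singleton] at hl
    exact absurd hl hlk
  · intro k q hq
    dsimp only at hq ⊢
    have hke := hreg k ⟨q, hq⟩
    subst hke
    rw [Function.update_self, Set.mem_singleton_iff] at hq
    subst hq
    exact ⟨hp, k, h.self_mem_sep k, hA, fun h' => absurd rfl h'⟩
  · intro k hk
    have hke := hreg k hk
    subst hke
    exact ⟨p, by simp, hA⟩
  · exact fun k hk hkC => absurd (Finset.mem_singleton.2 (hreg k hk)) hkC
  · intro k hk l hl hlk
    rw [hsep, Finset.mem_singleton] at hl
    exact absurd hl hlk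

/-- A vertex to which some meta-action of `𝒟_d` was answered is added to `ℒ_d`. -/
theorem CoverInv.addVertex {s : State m} {d e : ℕ} {p : Contract m} (h : CoverInv I S a s {d})
    (hd : d ∈ s.C) (hp : p ∈ s.U d) (he : e ∈ s.sep d) (hA : Ans I S a s e p) :
    CoverInv I S a { s with gen := Function.update s.gen d (insert p (s.gen d)) } {d} := by
  classical
  have hsub : ∀ k, s.gen k ⊆ Function.update s.gen d (insert p (s.gen d)) k := by
    intro k
    by_cases hkd : k = d
    · subst hkd; simp
    · rw [Function.update_of_ne hkd]
  have hreg : ∀ k, (Function.update s.gen d (insert p (s.gen d)) k).Nonempty →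
      (s.gen k).Nonempty := by
    intro k hk
    by_cases hkd : k = d
    · subst hkd; exact h.reg_of_mem_C k hd
    · rwa [Function.update_of_ne hkd] at hk
  refine ⟨fun k hk => h.mem_D k (hreg k hk), fun k hk => (h.reg_of_mem_C k hk).mono (hsub k), ?_,
    h.self_mem_sep, fun k l hl hlk => (h.reg_of_mem_sep k l hl hlk).mono (hsub l), ?_, h.U_eq,
    ?_, ?_, ?_, fun k hk => h.error k (hreg k hk)⟩
  · intro k
    show (Function.update s.gen d (insert p (s.gen d)) k).Finite
    by_cases hkd : k = d
    · subst hkd; rw [Function.update_self]; exact (h.gen_finite k).insert p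
    · rw [Function.update_of_ne hkd]; exact h.gen_finite k
  · intro k hk
    refine h.sep_eq k (hk.imp_left fun hk => ?_)
    exact Set.subset_empty_iff.1 ((hsub k).trans hk.subset)
  · intro k q hq
    dsimp only at hq ⊢
    by_cases hkd : k = d
    · subst hkd
      rw [Function.update_self] at hq
      rcases hq with rfl | hq
      · rw [h.U_eq] at hp
        exact ⟨hp.1, e, he, hA, hp.2 e he⟩
      · exact h.of_mem_gen k q hq
    · rw [Function.update_of_ne hkd] at hq
      exact h.of_mem_gen k q hq
  · intro k hk
    obtain ⟨q, hq, hA⟩ := h.witness k (hreg k hk)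
    exact ⟨q, hsub k hq, hA⟩
  · intro k hk hkC
    exact (h.covered k (hreg k hk) hkC).trans (convexHull_mono (hsub k))

/-- A correct answer of Action-Oracle to the pending query preserves the invariants and reduces
the bound on the number of remaining queries. -/
theorem resume_spec (hs : Standing I S a) (σ : Selection m) {s : State m}
    (hO : OracleInv I S a s) (hL : LocInv I S a s) (hq : s.loc.IsQuery) {e : ℕ}
    (hA : Ans I S a s e s.loc.contract) :
    ∃ N, Reaches I S a s (resume I σ (some e) s) N ∧ N + 1 ≤ cost I s := by
  have hreg := hL.contract_mem hq
  unfold LocInv at hL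
  unfold cost
  cases hl : s.loc with
  | first p =>
    rw [hl] at hL hA hreg
    change Ans I S a s e p at hA
    obtain ⟨h, hp, hgen⟩ := hL
    have h1 := coverLoop_spec hs σ _
      { s with gen := Function.update s.gen e {p}, C := {e}, loc := .first p } rfl
      (hO.congr rfl rfl rfl rfl) { h.start hgen hp hA with } ⟨e, by simp⟩
    refine ⟨I.full s s.D.card, ?_, by simp only; omega⟩
    simp only [resume, hl]
    exact ⟨⟨h1.same.D, h1.same.fresh, h1.same.emp, h1.same.rep, h1.same.buf⟩, h1.inv,
      h1.cost_le.trans (full_mono _ (pending_le _))⟩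
  | vertex d V p =>
    rw [hl] at hL hA hreg
    change Ans I S a s e p at hA
    change p ∈ I.region at hreg
    obtain ⟨h, hd, hV, hpV, hcov⟩ := hL
    have hr := register_spec h hd hreg hA
    have hfin : V.Finite := (h.extremePoints_U d).1.subset hV
    have hd' := hr.C hd
    have hA' : Ans I S a (register e p s) e p :=
      hA.mono hr.same.D fun _ => hr.same.emp ▸ subset_rfl
    have hO' := hO.of_sameData hr.same
    have hw := full_mono (I := I) s hr.waiting_le
    simp only [resume, hl]
    by_cases he : e ∈ (register e p s).sep d
    · rw [if_pos he]
      have h2 := hr.inv.addVertex hd' (hr.U ▸ (hV hpV).1) he hA'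
      have hgd := hr.gen d (h.reg_of_mem_C d hd)
      set s' := register e p s
      have hsubs : (s.U d).extremePoints ℝ ⊆
          (V \ {p}) ∪ Function.update s'.gen d (insert p (s'.gen d)) d := by
        intro q hq
        rw [Function.update_self, hgd]
        by_cases hqp : q = p
        · exact Or.inr (Or.inl hqp)
        · rcases hcov hq with hq | hq
          · exact Or.inl ⟨hq, hqp⟩
          · exact Or.inr (Or.inr hq)
      set s'' : State m := { s' with gen := Function.update s'.gen d (insert p (s'.gen d)) }
      have hw' : waiting s'' d = waiting s' d := by
        rw [waiting, waiting]
        congr 1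
        refine Finset.filter_congr fun k _ => and_congr_right fun hk => ?_
        show Function.update s'.gen d _ k = ∅ ∨ _ ↔ _
        rw [Function.update_of_ne hk]
      by_cases hne : (V \ {p}).Nonempty
      · rw [if_pos hne]
        refine ⟨_, ⟨⟨hr.same.D, hr.same.fresh, hr.same.emp, hr.same.rep, hr.same.buf⟩,
          ⟨{ h2 with }, hd', ?_, σ.point_mem _ _ hne, ?_⟩, le_rfl⟩, ?_⟩
        · show V \ {p} ⊆ (s'.U d).extremePoints ℝ
          rw [hr.U]; exact Set.sdiff_subset.trans hV
        · show (s'.U d).extremePoints ℝ ⊆ _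
          rw [hr.U]; exact hsubs
        · have hn := Set.ncard_sdiff_singleton_add_one hpV hfin
          show I.full s' (waiting s'' d) + (s'.D.card - (s'.sep d).card) * I.phase +
            (I.search + (V \ {p}).ncard) + 1 ≤ _
          rw [hw', full_congr hr.same.D, hr.same.D, hr.sep]
          omega
      · rw [if_neg hne]
        have h3 : (s'.U d).extremePoints ℝ ⊆ Function.update s'.gen d (insert p (s'.gen d)) d := by
          rw [hr.U]
          refine hsubs.trans (Set.union_subset ?_ subset_rfl)
          rw [Set.not_nonempty_iff_eq_empty.1 hne]
          exact Set.empty_subset _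
        have h4 := (closeGap_spec (s := s'') hs σ (hO'.congr rfl rfl rfl rfl) h2 hd').2
          (h2.subset_L h3)
        refine ⟨_, ⟨hr.same.trans ⟨h4.same.D, h4.same.fresh, h4.same.emp, h4.same.rep,
          h4.same.buf⟩, h4.inv, h4.cost_le⟩, ?_⟩
        have h5 : 2 ≤ I.search := Nat.le_add_right _ _
        rw [hw', full_congr (s := s) (by exact hr.same.D)]
        omega
    · rw [if_neg he]
      have hne : ((register e p s).gen d).Nonempty := by
        rw [hr.gen d (h.reg_of_mem_C d hd)]; exact h.reg_of_mem_C d hd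
      refine ⟨_, ⟨⟨hr.same.D, hr.same.fresh, hr.same.emp, hr.same.rep, hr.same.buf⟩,
        ⟨{ hr.inv with }, hd', σ.point_mem _ _ hne, hreg, e, he, hA', hr.reg⟩, le_rfl⟩, ?_⟩
      show I.full (register e p s) (waiting (register e p s) d) +
        ((register e p s).D.card - ((register e p s).sep d).card) * I.phase + I.search + 1 ≤ _
      have hn := (Set.ncard_pos hfin).2 ⟨p, hpV⟩
      rw [full_congr hr.same.D, hr.same.D, hr.sep]
      omega
  | left d p p₁ =>
    rw [hl] at hL hA hreg
    change Ans I S a s e p₁ at hA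
    change p₁ ∈ I.region at hreg
    obtain ⟨h, hd, hp₁, hp, dk, hk, hAk, hkr⟩ := hL
    obtain ⟨-, j, hj, hAj, -⟩ := h.of_mem_gen d p₁ hp₁
    -- Action-Oracle answers consistently, so that the first endpoint is answered by a member of
    -- `𝒟_d`, and the second one by the meta-action that triggered Find-HS.
    have hej : e = j := hO.ans_unique hA hAj
    subst hej
    simp only [resume, hl]
    refine ⟨_, ⟨⟨rfl, rfl, rfl, rfl, rfl⟩,
      ⟨{ h with }, hd, dk, ⟨hreg, hp, hAj, hAk, hj, hk, hkr⟩⟩, le_rfl⟩, ?_⟩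
    show I.full s (waiting s d) + (s.D.card - (s.sep d).card) * I.phase +
      (1 + I.halvings (2 * (m * I.B))) + 1 ≤ I.full s (waiting s d) +
        (s.D.card - (s.sep d).card) * I.phase + (2 + I.halvings (2 * (m * I.B)))
    omega
  | right d p₁ p₂ dj =>
    rw [hl] at hL hA
    change Ans I S a s e p₂ at hA
    obtain ⟨h, hd, dk, hS⟩ := hL
    have hek : e = dk := hO.ans_unique hA hS.ans₂
    subst hek
    simp only [resume, hl]
    refine ⟨_, bisect_spec hs σ hO h hd hS, ?_⟩
    have := halvings_mono hs.eta_pos (dist₂_nonneg p₁ p₂) (dist₂_le hS.mem₁ hS.mem₂)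
    omega
  | middle d p₁ p₂ dj dk =>
    rw [hl] at hL hA hreg
    change Ans I S a s e (midpt p₁ p₂) at hA
    change midpt p₁ p₂ ∈ I.region at hreg
    obtain ⟨h, hd, hS, hη⟩ := hL
    have hr := register_spec h hd hreg hA
    have hd' := hr.C hd
    have hA' : Ans I S a (register e (midpt p₁ p₂) s) e (midpt p₁ p₂) :=
      hA.mono hr.same.D fun _ => hr.same.emp ▸ subset_rfl
    have hO' := hO.of_sameData hr.same
    have hw := full_mono (I := I) s hr.waiting_le
    have hS' := hS.of_registers hr
    have hh := halvings_half hs.eta_pos hη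
    simp only [resume, hl]
    by_cases he : e ∈ (register e (midpt p₁ p₂) s).sep d
    · rw [if_pos he]
      have h1 := bisect_spec hs σ hO' hr.inv hd'
        (dj := e) (dk := dk) (p₁ := midpt p₁ p₂) (p₂ := p₂)
        { hS' with mem₁ := hreg, ans₁ := hA', mem_sep := he }
      refine ⟨_, ⟨hr.same.trans h1.same, h1.inv, h1.cost_le⟩, ?_⟩
      rw [full_congr hr.same.D, hr.same.D, hr.sep, dist₂_midpt_right]
      omega
    · rw [if_neg he]
      have h1 := bisect_spec hs σ hO' hr.inv hd'
        (dj := dj) (dk := e) (p₁ := p₁) (p₂ := midpt p₁ p₂)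
        { hS' with mem₂ := hreg, ans₂ := hA', notMem_sep := he, reg := hr.reg }
      refine ⟨_, ⟨hr.same.trans h1.same, h1.inv, h1.cost_le⟩, ?_⟩
      rw [full_congr hr.same.D, hr.same.D, hr.sep, dist₂_midpt_left]
      omega
  | done p =>
    rw [hl] at hq
    exact hq.elim

end

section

variable {m : ℕ} (I : Input m) (S : Setting m I.n) (a : Contract m → Fin I.n)

/-! ### The number of calls to Action-Oracle -/

/-- Bound on the number of queries in the run of Try-Cover that starts after `j` aborted ones.
There are at most `min j (2 * n - j)` meta-actions at that time. -/
noncomputable def Input.attempt (j : ℕ) : ℕ :=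
  1 + min j (2 * I.n - j) * (min j (2 * I.n - j) * I.phase)

/-- Bound on the number of queries in all runs of Try-Cover after the one that starts after `j`
aborted ones. -/
noncomputable def Input.later (j : ℕ) : ℕ := ∑ i ∈ Finset.Ico (j + 1) (2 * I.n), I.attempt i

open Classical in
/-- Bound on the number of remaining queries, including the pending one. -/
noncomputable def rank (s : State m) : ℕ :=
  if s.loc.IsQuery then I.later s.fresh + cost I s else 0

/-- The invariant of the algorithm on the clean event, after `t` rounds. As long as a query is
pending, `budget` relates the number of rounds used so far, up to the unfinished call of
Action-Oracle, to the number of calls that remain. -/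
structure Good (t : ℕ) (s : State m) : Prop where
  oracle : OracleInv I S a s
  loc : LocInv I S a s
  buf : s.loc.IsQuery → s.buf.length < I.q
  budget : s.loc.IsQuery → t + I.q * rank I s ≤ I.q * (I.later 0 + 1) + s.buf.length

variable {I S a}

theorem cost_pos (hs : Standing I S a) {s : State m} (hL : LocInv I S a s)
    (hq : s.loc.IsQuery) : 0 < cost I s := by
  unfold LocInv at hL
  unfold cost
  have h2 : 2 ≤ I.search := Nat.le_add_right _ _
  cases hl : s.loc <;> rw [hl] at hL hq <;> simp only
  · omega
  · omega
  · omega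
  · omega
  · have := halvings_half hs.eta_pos hL.2.2.2
    omega
  · exact hq.elim

/-- A new run of Try-Cover satisfies the invariants. -/
theorem restart_spec (σ : Selection m) {s : State m} (hB : 0 ≤ I.B) :
    LocInv I S a (restart I σ s) ∧ SameData s (restart I σ s) ∧
      cost I (restart I σ s) = 1 + s.D.card * (s.D.card * I.phase) := by
  have h0 : (0 : Contract m) ∈ I.region :=
    ⟨le_rfl, by simpa using mul_nonneg (Nat.cast_nonneg m) hB⟩
  refine ⟨⟨?_, σ.point_mem _ _ ⟨0, h0⟩, fun _ => rfl⟩, ⟨rfl, rfl, rfl, rfl, rfl⟩, rfl⟩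
  have hne : ∀ d, ¬ ((restart I σ s).gen d).Nonempty := fun d => Set.not_nonempty_empty
  refine ⟨fun d h => absurd h (hne d), ?_, fun d => Set.finite_empty,
    fun d => Finset.mem_singleton_self d, ?_, fun d _ => rfl, ?_, ?_, fun d h => absurd h (hne d),
    fun d h => absurd h (hne d), fun d h => absurd h (hne d)⟩
  · intro d hd
    exact absurd hd (Finset.notMem_empty d)
  · intro d k hk hkd
    exact absurd (Finset.mem_singleton.1 hk) hkd
  · intro d
    ext p
    constructor
    · intro hp
      exact ⟨hp, fun k hk hkd => absurd (Finset.mem_singleton.1 hk) hkd⟩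
    · intro hp
      exact hp.1
  · intro d p hp
    exact absurd hp (Set.notMem_empty p)

theorem rank_pos (hs : Standing I S a) {s : State m} (hL : LocInv I S a s)
    (hq : s.loc.IsQuery) : 0 < rank I s := by
  rw [rank, if_pos hq]
  have := cost_pos hs hL hq
  omega

theorem rank_le (s : State m) : rank I s ≤ I.later s.fresh + cost I s := by
  rw [rank]; split_ifs <;> omega

theorem restart_isQuery (σ : Selection m) (s : State m) : (restart I σ s).loc.IsQuery := trivial

/-- A completed call to Action-Oracle with an accurate result preserves the invariants and uses up
one of the remaining calls. -/
theorem resume_oracle_spec (hs : Standing I S a) (σ : Selection m) {s : State m}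
    (hO : OracleInv I S a s) (hL : LocInv I S a s) (hq : s.loc.IsQuery) {G : Fin m → ℝ}
    (hG : ‖G - S.F (a s.loc.contract)‖ ≤ I.eps) :
    let s' := resume I σ (oracle I G s).2 (oracle I G s).1
    OracleInv I S a s' ∧ LocInv I S a s' ∧ s'.buf = s.buf ∧ rank I s' + 1 ≤ rank I s := by
  have hreg := hL.contract_mem hq
  have hrank : rank I s = I.later s.fresh + cost I s := if_pos hq
  rcases oracle_spec hO hs.eps_pos.le hreg hG with ⟨d, E, h1, hE, hO', hA⟩ | ⟨s', h1, hf, hb, hO'⟩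
  · obtain ⟨N, hR, hN⟩ := resume_spec hs σ hO' (hL.mono hE) hq hA
    rw [h1]
    refine ⟨hO'.of_sameData hR.same, hR.inv, hR.same.buf, ?_⟩
    refine (Nat.add_le_add_right (rank_le _) 1).trans ?_
    rw [hR.same.fresh, hrank]
    have h2 := hR.cost_le
    have h3 : cost I { s with emp := E } = cost I s := rfl
    change I.later s.fresh + cost I (resume I σ (some d) { s with emp := E }) + 1 ≤ _
    omega
  · rw [h1]
    obtain ⟨h2, h3, h4⟩ := restart_spec (I := I) (S := S) (a := a) σ (s := s')
      (zero_le_one.trans hs.one_le_B)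
    refine ⟨hO'.of_sameData h3, h2, h3.buf.trans hb, ?_⟩
    refine (Nat.add_le_add_right (rank_le _) 1).trans ?_
    show I.later (restart I σ s').fresh + cost I (restart I σ s') + 1 ≤ _
    -- After a merge there is a meta-action, hence `s'.fresh < 2 * n` and the next run is counted.
    have h5 : s.fresh + 1 < 2 * I.n := by
      have := hO'.card_add_fresh_le'
      have h6 := hO'.card_le_fresh
      have h7 : 0 < s'.D.card ∨ s'.D.card = 0 := by omega
      have h8 : s'.D.Nonempty := by
        have : s'.D = _ := congrArg (fun x => x.1.D) h1.symm
        rw [this, oracle]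
        split_ifs with h
        · have := congrArg (fun x => x.2) h1
          rw [oracle, dif_pos h] at this
          exact absurd this (by simp)
        · exact ⟨s.fresh, Finset.mem_insert_self _ _⟩
      have := Finset.card_pos.2 h8
      omega
    have h6 : s'.D.card ≤ min s'.fresh (2 * I.n - s'.fresh) := by
      have := hO'.card_add_fresh_le'
      have := hO'.card_le_fresh
      rw [le_min_iff]
      omega
    have h7 : I.later s.fresh = I.attempt s'.fresh + I.later s'.fresh := by
      rw [Input.later, Input.later, hf, Finset.sum_eq_sum_Ico_succ_bot h5]
    have h8 : cost I (restart I σ s') ≤ I.attempt s'.fresh := by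
      rw [h4, Input.attempt]
      exact Nat.add_le_add_left (Nat.mul_le_mul h6 (Nat.mul_le_mul_right _ h6)) 1
    have h9 := cost_pos hs hL hq
    rw [h3.fresh, hrank]
    omega

theorem step_of_isQuery (σ : Selection m) {s : State m} (hq : s.loc.IsQuery) (ω : Fin m) :
    step I σ s ω = if I.q ≤ (ω :: s.buf).length then
      resume I σ (oracle I (frequencies (ω :: s.buf)) { s with seen := ω :: s.seen, buf := [] }).2
        (oracle I (frequencies (ω :: s.buf)) { s with seen := ω :: s.seen, buf := [] }).1
      else { s with seen := ω :: s.seen, buf := ω :: s.buf } := by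
  unfold step
  cases hl : s.loc <;> rw [hl] at hq
  exact hq.elim

theorem step_of_not_isQuery (σ : Selection m) {s : State m} (hq : ¬ s.loc.IsQuery) (ω : Fin m) :
    step I σ s ω = { s with seen := ω :: s.seen, buf := ω :: s.buf } := by
  unfold step
  cases hl : s.loc <;> rw [hl] at hq <;> exact absurd trivial hq

theorem LocInv.observe {s : State m} (h : LocInv I S a s) (x y : List (Fin m)) :
    LocInv I S a { s with seen := x, buf := y } := by
  unfold LocInv at h ⊢
  cases hl : s.loc <;> rw [hl] at h <;> simp only
  · exact ⟨{ h.1 with }, h.2⟩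
  · exact ⟨{ h.1 with }, h.2⟩
  · obtain ⟨h1, h2, h3, h4, dk, h5, h6, h7⟩ := h
    exact ⟨{ h1 with }, h2, h3, h4, dk, h5, h6, h7⟩
  · obtain ⟨h1, h2, dk, h3⟩ := h
    exact ⟨{ h1 with }, h2, dk, { h3 with }⟩
  · exact ⟨{ h.1 with }, h.2.1, { h.2.2.1 with }, h.2.2.2⟩
  · exact h

theorem Good.step_of_lt (σ : Selection m) {s : State m} (h : Good I S a t s)
    (hq : s.loc.IsQuery) (ω : Fin m) (hlt : s.buf.length + 1 < I.q) :
    Good I S a (t + 1) (step I σ s ω) ∧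
      step I σ s ω = { s with seen := ω :: s.seen, buf := ω :: s.buf } := by
  have h1 : step I σ s ω = { s with seen := ω :: s.seen, buf := ω :: s.buf } := by
    rw [step_of_isQuery σ hq, if_neg (by simpa using hlt)]
  refine ⟨?_, h1⟩
  rw [h1]
  refine ⟨h.oracle.congr rfl rfl rfl rfl, h.loc.observe _ _, fun _ => by simpa using hlt,
    fun _ => ?_⟩
  have := h.budget hq
  have h2 : rank I { s with seen := ω :: s.seen, buf := ω :: s.buf } = rank I s := rfl
  rw [h2]
  simp only [List.length_cons]
  omega

theorem Good.step_of_not_isQuery (σ : Selection m) {s : State m} (h : Good I S a t s)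
    (hq : ¬ s.loc.IsQuery) (ω : Fin m) : Good I S a (t + 1) (step I σ s ω) := by
  rw [HiddenAction.step_of_not_isQuery σ hq]
  exact ⟨h.oracle.congr rfl rfl rfl rfl, h.loc.observe _ _, fun h' => absurd h' hq,
    fun h' => absurd h' hq⟩

theorem Good.step_of_accurate (hs : Standing I S a) (hq0 : 0 < I.q) (σ : Selection m)
    {s : State m} (h : Good I S a t s) (hq : s.loc.IsQuery) (ω : Fin m)
    (hlen : s.buf.length + 1 = I.q)
    (hacc : ‖frequencies (ω :: s.buf) - S.F (a s.loc.contract)‖ ≤ I.eps) :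
    Good I S a (t + 1) (step I σ s ω) ∧ (step I σ s ω).buf = [] ∧
      rank I (step I σ s ω) + 1 ≤ rank I s := by
  rw [step_of_isQuery σ hq, if_pos (by simp [hlen])]
  obtain ⟨h1, h2, h3, h4⟩ := resume_oracle_spec hs σ
    (s := { s with seen := ω :: s.seen, buf := [] }) (h.oracle.congr rfl rfl rfl rfl)
    (h.loc.observe _ _) hq hacc
  refine ⟨⟨h1, h2, fun _ => by rw [h3]; exact hq0, fun _ => ?_⟩, h3, h4⟩
  have h5 := h.budget hq
  have h6 := Nat.mul_le_mul_left I.q h4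
  have h7 : rank I { s with seen := ω :: s.seen, buf := [] } = rank I s := rfl
  rw [h7, mul_add, mul_one] at h6
  rw [h3]
  simp only [List.length_nil]
  omega

/-- The initial state, in which no meta-action exists. -/
theorem startState_spec (σ : Selection m) (hB : 0 ≤ I.B) (hq0 : 0 < I.q) :
    Good I S a 0 (startState I σ) ∧ rank I (startState I σ) = I.later 0 + 1 ∧
      (startState I σ).buf = [] := by
  obtain ⟨h1, h2, h3⟩ := restart_spec (I := I) (S := S) (a := a) σ (s :=
    { seen := [], buf := [], D := ∅, fresh := 0, emp := fun _ => ∅, rep := fun _ _ => 0,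
      gen := fun _ => ∅, U := fun _ => ∅, sep := fun _ => ∅, dc := fun _ _ => 0, C := ∅,
      loc := .done 0 }) hB
  have hrank : rank I (startState I σ) = I.later 0 + 1 := by
    have h4 : cost I (startState I σ) = 1 := by
      rw [startState, h3]; simp
    have h5 : rank I (startState I σ) = I.later 0 + cost I (startState I σ) :=
      if_pos (restart_isQuery σ _)
    rw [h5, h4]
  refine ⟨⟨?_, h1, fun _ => hq0, fun _ => ?_⟩, hrank, rfl⟩
  · exact ⟨fun d hd => absurd hd (Finset.notMem_empty d),
      fun d hd => absurd hd (Finset.notMem_empty d), fun d hd => absurd hd (Finset.notMem_empty d),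
      fun d hd => absurd hd (Finset.notMem_empty d), fun d hd => absurd hd (Finset.notMem_empty d),
      Nat.zero_le _⟩
  · rw [hrank, zero_add]
    exact Nat.le_add_right _ _

/-! ### The probability of the clean event -/

variable (I S a)

open Classical in
/-- Bound on the probability that some call to Action-Oracle will be inaccurate. -/
noncomputable def risk (α : ℝ) (t : ℕ) (s : State m) : ℝ :=
  if Good I S a t s then
    if s.loc.IsQuery then
      min 1 (deviation (S.F (a s.loc.contract)) I.eps (I.q - s.buf.length) s.buf +
        (rank I s - 1) * α)
    else 0
  else 1

variable {I S a} {α : ℝ} {t : ℕ}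

theorem risk_le_one (s : State m) : risk I S a α t s ≤ 1 := by
  rw [risk]; split_ifs
  · exact min_le_left _ _
  · exact zero_le_one
  · exact le_rfl

theorem rank_sub_one_nonneg (hs : Standing I S a) {s : State m} (h : Good I S a t s)
    (hq : s.loc.IsQuery) : (0 : ℝ) ≤ rank I s - 1 := by
  have : (1 : ℝ) ≤ rank I s := by exact_mod_cast rank_pos hs h.loc hq
  linarith

theorem risk_nonneg (hs : Standing I S a) (hα : 0 ≤ α) (t : ℕ) (s : State m) :
    0 ≤ risk I S a α t s := by
  rw [risk]; split_ifs with h hq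
  · exact le_min zero_le_one (add_nonneg (deviation_nonneg (S.F_nonneg _) _ _)
      (mul_nonneg (rank_sub_one_nonneg hs h hq) hα))
  · exact le_rfl
  · exact zero_le_one

theorem one_le_risk {s : State m} (h : ¬ Good I S a t s) : 1 ≤ risk I S a α t s := by
  rw [risk, if_neg h]

/-- At the beginning of a call, the risk is at most `α` for each remaining call. -/
theorem risk_le_of_buf (hs : Standing I S a) (hα : 0 ≤ α) (hq0 : 0 < I.q)
    (hqα : 2 * m * Real.exp (-(2 * I.q * I.eps ^ 2)) ≤ α) {s : State m} (h : Good I S a t s)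
    (hbuf : s.buf = []) : risk I S a α t s ≤ rank I s * α := by
  rw [risk, if_pos h]
  split_ifs with hq
  · refine (min_le_right _ _).trans ?_
    rw [hbuf, List.length_nil, Nat.sub_zero]
    have := (deviation_nil_le (S.F_nonneg (a s.loc.contract)) (S.F_sum _) hs.eps_pos hq0).trans hqα
    linarith
  · exact mul_nonneg (Nat.cast_nonneg _) hα

/-- The risk is a supermartingale: it is constant on average during a call, and a completed accurate
call replaces a bound for `rank - 1` further calls by one for the calls that really remain. -/
theorem sum_risk_step_le (hs : Standing I S a) (hα : 0 ≤ α) (hq0 : 0 < I.q)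
    (hqα : 2 * m * Real.exp (-(2 * I.q * I.eps ^ 2)) ≤ α) (σ : Selection m) {s : State m}
    (h : Good I S a t s) :
    ∑ ω, S.F (a s.loc.contract) ω * risk I S a α (t + 1) (step I σ s ω) ≤ risk I S a α t s := by
  classical
  by_cases hq : s.loc.IsQuery
  swap
  · refine le_of_eq ?_
    rw [risk, if_pos h, if_neg hq]
    refine Finset.sum_eq_zero fun ω _ => ?_
    have h2 : ¬ (step I σ s ω).loc.IsQuery := by rw [step_of_not_isQuery σ hq]; exact hq
    rw [risk, if_pos (h.step_of_not_isQuery σ hq ω), if_neg h2, mul_zero]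
  have hF := S.F_nonneg (a s.loc.contract)
  have hsum := S.F_sum (a s.loc.contract)
  rw [risk.eq_1 I S a α t s, if_pos h, if_pos hq]
  refine le_min ?_ ?_
  · rw [← hsum]
    exact Finset.sum_le_sum fun ω _ => mul_le_of_le_one_right (hF ω) (risk_le_one _)
  have hlt := h.buf hq
  have hsplit : deviation (S.F (a s.loc.contract)) I.eps (I.q - s.buf.length) s.buf +
      (rank I s - 1) * α = ∑ ω, S.F (a s.loc.contract) ω *
        (deviation (S.F (a s.loc.contract)) I.eps (I.q - (s.buf.length + 1)) (ω :: s.buf) +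
          (rank I s - 1) * α) := by
    have : I.q - s.buf.length = (I.q - (s.buf.length + 1)) + 1 := by omega
    rw [this, deviation]
    simp only [mul_add, Finset.sum_add_distrib, ← Finset.sum_mul, hsum, one_mul]
  rw [hsplit]
  refine Finset.sum_le_sum fun ω _ => mul_le_mul_of_nonneg_left ?_ (hF ω)
  rcases Nat.lt_or_ge (s.buf.length + 1) I.q with hlt' | hge
  · obtain ⟨h1, h2⟩ := h.step_of_lt σ hq ω hlt'
    rw [risk, if_pos h1]
    have hq' : (step I σ s ω).loc.IsQuery := by rw [h2]; exact hq
    rw [if_pos hq', h2]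
    exact min_le_right _ _
  · have hlen : s.buf.length + 1 = I.q := by omega
    have h0 := mul_nonneg (rank_sub_one_nonneg hs h hq) hα
    rw [hlen, Nat.sub_self, deviation]
    split_ifs with hacc
    · obtain ⟨h1, h2, h3⟩ := h.step_of_accurate hs hq0 σ hq ω hlen hacc
      refine (risk_le_of_buf hs hα hq0 hqα h1 h2).trans ?_
      rw [zero_add]
      have h4 : (rank I (step I σ s ω) : ℝ) + 1 ≤ rank I s := by exact_mod_cast h3
      exact mul_le_mul_of_nonneg_right (by linarith) hα
    · exact (risk_le_one _).trans (by linarith)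

variable (I) in
/-- The state of the algorithm after the outcomes `h` have been observed. -/
noncomputable def stateAfter (σ : Selection m) (h : List (Fin m)) : State m :=
  h.foldl (step I σ) (startState I σ)

/-- With high probability, the invariants hold throughout the interaction. -/
theorem prob_not_good_le (hs : Standing I S a) (hα : 0 ≤ α) (hq0 : 0 < I.q)
    (hqα : 2 * m * Real.exp (-(2 * I.q * I.eps ^ 2)) ≤ α) (σ : Selection m) (T : ℕ) :
    S.prob a (discoverAndCover I σ)
      {w : Fin T → Fin m | ∃ t ≤ T, ¬ Good I S a t (stateAfter I σ ((List.ofFn w).take t))} ≤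
        ((I.later 0 + 1 : ℕ) : ℝ) * α := by
  have hset : {w : Fin T → Fin m |
      ∃ t ≤ T, ¬ Good I S a t (stateAfter I σ ((List.ofFn w).take t))} =
      {w : Fin T → Fin m | ∃ t ≤ T, ¬ Good I S a ((List.ofFn w).take t).length
        (stateAfter I σ ((List.ofFn w).take t))} := by
    ext w
    refine exists_congr fun t => and_congr_right fun ht => ?_
    rw [List.length_take, List.length_ofFn, min_eq_left ht]
  rw [hset]
  refine (S.prob_exists_not_le (a := a) (π := discoverAndCover I σ)
    (G := fun h => Good I S a h.length (stateAfter I σ h))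
    (Ψ := fun h => risk I S a α h.length (stateAfter I σ h)) (fun h => risk_nonneg hs hα _ _)
    (fun h hG => one_le_risk hG) (fun h hG => ?_) T).trans ?_
  · simp only [List.length_append, List.length_singleton, stateAfter, List.foldl_append,
      List.foldl_cons, List.foldl_nil]
    exact sum_risk_step_le hs hα hq0 hqα σ hG
  · obtain ⟨h1, h2, h4⟩ := startState_spec (I := I) (S := S) (a := a) σ
      (zero_le_one.trans hs.one_le_B) hq0
    rw [← h2]
    exact risk_le_of_buf hs hα hq0 hqα h1 h4

/-! ### Regret on the clean event -/

variable (I S a) in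
/-- If the invariants hold in all rounds, then all but the first `q * (later 0 + 1)` rounds use a
contract whose loss is at most `loss`. -/
theorem regret_le (hs : Standing I S a) (σ : Selection m) {T : ℕ} (w : Fin T → Fin m)
    (hG : ∀ t ≤ T, Good I S a t (stateAfter I σ ((List.ofFn w).take t))) :
    S.regret a I.B (discoverAndCover I σ) w ≤
      I.q * (I.later 0 + 1 : ℕ) * (1 + m * I.B) + T * I.loss := by
  have hB := hs.one_le_B
  have hbox : (box m I.B).Nonempty := ⟨0, fun ω => ⟨le_rfl, zero_le_one.trans hB⟩⟩
  have hc : 0 ≤ 1 + m * I.B := by positivity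
  have hloss : 0 ≤ I.loss := by
    have := hs.beta_pos
    rw [Input.loss]; positivity
  set V := sSup (S.u a '' box m I.B) with hV
  have hV1 : V ≤ 1 := by
    refine csSup_le (hbox.image _) ?_
    rintro _ ⟨p, hp, rfl⟩
    exact principalUtility_le_one S (fun ω => (hp ω).1) _
  set M := I.q * (I.later 0 + 1) with hM
  have hround : ∀ t : Fin T, V - S.u a ((discoverAndCover I σ).contract w t) ≤
      (if (t : ℕ) < M then 1 + m * I.B else 0) + I.loss := by
    intro t
    have hg := hG t t.2.le
    have hcon : (discoverAndCover I σ).contract w t =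
      (stateAfter I σ ((List.ofFn w).take t)).loc.contract := rfl
    rw [hcon]
    set s := stateAfter I σ ((List.ofFn w).take t)
    by_cases hq : s.loc.IsQuery
    · have h1 := hg.budget hq
      have h2 := Nat.mul_le_mul_left I.q (rank_pos hs hg.loc hq)
      have h3 := hg.buf hq
      have hlt : (t : ℕ) < M := by
        rw [hM]; omega
      rw [if_pos hlt]
      have hmem := hg.loc.contract_mem hq
      have := le_principalUtility S hmem.1 hmem.2 (a s.loc.contract)
      rw [Setting.u]
      linarith
    · have h1 : V ≤ S.u a s.loc.contract + I.loss := by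
        refine csSup_le (hbox.image _) ?_
        rintro _ ⟨p, hp, rfl⟩
        have h2 := hg.loc
        unfold LocInv at h2
        cases hl : s.loc <;> rw [hl] at h2 hq <;>
          first | exact absurd trivial hq | exact h2 p hp
      have : (0 : ℝ) ≤ if (t : ℕ) < M then 1 + m * I.B else 0 := by split_ifs <;> positivity
      linarith
  have hsum : S.regret a I.B (discoverAndCover I σ) w =
      ∑ t : Fin T, (V - S.u a ((discoverAndCover I σ).contract w t)) := by
    rw [Setting.regret, Finset.sum_sub_distrib, Finset.sum_const, Finset.card_univ,
      Fintype.card_fin, nsmul_eq_mul]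
  rw [hsum]
  refine (Finset.sum_le_sum fun t _ => hround t).trans ?_
  rw [Finset.sum_add_distrib, Finset.sum_const, Finset.card_univ, Fintype.card_fin, nsmul_eq_mul]
  refine add_le_add_left ?_ _
  rw [Fin.sum_univ_eq_sum_range (fun t => if t < M then (1 + m * I.B : ℝ) else 0),
    ← Finset.sum_filter, Finset.sum_const, nsmul_eq_mul]
  refine mul_le_mul_of_nonneg_right ?_ hc
  rw [← Nat.cast_mul, ← hM]
  refine Nat.cast_le.2 ((Finset.card_le_card (t := Finset.range M) fun t ht => ?_).trans
    (Finset.card_range M).le)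
  exact Finset.mem_range.2 (Finset.mem_filter.1 ht).2

end

/-! ### The parameters of the algorithm -/

/-- The admissible values of the parameters of Discover-and-Cover. -/
structure Input.Admissible {m : ℕ} (I : Input m) : Prop where
  m_pos : 0 < m
  n_pos : 0 < I.n
  one_le_B : 1 ≤ I.B
  rho_pos : 0 < I.ρ
  rho_le : I.ρ ≤ 1 / 2
  delta_pos : 0 < I.δ
  delta_lt : I.δ < 1

/-- Since a run of Try-Cover deals with at most `min i (2 * n - i)` meta-actions, all runs together
cost `n ^ 3` instead of `2 * n ^ 3` phases. -/
theorem sum_min_sq_le (n : ℕ) :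
    ∑ i ∈ Finset.range (2 * n), min i (2 * n - i) * min i (2 * n - i) ≤ n ^ 3 := by
  rw [two_mul, Finset.sum_range_add, ← Finset.sum_add_distrib]
  calc _ ≤ ∑ _i ∈ Finset.range n, n * n := by
        refine Finset.sum_le_sum fun i hi => ?_
        obtain ⟨j, rfl⟩ : ∃ j, n = i + j := ⟨n - i, by have := Finset.mem_range.1 hi; omega⟩
        have h1 : min i (i + j + (i + j) - i) = i := min_eq_left (by omega)
        have h2 : min (i + j + i) (i + j + (i + j) - (i + j + i)) = j := by
          rw [min_eq_right (by omega)]; omega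
        rw [h1, h2]
        nlinarith [Nat.zero_le (i * j)]
    _ = _ := by rw [Finset.sum_const, Finset.card_range, smul_eq_mul]; ring

namespace Input

/-- The quantity whose logarithm bounds the length of a binary search. -/
noncomputable def width {m : ℕ} (I : Input m) : ℝ := 2 * I.B * m / I.eta

/-- The number of vertices of an upper bound, as it enters `Input.alpha`. -/
def vertices {m : ℕ} (I : Input m) : ℕ := (m + I.n + 1).choose m

namespace Admissible

variable {m : ℕ} {I : Input m}

theorem one_le_m (h : I.Admissible) : (1 : ℝ) ≤ m := by exact_mod_cast h.m_pos

theorem one_le_n (h : I.Admissible) : (1 : ℝ) ≤ I.n := by exact_mod_cast h.n_pos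

theorem eps_eq (h : I.Admissible) :
    I.B * I.eps * m * (I.n : ℝ) ^ 2 = I.ρ ^ 2 / (1024 * m) := by
  have h1 := h.one_le_m
  have h2 := h.one_le_n
  have h3 := h.one_le_B
  rw [eps]
  field_simp
  norm_num

theorem eps_pos (h : I.Admissible) : 0 < I.eps := by
  have h1 := h.one_le_m
  have h2 := h.one_le_n
  have h3 := h.one_le_B
  have h4 := h.rho_pos
  rw [eps]
  positivity

theorem gamma_le (h : I.Admissible) : I.gamma ≤ I.ρ ^ 2 / 36 := by
  have h1 := h.one_le_m
  have h2 := h.one_le_n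
  have h3 := h.one_le_B
  have h4 := h.eps_pos
  have h5 : 2 * I.n * I.eta * √(m : ℝ) = I.eps * m * (I.n : ℝ) ^ 2 := by
    rw [eta]
    have := Real.mul_self_sqrt (Nat.cast_nonneg (α := ℝ) m)
    linear_combination I.eps * (I.n : ℝ) ^ 2 * this
  have h6 : I.eps * m * (I.n : ℝ) ^ 2 ≤ I.B * I.eps * m * (I.n : ℝ) ^ 2 := by
    have : 0 ≤ I.eps * m * (I.n : ℝ) ^ 2 := by positivity
    nlinarith
  have h7 := h.eps_eq
  have h8 : I.ρ ^ 2 / (1024 * m) ≤ I.ρ ^ 2 / 1024 :=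
    div_le_div_of_nonneg_left (sq_nonneg _) (by norm_num) (by linarith)
  have h9 := sq_nonneg I.ρ
  rw [gamma, h5]
  linarith

theorem beta_le (h : I.Admissible) : I.beta ≤ I.ρ / 1024 := by
  have h1 := h.one_le_m
  have h2 := h.one_le_n
  have h3 := h.one_le_B
  have h4 := h.eps_pos
  have h5 : I.beta ≤ I.B * I.eps * m * (I.n : ℝ) ^ 2 := by
    have h6 : 0 ≤ I.B * I.eps * m * I.n := by positivity
    rw [beta]
    nlinarith
  rw [h.eps_eq] at h5
  have h8 : I.ρ ^ 2 / (1024 * m) ≤ I.ρ ^ 2 / 1024 :=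
    div_le_div_of_nonneg_left (sq_nonneg _) (by norm_num) (by linarith)
  have h9 : I.ρ ^ 2 ≤ I.ρ := by nlinarith [h.rho_pos, h.rho_le]
  linarith

theorem loss_le (h : I.Admissible) : I.loss ≤ 2 * I.ρ := by
  have h1 : √I.gamma ≤ I.ρ / 6 := by
    refine Real.sqrt_le_iff.2 ⟨by linarith [h.rho_pos], h.gamma_le.trans (le_of_eq ?_)⟩
    ring
  have h2 := h.beta_le
  rw [loss]
  linarith [h.rho_pos]

/-- The width is of order `ρ ^ (-2)`. -/
theorem width_eq (h : I.Admissible) :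
    I.width = 4096 * I.B ^ 2 * (m : ℝ) ^ 2 * √(m : ℝ) * I.n / I.ρ ^ 2 := by
  have h1 := h.one_le_m
  have h2 := h.one_le_n
  have h3 := h.one_le_B
  have h4 := h.rho_pos
  have h5 : 0 < √(m : ℝ) := Real.sqrt_pos.2 (by linarith)
  have h6 := Real.sq_sqrt (Nat.cast_nonneg (α := ℝ) m)
  rw [width, eta, eps]
  field_simp
  rw [h6]
  ring

theorem le_width (h : I.Admissible) : 16384 ≤ I.width := by
  have h1 := h.one_le_m
  have h2 := h.one_le_n
  have h3 := h.one_le_B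
  have h4 := h.rho_pos
  have h5 : 1 ≤ √(m : ℝ) := Real.one_le_sqrt.2 h1
  rw [h.width_eq, le_div_iff₀ (by positivity)]
  have h6 : I.ρ ^ 2 ≤ 1 / 4 := by nlinarith [h.rho_le]
  have h7 : 1 ≤ I.B ^ 2 * (m : ℝ) ^ 2 * √(m : ℝ) * I.n :=
    one_le_mul_of_one_le_of_one_le (one_le_mul_of_one_le_of_one_le
      (one_le_mul_of_one_le_of_one_le (one_le_pow₀ h3) (one_le_pow₀ h1)) h5) h2
  linarith

theorem nine_le_log (h : I.Admissible) : 9 ≤ Real.log I.width := by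
  have h1 : Real.log 16384 = 14 * Real.log 2 := by
    rw [show (16384 : ℝ) = 2 ^ (14 : ℕ) by norm_num, Real.log_pow]; norm_num
  have h2 := Real.log_le_log (by norm_num) h.le_width
  have h3 := Real.log_two_gt_d9
  linarith

theorem alpha_eq : I.alpha = I.δ / (2 * (I.n : ℝ) ^ 3 * (Real.log I.width + I.vertices)) := rfl

theorem one_le_calls (h : I.Admissible) :
    1 ≤ 2 * (I.n : ℝ) ^ 3 * (Real.log I.width + I.vertices) := by
  have h1 := h.nine_le_log
  have h2 : (0 : ℝ) ≤ I.vertices := Nat.cast_nonneg _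
  have h3 : 1 ≤ (I.n : ℝ) ^ 3 := one_le_pow₀ h.one_le_n
  nlinarith

theorem alpha_pos (h : I.Admissible) : 0 < I.alpha :=
  div_pos h.delta_pos (lt_of_lt_of_le one_pos h.one_le_calls)

theorem alpha_lt (h : I.Admissible) : I.alpha < 1 := by
  rw [alpha_eq, div_lt_one (lt_of_lt_of_le one_pos h.one_le_calls)]
  exact h.delta_lt.trans_le h.one_le_calls

theorem log_pos (h : I.Admissible) : 0 < Real.log (2 * m / I.alpha) := by
  apply Real.log_pos
  rw [lt_div_iff₀ h.alpha_pos]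
  linarith [h.alpha_lt, h.one_le_m]

theorem q_pos (h : I.Admissible) : 0 < I.q :=
  Nat.ceil_pos.2 (mul_pos (by have := h.eps_pos; positivity) h.log_pos)

/-- The length of a call to Action-Oracle is sufficient for the confidence `alpha`. -/
theorem exp_le_alpha (h : I.Admissible) :
    2 * m * Real.exp (-(2 * I.q * I.eps ^ 2)) ≤ I.alpha := by
  have h1 := h.one_le_m
  have h2 := h.eps_pos
  have h3 : Real.log (2 * m / I.alpha) ≤ 2 * I.q * I.eps ^ 2 := by
    have := Nat.le_ceil (1 / (2 * I.eps ^ 2) * Real.log (2 * m / I.alpha))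
    change _ ≤ (I.q : ℝ) at this
    rw [div_mul_eq_mul_div, one_mul, div_le_iff₀ (by positivity)] at this
    linarith
  have h4 : Real.exp (-(2 * I.q * I.eps ^ 2)) ≤ I.alpha / (2 * m) := by
    calc _ ≤ Real.exp (-Real.log (2 * m / I.alpha)) := Real.exp_le_exp.2 (neg_le_neg h3)
      _ = _ := by
        rw [Real.exp_neg, Real.exp_log (div_pos (by linarith) h.alpha_pos), inv_div]
  calc _ ≤ 2 * m * (I.alpha / (2 * m)) := mul_le_mul_of_nonneg_left h4 (by positivity)
    _ = _ := by field_simp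

theorem standing (h : I.Admissible) {S : Setting m I.n} {a : Contract m → Fin I.n}
    (hr : I.r = S.r) (ha : S.IsResponse a) : Standing I S a where
  r_eq := hr
  response := ha
  one_le_B := h.one_le_B
  eps_pos := h.eps_pos
  n_pos := h.n_pos
  m_pos := h.m_pos
  gamma_le := h.gamma_le.trans (by nlinarith [h.rho_pos, h.rho_le])

theorem later_add_one_le (h : I.Admissible) :
    I.later 0 + 1 ≤ 2 * I.n + I.n ^ 3 * I.phase := by
  have h1 : 2 * I.n = (2 * I.n - 1) + 1 := by have := h.n_pos; omega
  have h2 : I.later 0 ≤ (2 * I.n - 1) + (∑ i ∈ Finset.range (2 * I.n),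
      min i (2 * I.n - i) * min i (2 * I.n - i)) * I.phase := by
    rw [later]
    simp only [attempt, Finset.sum_add_distrib, ← mul_assoc, ← Finset.sum_mul]
    refine add_le_add (by simp) (Nat.mul_le_mul_right _ (Finset.sum_le_sum_of_subset ?_))
    intro i hi
    exact Finset.mem_range.2 (Finset.mem_Ico.1 hi).2
  have h3 := Nat.mul_le_mul_right I.phase (sum_min_sq_le I.n)
  omega

/-- The number of calls to Action-Oracle is at most `δ / alpha`. -/
theorem later_le (h : I.Admissible) :
    ((I.later 0 + 1 : ℕ) : ℝ) ≤ 2 * (I.n : ℝ) ^ 3 * (Real.log I.width + I.vertices) := by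
  have h1 : ((I.later 0 + 1 : ℕ) : ℝ) ≤ 2 * I.n + (I.n : ℝ) ^ 3 * I.phase := by
    exact_mod_cast h.later_add_one_le
  have h2 := h.nine_le_log
  have h3 : 1 ≤ (I.n : ℝ) ^ 3 := one_le_pow₀ h.one_le_n
  have h4 : (I.n : ℝ) ≤ (I.n : ℝ) ^ 3 := le_self_pow₀ h.one_le_n (by norm_num)
  have h5 : ((m + I.n).choose m : ℝ) ≤ I.vertices := by
    exact_mod_cast Nat.choose_le_choose m (Nat.le_succ _)
  have h6 : (I.halvings (2 * (m * I.B)) : ℝ) ≤ 1.443 * Real.log I.width + 1 := by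
    have h7 : 2 * (m * I.B) / I.eta = I.width := by rw [width]; ring
    have h8 : 0 ≤ Real.logb 2 I.width := by
      rw [Real.logb]
      exact div_nonneg (by linarith) (Real.log_nonneg one_le_two)
    rw [halvings, h7]
    refine (Nat.ceil_lt_add_one h8).le.trans (add_le_add_left ?_ 1)
    have h9 := Real.log_two_gt_d9
    rw [Real.logb, div_le_iff₀ (by linarith)]
    nlinarith
  have h7 : (I.phase : ℝ) = 2 + I.halvings (2 * (m * I.B)) + ((m + I.n).choose m : ℝ) := by
    rw [phase, search]; push_cast; ring
  have h8 : (0 : ℝ) ≤ I.vertices := Nat.cast_nonneg _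
  have h9 : 2 + (I.phase : ℝ) ≤ 2 * (Real.log I.width + I.vertices) := by
    rw [h7]; linarith
  have h10 := mul_le_mul_of_nonneg_left h9 (zero_le_one.trans h3)
  linarith

theorem later_mul_alpha_le (h : I.Admissible) :
    ((I.later 0 + 1 : ℕ) : ℝ) * I.alpha ≤ I.δ := by
  have h1 := mul_le_mul_of_nonneg_right h.later_le h.alpha_pos.le
  refine h1.trans (le_of_eq ?_)
  rw [alpha_eq]
  exact mul_div_cancel₀ _ (lt_of_lt_of_le one_pos h.one_le_calls).ne'

end Admissible

end Input

/-! ### Asymptotics of the regret bound -/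

/-- The number of vertices is polynomial in `m` for fixed `n`; it accounts for the factor `m ^ n` of
the regret. -/
theorem choose_le_pow (m n : ℕ) (hm : 0 < m) :
    (m + n + 1).choose m ≤ (m + 1) * (n + 1) * m ^ n := by
  have h0 : (m + n + 1).choose m = (m + n + 1).choose (n + 1) := by
    rw [← Nat.choose_symm_of_eq_add (show m + n + 1 = (n + 1) + m by ring)]
  rw [h0]
  clear h0
  induction n with
  | zero => simp
  | succ n ih =>
    have h1 : (m + n + 1 + 1) * (m + n + 1).choose (n + 1) =
        (m + (n + 1) + 1).choose (n + 1 + 1) * (n + 1 + 1) :=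
      Nat.add_one_mul_choose_eq (m + n + 1) (n + 1)
    refine Nat.le_of_mul_le_mul_right (c := n + 2) ?_ (by omega)
    calc (m + (n + 1) + 1).choose (n + 1 + 1) * (n + 2)
        = (m + n + 1 + 1) * (m + n + 1).choose (n + 1) := h1.symm
      _ ≤ (m + n + 1 + 1) * ((m + 1) * (n + 1) * m ^ n) := Nat.mul_le_mul_left _ ih
      _ = (m + 1) * m ^ n * ((n + 1) * (m + n + 2)) := by ring
      _ ≤ (m + 1) * m ^ n * (m * (n + 2) ^ 2) := by
          refine Nat.mul_le_mul_left _ ?_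
          obtain ⟨k, rfl⟩ : ∃ k, m = k + 1 := ⟨m - 1, by omega⟩
          nlinarith [Nat.zero_le (k * n ^ 2), Nat.zero_le (k * n)]
      _ = _ := by ring

namespace Input

/-- The size `m n B` of the problem, in which the regret bound is polynomial up to `m ^ n`. -/
noncomputable def size {m : ℕ} (I : Input m) : ℝ := m * I.n * I.B

namespace Admissible

variable {m : ℕ} {I : Input m}

theorem one_le_size (h : I.Admissible) : 1 ≤ I.size :=
  one_le_mul_of_one_le_of_one_le
    (one_le_mul_of_one_le_of_one_le h.one_le_m h.one_le_n) h.one_le_B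

theorem mul_n_le_size (h : I.Admissible) : (m : ℝ) * I.n ≤ I.size := by
  have h1 := h.one_le_m
  have h2 := h.one_le_n
  exact le_mul_of_one_le_right (by positivity) h.one_le_B

theorem mul_B_le_size (h : I.Admissible) : (m : ℝ) * I.B ≤ I.size := by
  have h1 := h.one_le_m
  have h2 := h.one_le_B
  rw [size, mul_right_comm]
  exact le_mul_of_one_le_right (by positivity) h.one_le_n

theorem m_le_size (h : I.Admissible) : (m : ℝ) ≤ I.size := by
  have h1 := h.one_le_m
  exact (le_mul_of_one_le_right (by linarith) h.one_le_n).trans h.mul_n_le_size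

theorem n_le_size (h : I.Admissible) : (I.n : ℝ) ≤ I.size := by
  have h1 := h.one_le_n
  exact (le_mul_of_one_le_left (by linarith) h.one_le_m).trans h.mul_n_le_size

theorem vertices_le (h : I.Admissible) : (I.vertices : ℝ) ≤ 4 * (I.size * (m : ℝ) ^ I.n) := by
  have h1 : (I.vertices : ℝ) ≤ ((m : ℝ) + 1) * (I.n + 1) * (m : ℝ) ^ I.n := by
    have h0 : (I.vertices : ℝ) ≤ ((m + 1) * (I.n + 1) * m ^ I.n : ℕ) :=
      Nat.cast_le.2 (choose_le_pow m I.n h.m_pos)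
    push_cast at h0
    exact h0
  have h2 : ((m : ℝ) + 1) * (I.n + 1) ≤ 4 * I.size := by
    linarith [h.mul_n_le_size, h.m_le_size, h.n_le_size, h.one_le_size]
  have h3 := mul_le_mul_of_nonneg_right h2 (show (0 : ℝ) ≤ (m : ℝ) ^ I.n by positivity)
  linarith

theorem width_le (h : I.Admissible) {τ T : ℝ} (hτ : 1 ≤ 2 * τ * I.ρ) (hT : τ ^ 2 ≤ T) :
    I.width ≤ 16384 * I.size ^ 3 * T := by
  have hm := h.one_le_m
  have hn := h.one_le_n
  have hB := h.one_le_B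
  have hρ := h.rho_pos
  have h2 : I.B ^ 2 * (m : ℝ) ^ 2 * √(m : ℝ) * I.n ≤ I.size ^ 3 := by
    have h3 : √(m : ℝ) ≤ m := Real.sqrt_le_iff.2 ⟨by linarith, by nlinarith⟩
    have h4 := h.mul_B_le_size
    have h5 := h.mul_n_le_size
    have h6 := h.one_le_size
    calc I.B ^ 2 * (m : ℝ) ^ 2 * √(m : ℝ) * I.n
        ≤ I.B ^ 2 * (m : ℝ) ^ 2 * m * I.n := by gcongr
      _ = (m * I.B) * (m * I.B) * (m * I.n) := by ring
      _ ≤ I.size * I.size * I.size := by gcongr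
      _ = I.size ^ 3 := by ring
  rw [h.width_eq, div_le_iff₀ (by positivity)]
  have h4 : 1 ≤ 4 * (τ ^ 2 * I.ρ ^ 2) := by
    have := one_le_pow₀ hτ (n := 2)
    linarith [mul_pow (2 * τ) I.ρ 2, mul_pow 2 τ 2]
  have h5 : 1 ≤ 4 * (T * I.ρ ^ 2) := by
    have := mul_le_mul_of_nonneg_right hT (sq_nonneg I.ρ)
    linarith
  have h6 : 0 ≤ I.size ^ 3 := pow_nonneg (zero_le_one.trans h.one_le_size) 3
  have h7 := mul_le_mul_of_nonneg_left h5 h6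
  linarith

theorem log_width_le (h : I.Admissible) {τ T : ℝ} (hτ : 1 ≤ 2 * τ * I.ρ) (hT : τ ^ 2 ≤ T)
    (hT1 : 1 ≤ T) : Real.log I.width ≤ 17 * (I.size * (1 + Real.log T)) := by
  have hP := h.one_le_size
  have h2 : Real.log 16384 = 14 * Real.log 2 := by
    rw [show (16384 : ℝ) = 2 ^ (14 : ℕ) by norm_num, Real.log_pow]; norm_num
  have h3 := Real.log_two_lt_d9
  have h4 : Real.log I.size ≤ I.size - 1 := Real.log_le_sub_one_of_pos (by linarith)
  have h5 := Real.log_le_log (lt_of_lt_of_le (by norm_num) h.le_width) (h.width_le hτ hT)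
  have h6 : Real.log T ≤ I.size * Real.log T := le_mul_of_one_le_left (Real.log_nonneg hT1) hP
  have h7 := Real.log_nonneg hT1
  rw [Real.log_mul (by positivity) (by positivity), Real.log_mul (by norm_num) (by positivity),
    Real.log_pow, h2] at h5
  push_cast at h5
  linarith

theorem log_width_add_vertices_le (h : I.Admissible) {τ T : ℝ} (hτ : 1 ≤ 2 * τ * I.ρ)
    (hT : τ ^ 2 ≤ T) (hT1 : 1 ≤ T) :
    Real.log I.width + I.vertices ≤ 21 * (I.size * (1 + Real.log T) * (m : ℝ) ^ I.n) := by
  have hP := h.one_le_size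
  have hl := Real.log_nonneg hT1
  have hM : 1 ≤ (m : ℝ) ^ I.n := one_le_pow₀ h.one_le_m
  have h1 : I.size * (1 + Real.log T) ≤ I.size * (1 + Real.log T) * (m : ℝ) ^ I.n :=
    le_mul_of_one_le_right (by positivity) hM
  have h2 : I.size * (m : ℝ) ^ I.n ≤ I.size * (1 + Real.log T) * (m : ℝ) ^ I.n :=
    mul_le_mul_of_nonneg_right (le_mul_of_one_le_right (by linarith) (by linarith)) (by linarith)
  linarith [h.log_width_le hτ hT hT1, h.vertices_le]

/-- The logarithm of the inverse confidence is polynomial, as `m ^ n` enters it through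
`n * log m` only. -/
theorem log_confidence_le (h : I.Admissible) {τ T : ℝ} (hτ : 1 ≤ 2 * τ * I.ρ) (hT : τ ^ 2 ≤ T)
    (hT1 : 1 ≤ T) : Real.log (2 * m / I.alpha) ≤
      88 * (I.size * (1 + Real.log T) * (1 + Real.log (1 / I.δ))) := by
  have hXV := h.log_width_add_vertices_le hτ hT hT1
  have hP := h.one_le_size
  have hm := h.one_le_m
  have hδ := h.delta_pos
  have hl := Real.log_nonneg hT1
  have hlogδ : 0 ≤ Real.log (1 / I.δ) := Real.log_nonneg ((one_le_div hδ).2 h.delta_lt.le)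
  have h0 : 0 ≤ Real.log I.width + I.vertices :=
    add_nonneg (by linarith [h.nine_le_log]) (Nat.cast_nonneg _)
  have h1 : 2 * m / I.alpha ≤
      84 * I.size ^ 5 * (1 + Real.log T) * (m : ℝ) ^ I.n * (1 / I.δ) := by
    have h2 : 2 * m / I.alpha =
        2 * m * (2 * (I.n : ℝ) ^ 3 * (Real.log I.width + I.vertices)) * (1 / I.δ) := by
      rw [alpha_eq, div_div_eq_mul_div, mul_one_div]
    rw [h2]
    refine mul_le_mul_of_nonneg_right ?_ (by positivity)
    have h3 := h.m_le_size
    have h4 := h.n_le_size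
    calc 2 * m * (2 * (I.n : ℝ) ^ 3 * (Real.log I.width + I.vertices))
        ≤ 2 * I.size * (2 * I.size ^ 3 *
          (21 * (I.size * (1 + Real.log T) * (m : ℝ) ^ I.n))) := by gcongr
      _ = _ := by ring
  have h3 := Real.log_le_log (div_pos (by linarith) h.alpha_pos) h1
  rw [Real.log_mul (by positivity) (by positivity), Real.log_mul (by positivity) (by positivity),
    Real.log_mul (by positivity) (by positivity), Real.log_mul (by norm_num) (by positivity),
    Real.log_pow, Real.log_pow] at h3
  have h4 : Real.log I.size ≤ I.size - 1 := Real.log_le_sub_one_of_pos (by linarith)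
  have h5 : Real.log 84 ≤ 84 - 1 := Real.log_le_sub_one_of_pos (by norm_num)
  have h6 : Real.log (1 + Real.log T) ≤ 1 + Real.log T - 1 :=
    Real.log_le_sub_one_of_pos (by linarith)
  have h8 : (I.n : ℝ) * Real.log m ≤ I.size := by
    have h7 : Real.log m ≤ m := (Real.log_le_sub_one_of_pos (by linarith)).trans (by linarith)
    have := mul_le_mul_of_nonneg_left h7 (zero_le_one.trans h.one_le_n)
    linarith [h.mul_n_le_size]
  push_cast at h3
  have h9 : 0 ≤ (I.size - 1) * Real.log T := mul_nonneg (by linarith) hl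
  have h10 : 1 ≤ I.size * (1 + Real.log T) :=
    one_le_mul_of_one_le_of_one_le hP (by linarith)
  have h11 : 0 ≤ (I.size * (1 + Real.log T) - 1) * Real.log (1 / I.δ) :=
    mul_nonneg (by linarith) hlogδ
  linarith

/-- `τ` stands for `T ^ (1 / 5)`; the length of a call is of order `T ^ (4 / 5)`. -/
theorem inv_eps_sq_le (h : I.Admissible) {τ : ℝ} (hτ : 1 ≤ 2 * τ * I.ρ) :
    1 / (2 * I.eps ^ 2) ≤ 2 ^ 23 * (I.size ^ 4 * τ ^ 4) := by
  have hm := h.one_le_m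
  have hn := h.one_le_n
  have hB := h.one_le_B
  have h1 : I.ρ ^ 2 ≤ I.eps * (1024 * I.size ^ 2) := by
    have h0 := h.one_le_size
    have h3 := h.mul_n_le_size
    rw [Input.eps, div_mul_eq_mul_div, le_div_iff₀ (by positivity)]
    refine mul_le_mul_of_nonneg_left ?_ (sq_nonneg _)
    calc 32 ^ 2 * I.B * (m : ℝ) ^ 2 * (I.n : ℝ) ^ 2
        = 1024 * ((m * I.n) * I.size) := by rw [size]; ring
      _ ≤ 1024 * (I.size * I.size) := by gcongr
      _ = _ := by ring
  have h2 : 1 ≤ 16 * (τ ^ 4 * (I.ρ ^ 2) ^ 2) := by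
    have := one_le_pow₀ hτ (n := 4)
    calc (1 : ℝ) ≤ (2 * τ * I.ρ) ^ 4 := this
      _ = _ := by ring
  have h3 : (I.ρ ^ 2) ^ 2 ≤ (I.eps * (1024 * I.size ^ 2)) ^ 2 :=
    pow_le_pow_left₀ (sq_nonneg _) h1 2
  have h4 := mul_le_mul_of_nonneg_left h3 (show (0 : ℝ) ≤ 16 * τ ^ 4 by positivity)
  have h5 := h.eps_pos
  rw [div_le_iff₀ (by positivity)]
  calc (1 : ℝ) ≤ 16 * τ ^ 4 * (I.eps * (1024 * I.size ^ 2)) ^ 2 := by linarith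
    _ = _ := by ring

theorem q_le (h : I.Admissible) {τ T : ℝ} (hτ : 1 ≤ 2 * τ * I.ρ) (hτ1 : 1 ≤ τ) (hT : τ ^ 2 ≤ T)
    (hT1 : 1 ≤ T) : (I.q : ℝ) ≤
      (2 ^ 23 * 88 + 1) * (I.size ^ 5 * (1 + Real.log T) * (1 + Real.log (1 / I.δ)) * τ ^ 4) := by
  have hP := h.one_le_size
  have hl := Real.log_nonneg hT1
  have hlogδ : 0 ≤ Real.log (1 / I.δ) :=
    Real.log_nonneg ((one_le_div h.delta_pos).2 h.delta_lt.le)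
  have h1 : 1 / (2 * I.eps ^ 2) * Real.log (2 * m / I.alpha) ≤ 2 ^ 23 * 88 *
      (I.size ^ 5 * (1 + Real.log T) * (1 + Real.log (1 / I.δ)) * τ ^ 4) := by
    calc _ ≤ 2 ^ 23 * (I.size ^ 4 * τ ^ 4) *
          (88 * (I.size * (1 + Real.log T) * (1 + Real.log (1 / I.δ)))) :=
          mul_le_mul (h.inv_eps_sq_le hτ) (h.log_confidence_le hτ hT hT1) h.log_pos.le
            (by positivity)
      _ = _ := by ring
  have h2 : (0 : ℝ) ≤ 1 / (2 * I.eps ^ 2) * Real.log (2 * m / I.alpha) :=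
    mul_nonneg (by positivity) h.log_pos.le
  have h3 : (I.q : ℝ) ≤ 1 / (2 * I.eps ^ 2) * Real.log (2 * m / I.alpha) + 1 :=
    (Nat.ceil_lt_add_one h2).le
  have h4 : 1 ≤ I.size ^ 5 * (1 + Real.log T) * (1 + Real.log (1 / I.δ)) * τ ^ 4 :=
    one_le_mul_of_one_le_of_one_le (one_le_mul_of_one_le_of_one_le
      (one_le_mul_of_one_le_of_one_le (one_le_pow₀ hP) (by linarith)) (by linarith))
      (one_le_pow₀ hτ1)
  linarith

/-- The regret of the exploration rounds, when the accuracy is of order at least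
`T ^ (-1 / 5)`. -/
theorem exploration_le (h : I.Admissible) {T : ℝ} (hT : 1 ≤ T)
    (hρ : T ^ (-(1 / 5) : ℝ) / 2 ≤ I.ρ) :
    I.q * ((I.later 0 + 1 : ℕ) : ℝ) * (1 + m * I.B) ≤
      (2 ^ 23 * 88 + 1) * 84 * (m : ℝ) ^ I.n * I.size ^ 10 *
        (1 + Real.log (1 / I.δ)) * (1 + Real.log T) ^ 10 * T ^ (4 / 5 : ℝ) := by
  obtain ⟨τ, hτ⟩ : ∃ τ : ℝ, τ = T ^ (1 / 5 : ℝ) := ⟨_, rfl⟩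
  have hτ1 : 1 ≤ τ := hτ ▸ Real.one_le_rpow hT (by norm_num)
  have hτ4 : T ^ (4 / 5 : ℝ) = τ ^ 4 := by
    rw [hτ, ← Real.rpow_natCast, ← Real.rpow_mul (by linarith)]; norm_num
  have hτ2 : τ ^ 2 ≤ T := by
    rw [hτ, ← Real.rpow_natCast, ← Real.rpow_mul (by linarith)]
    calc _ ≤ T ^ (1 : ℝ) := Real.rpow_le_rpow_of_exponent_le hT (by norm_num)
      _ = T := Real.rpow_one T
  have hτρ : 1 ≤ 2 * τ * I.ρ := by
    have h1 : T ^ (-(1 / 5) : ℝ) = τ⁻¹ := by rw [hτ, Real.rpow_neg (by linarith)]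
    rw [h1] at hρ
    have h2 := mul_le_mul_of_nonneg_left hρ (zero_le_one.trans hτ1)
    have h3 : τ * (τ⁻¹ / 2) = 1 / 2 := by field_simp
    linarith
  have hP := h.one_le_size
  have hq := h.q_le hτρ hτ1 hτ2 hT
  have hl := Real.log_nonneg hT
  have hlogδ : 0 ≤ Real.log (1 / I.δ) :=
    Real.log_nonneg ((one_le_div h.delta_pos).2 h.delta_lt.le)
  have hN : ((I.later 0 + 1 : ℕ) : ℝ) ≤
      42 * (I.size ^ 4 * (1 + Real.log T) * (m : ℝ) ^ I.n) := by
    have h0 : 0 ≤ Real.log I.width + I.vertices :=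
      add_nonneg (by linarith [h.nine_le_log]) (Nat.cast_nonneg _)
    have h1 := h.n_le_size
    have h2 := h.log_width_add_vertices_le hτρ hτ2 hT
    refine h.later_le.trans ?_
    calc 2 * (I.n : ℝ) ^ 3 * (Real.log I.width + I.vertices)
        ≤ 2 * I.size ^ 3 * (21 * (I.size * (1 + Real.log T) * (m : ℝ) ^ I.n)) := by gcongr
      _ = _ := by ring
  have hmB : 1 + m * I.B ≤ 2 * I.size := by linarith [h.mul_B_le_size]
  have hB0 : 0 ≤ 1 + m * I.B := by
    have := h.one_le_B
    positivity
  obtain ⟨ℓ, hℓ⟩ : ∃ ℓ : ℝ, ℓ = 1 + Real.log T := ⟨_, rfl⟩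
  obtain ⟨Λ, hΛ⟩ : ∃ Λ : ℝ, Λ = 1 + Real.log (1 / I.δ) := ⟨_, rfl⟩
  have hℓ1 : 1 ≤ ℓ := by linarith
  have hΛ1 : 1 ≤ Λ := by linarith
  rw [hτ4]
  rw [← hℓ] at hN
  rw [← hℓ, ← hΛ] at hq ⊢
  calc I.q * ((I.later 0 + 1 : ℕ) : ℝ) * (1 + m * I.B)
      ≤ (2 ^ 23 * 88 + 1) * (I.size ^ 5 * ℓ * Λ * τ ^ 4) *
        (42 * (I.size ^ 4 * ℓ * (m : ℝ) ^ I.n)) * (2 * I.size) :=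
        mul_le_mul (mul_le_mul hq hN (Nat.cast_nonneg _) (by positivity)) hmB hB0 (by positivity)
    _ = (2 ^ 23 * 88 + 1) * 84 * (m : ℝ) ^ I.n * I.size ^ 10 * Λ * ℓ ^ 2 * τ ^ 4 := by ring
    _ ≤ (2 ^ 23 * 88 + 1) * 84 * (m : ℝ) ^ I.n * I.size ^ 10 * Λ * ℓ ^ 10 * τ ^ 4 := by
        have : ℓ ^ 2 ≤ ℓ ^ 10 := pow_le_pow_right₀ hℓ1 (by norm_num)
        gcongr

end Admissible

end Input

/-- The accuracy is large enough for the exploration to be short, and so small that the loss of all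
remaining rounds is of order `T ^ (4 / 5)`. -/
theorem accuracy_spec {m n T : ℕ} {B : ℝ} (hm : 0 < m) (hn : 0 < n) (hT : 0 < T) (hB : 1 ≤ B) :
    (T : ℝ) ^ (-(1 / 5) : ℝ) / 2 ≤ accuracy m n B T ∧ accuracy m n B T ≤ 1 / 2 ∧
      T * accuracy m n B T ≤ (m : ℝ) ^ n * ((m : ℝ) * n * B) ^ 2 * (T : ℝ) ^ (4 / 5 : ℝ) := by
  have hm1 : (1 : ℝ) ≤ m := by exact_mod_cast hm
  have hn1 : (1 : ℝ) ≤ n := by exact_mod_cast hn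
  have hT1 : (1 : ℝ) ≤ T := by exact_mod_cast hT
  have h1 : (1 : ℝ) ≤ (m : ℝ) ^ ((n : ℝ) / 5) := Real.one_le_rpow hm1 (by positivity)
  have h2 : 1 ≤ B ^ (3 / 5 : ℝ) := Real.one_le_rpow hB (by norm_num)
  have h3 : 1 ≤ (n : ℝ) ^ (8 / 5 : ℝ) := Real.one_le_rpow hn1 (by norm_num)
  have h4 : 0 < (T : ℝ) ^ (-(1 / 5) : ℝ) := Real.rpow_pos_of_pos (by linarith) _
  refine ⟨?_, min_le_right _ _, ?_⟩
  · refine le_min ?_ ?_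
    · have h5 : 1 ≤ (m : ℝ) ^ ((n : ℝ) / 5) * B ^ (3 / 5 : ℝ) * m * (n : ℝ) ^ (8 / 5 : ℝ) :=
        one_le_mul_of_one_le_of_one_le (one_le_mul_of_one_le_of_one_le
          (one_le_mul_of_one_le_of_one_le h1 h2) hm1) h3
      have := mul_le_mul_of_nonneg_right h5 h4.le
      linarith
    · have : (T : ℝ) ^ (-(1 / 5) : ℝ) ≤ 1 := Real.rpow_le_one_of_one_le_of_nonpos hT1 (by norm_num)
      linarith
  · have h5 : (m : ℝ) ^ ((n : ℝ) / 5) ≤ (m : ℝ) ^ n := by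
      rw [← Real.rpow_natCast]
      exact Real.rpow_le_rpow_of_exponent_le hm1 (by linarith)
    have h6 : B ^ (3 / 5 : ℝ) ≤ B := by
      simpa using Real.rpow_le_rpow_of_exponent_le hB (show (3 / 5 : ℝ) ≤ 1 by norm_num)
    have h7 : (n : ℝ) ^ (8 / 5 : ℝ) ≤ (n : ℝ) ^ 2 := by
      rw [← Real.rpow_natCast]
      exact Real.rpow_le_rpow_of_exponent_le hn1 (by norm_num)
    have h8 : (T : ℝ) * (T : ℝ) ^ (-(1 / 5) : ℝ) = (T : ℝ) ^ (4 / 5 : ℝ) := by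
      rw [← Real.rpow_one_add' (by linarith) (by norm_num)]; norm_num
    calc T * accuracy m n B T
        ≤ T * ((m : ℝ) ^ ((n : ℝ) / 5) * B ^ (3 / 5 : ℝ) * m * (n : ℝ) ^ (8 / 5 : ℝ) *
          (T : ℝ) ^ (-(1 / 5) : ℝ)) :=
          mul_le_mul_of_nonneg_left (min_le_left _ _) (by linarith)
      _ = (m : ℝ) ^ ((n : ℝ) / 5) * (B ^ (3 / 5 : ℝ) * m * (n : ℝ) ^ (8 / 5 : ℝ)) *
          (T : ℝ) ^ (4 / 5 : ℝ) := by rw [← h8]; ring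
      _ ≤ (m : ℝ) ^ n * (B * m * (n : ℝ) ^ 2) * (T : ℝ) ^ (4 / 5 : ℝ) := by gcongr
      _ ≤ _ := by
          refine mul_le_mul_of_nonneg_right (mul_le_mul_of_nonneg_left ?_ (by positivity))
            (by positivity)
          calc B * m * (n : ℝ) ^ 2 ≤ B * m * (n : ℝ) ^ 2 * (B * m) :=
                le_mul_of_one_le_right (by positivity) (one_le_mul_of_one_le_of_one_le hB hm1)
            _ = _ := by ring

end HiddenAction

theorem theorem3 :
    ∃ K : ℝ, 0 < K ∧ ∃ k : ℕ,
      ∀ (m n T : ℕ) (B δ : ℝ) (S : HiddenAction.Setting m n)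
        (a : HiddenAction.Contract m → Fin n) (σ : HiddenAction.Selection m),
        0 < T → 1 ≤ B → 0 < δ → δ < 1 → S.IsResponse a →
          1 - δ ≤ S.prob a (HiddenAction.exploreThenCommit n S.r B δ T σ)
            {w : Fin T → Fin m |
              S.regret a B (HiddenAction.exploreThenCommit n S.r B δ T σ) w ≤
                K * (m : ℝ) ^ n * ((m : ℝ) * n * B) ^ k * (1 + Real.log (1 / δ)) *
                  (1 + Real.log T) ^ k * (T : ℝ) ^ (4 / 5 : ℝ)} := by
  open HiddenAction in
  refine ⟨(2 ^ 23 * 88 + 1) * 84 + 2, by norm_num, 10, ?_⟩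
  intro m n T B δ S a σ hT hB hδ0 hδ1 ha
  obtain ⟨b, -⟩ := S.exists_free
  have hn : 0 < n := b.pos
  have hm : 0 < m := by
    rcases Nat.eq_zero_or_pos m with rfl | hm
    · have := S.F_sum b
      simp at this
    · exact hm
  have hT1 : (1 : ℝ) ≤ T := by exact_mod_cast hT
  obtain ⟨hρ1, hρ2, hρ3⟩ := accuracy_spec hm hn hT hB
  let I : Input m := { n := n, r := S.r, B := B, ρ := accuracy m n B T, δ := δ }
  have hI : I.Admissible := ⟨hm, hn, hB,
    lt_of_lt_of_le (div_pos (Real.rpow_pos_of_pos (by linarith) _) two_pos) hρ1, hρ2, hδ0, hδ1⟩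
  have hs : Standing I S a := hI.standing rfl ha
  refine S.prob_ge_of_forall ((prob_not_good_le hs hI.alpha_pos.le hI.q_pos hI.exp_le_alpha σ
    T).trans hI.later_mul_alpha_le) fun w hw => ?_
  have hG : ∀ t ≤ T, Good I S a t (stateAfter I σ ((List.ofFn w).take t)) := by
    intro t ht
    by_contra h
    exact hw ⟨t, ht, h⟩
  have h1 := regret_le I S a hs σ w hG
  have h2 := hI.exploration_le hT1 hρ1
  have h3 := mul_le_mul_of_nonneg_left hI.loss_le (Nat.cast_nonneg (α := ℝ) T)
  have hP : 1 ≤ (m : ℝ) * n * B := one_le_mul_of_one_le_of_one_le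
    (one_le_mul_of_one_le_of_one_le (by exact_mod_cast hm) (by exact_mod_cast hn)) hB
  have hℓ : 1 ≤ (1 + Real.log T) ^ 10 :=
    one_le_pow₀ (by linarith [Real.log_nonneg hT1])
  have hΛ : 1 ≤ 1 + Real.log (1 / δ) := by
    linarith [Real.log_nonneg ((one_le_div hδ0).2 hδ1.le)]
  have h4 : (m : ℝ) ^ n * ((m : ℝ) * n * B) ^ 2 * (T : ℝ) ^ (4 / 5 : ℝ) ≤
      (m : ℝ) ^ n * ((m : ℝ) * n * B) ^ 10 * (1 + Real.log (1 / δ)) * (1 + Real.log T) ^ 10 *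
        (T : ℝ) ^ (4 / 5 : ℝ) := by
    refine mul_le_mul_of_nonneg_right ?_ (by positivity)
    have h5 : ((m : ℝ) * n * B) ^ 2 ≤ ((m : ℝ) * n * B) ^ 10 :=
      pow_le_pow_right₀ hP (by norm_num)
    calc (m : ℝ) ^ n * ((m : ℝ) * n * B) ^ 2
        ≤ (m : ℝ) ^ n * ((m : ℝ) * n * B) ^ 10 := by gcongr
      _ ≤ (m : ℝ) ^ n * ((m : ℝ) * n * B) ^ 10 * ((1 + Real.log (1 / δ)) *
          (1 + Real.log T) ^ 10) :=
          le_mul_of_one_le_right (by positivity) (one_le_mul_of_one_le_of_one_le hΛ hℓ)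
      _ = _ := by ring
  show S.regret a I.B (discoverAndCover I σ) w ≤ _
  change _ ≤ (2 ^ 23 * 88 + 1) * 84 * (m : ℝ) ^ n * ((m : ℝ) * n * B) ^ 10 *
    (1 + Real.log (1 / δ)) * (1 + Real.log T) ^ 10 * (T : ℝ) ^ (4 / 5 : ℝ) at h2
  have h6 : I.ρ = accuracy m n B T := rfl
  rw [h6] at h3
  linarith
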